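/- Let $\mathbf T=\mathbb R/2\pi\mathbb Z$ carry the measure $d\theta/2\pi$, let $N,\lambda>0$, and let $\Omega_N=\{u\in L^2(\mathbf T;\mathbb C):\int_{\mathbf T}|u|^2\,d\theta/2\pi\le N\}$ with the metric of the norm $\|\cdot\|_{L^2}$. Let $\gamma$ be the law on $L^2(\mathbf T;\mathbb C)$ of the Brownian loop $\sum_{j\in\mathbb Z,\,j\ne0}e^{ij\theta}(\gamma_j+i\gamma_j')/j$, where $\gamma_j,\gamma_j'$ are mutually independent standard real Gaussian variables. The Gibbs measure of the focussing cubic periodic nonlinear Schrödinger equation (space dimension $D=1$, exponent $p=4$) is $$\nu(du)=Z^{-1}\,\mathbf 1_{\Omega_N}(u)\,\exp\Bigl(\frac\lambda4\int_{\mathbf T}|u|^4\,\frac{d\theta}{2\pi}\Bigr)\gamma(du),$$ normalized by $Z=Z(N,\lambda)$. For $n\ge0$ let $P_n$ be the Dirichlet projection of $L^2(\mathbf T;\mathbb C)$ onto $\mathrm{span}\{e^{ij\theta}:|j|\le n\}$, let $X^n=\Omega_N\cap P_nL^2$, and let $$\nu_n(du)=Z_n^{-1}\,\mathbf 1_{\Omega_N}(u)\,\exp\Bigl(\frac\lambda4\int_{\mathbf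 T}|u|^4\,\frac{d\theta}{2\pi}\Bigr)\,(\gamma\circ P_n^{-1})(du)$$ on $X^n$, normalized by $Z_n$. Put $\hat X^\infty=(\Omega_N,\|\cdot\|_{L^2},\nu)$ and $\hat X^n=(X^n,\|\cdot\|_{L^2},\nu_n)$. For a metric space $(X,d)$ and $f:X\to\mathbb R$ write $|\nabla f|(x)=\limsup_{y\to x}|f(y)-f(x)|/d(x,y)\in[0,\infty]$. For $\alpha>0$, a complete separable length space $(X,d)$ without isolated points, with a Borel probability measure $\mu$, satisfies $LSI(\alpha)$ if for every $f\in L^2(\mu)$ such that $|\nabla f|$ is finite at every point and belongs to $L^2(\mu)$, the function $f^2\log\bigl(f^2/\int f^2d\mu\bigr)$ is $\mu$-integrable and $$\int_Xf^2\log\Bigl(f^2\Big/\int_Xf^2d\mu\Bigr)d\mu\le\frac2\alpha\int_X|\nabla f|^2d\mu .$$ The diameter of $(X,d,\mu)$ is the supremum of $d(x,y)$ over $x,y$ in the support of $\mu$. The $L^2$ transportation distance of $(X,d_1,\mu_1)$ and $(Y,d_2,\mu_2)$ is $$D_{L^2}=\inf_{\delta,\pi}\Bigl(\iint_{X\times Y}\delta(x,y)^2\,\pi(dx\,dy)\Bigr)^{1/2},$$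 over all pseudo metrics $\delta:(X\sqcup Y)^2\to[0,\infty]$ that restrict to $d_1$ on $X$ and to $d_2$ on $Y$, and all probability measures $\pi$ on $X\times Y$ with marginals $\mu_1$ and $\mu_2$. **Theorem.** Let $0<N\lambda<3/(14\pi^2)$. Then $\nu$ and all $\nu_n$ are well-defined probability measures ($0<Z,Z_n<\infty$) and $\hat X^\infty$, $\hat X^n$ are complete separable metric spaces with Borel probability measures; $\hat X^\infty$ has finite diameter and satisfies $LSI\bigl(1-14\pi^2N\lambda/3\bigr)$; and $D_{L^2}(\hat X^n,\hat X^\infty)\to0$ as $n\to\infty$. -/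

import Mathlib

open MeasureTheory ProbabilityTheory Filter Topology
open scoped ENNReal

noncomputable section

namespace NLSGibbs

/-! ### Metric probability spaces -/

section MetricMeasure

variable {X Y : Type*} [MetricSpace X] [MetricSpace Y]

/-- The norm of the gradient `|∇f|(x) = limsup_{y → x, y ≠ x} |f y - f x| / d(x, y)`, with values
in `[0, ∞]`. -/
def gradNorm (f : X → ℝ) (x : X) : ℝ≥0∞ :=
  limsup (fun y => edist (f y) (f x) / edist y x) (𝓝[≠] x)

/-- `X` is a length space: the distance of two points is the infimum of the lengths of the
continuous paths that join them. -/
def IsLengthSpace (X : Type*) [MetricSpace X] : Prop :=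
  ∀ x y : X, edist x y = ⨅ γ : Path x y, eVariationOn γ Set.univ

/-- `(X, d, μ)` is a metric probability space: `(X, d)` is complete and separable and `μ` is a
Borel probability measure (which is then automatically a Radon measure). -/
structure IsMetricProbabilitySpace [MeasurableSpace X] (μ : Measure X) : Prop where
  borel : BorelSpace X
  complete : CompleteSpace X
  separable : TopologicalSpace.SeparableSpace X
  prob : IsProbabilityMeasure μ

/-- The diameter of `(X, d, μ)`, that is, the supremum of the distances of points of the support
of `μ`. -/
def mmDiam [MeasurableSpace X] (μ : Measure X) : ℝ≥0∞ :=
  Metric.ediam μ.support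

/-- The logarithmic Sobolev inequality `LSI(α)` on a metric probability space that is a length
space without isolated points. The functions are those `f ∈ L²(μ)` whose gradient norm is a
real-valued function (finite at every point) in `L²(μ)`. The entropy integral is asserted to be
convergent. -/
structure SatisfiesLSI [MeasurableSpace X] (μ : Measure X) (α : ℝ) : Prop where
  space : IsMetricProbabilitySpace μ
  length : IsLengthSpace X
  noIsolated : ∀ x : X, (𝓝[≠] x).NeBot
  pos : 0 < α
  lsi : ∀ f : X → ℝ, MemLp f 2 μ → (∀ x, gradNorm f x ≠ ∞) →
    MemLp (fun x => (gradNorm f x).toReal) 2 μ →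
    Integrable (fun x => f x ^ 2 * Real.log (f x ^ 2 / ∫ y, f y ^ 2 ∂μ)) μ ∧
      ∫ x, f x ^ 2 * Real.log (f x ^ 2 / ∫ y, f y ^ 2 ∂μ) ∂μ
        ≤ 2 / α * ∫ x, (gradNorm f x).toReal ^ 2 ∂μ

/-- A coupling of the metrics of `X` and `Y`: a pseudo metric on the disjoint union `X ⊔ Y`, with
values in `[0, ∞]`, which restricts to the given metrics on `X` and on `Y`. -/
structure IsMetricCoupling (δ : X ⊕ Y → X ⊕ Y → ℝ≥0∞) : Prop where
  self : ∀ z, δ z z = 0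
  symm : ∀ z w, δ z w = δ w z
  triangle : ∀ z w v, δ z v ≤ δ z w + δ w v
  left : ∀ x x' : X, δ (Sum.inl x) (Sum.inl x') = edist x x'
  right : ∀ y y' : Y, δ (Sum.inr y) (Sum.inr y') = edist y y'

/-- Sturm's `L²` transportation distance between `(X, d, μ)` and `(Y, d', ν)`: the infimum of
`(∬ δ(x, y)² π(dx dy))^{1/2}` over all couplings `δ` of the metrics and all transportation plans
`π` with marginals `μ` and `ν`. -/
def transportDist [MeasurableSpace X] [MeasurableSpace Y] (μ : Measure X) (ν : Measure Y) :
    ℝ≥0∞ :=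
  ⨅ (δ : X ⊕ Y → X ⊕ Y → ℝ≥0∞) (_ : IsMetricCoupling δ) (π : Measure (X × Y))
    (_ : π.map Prod.fst = μ) (_ : π.map Prod.snd = ν),
    (∫⁻ p, δ (Sum.inl p.1) (Sum.inr p.2) ^ 2 ∂π) ^ (1 / 2 : ℝ)

end MetricMeasure

/-! ### Fields on the circle -/

instance twoPiPos : Fact (0 < 2 * Real.pi) := ⟨Real.two_pi_pos⟩

/-- The circle `𝐓 = ℝ / 2πℤ`. -/
abbrev Circ : Type := AddCircle (2 * Real.pi)

/-- The normalized Lebesgue measure `dθ / 2π` on the circle. -/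
abbrev circMeasure : Measure Circ := AddCircle.haarAddCircle

/-- `L²(𝐓, dθ / 2π; ℂ)`. -/
abbrev Field2 : Type := Lp ℂ 2 circMeasure

instance : MeasurableSpace Field2 := borel Field2

instance : BorelSpace Field2 := ⟨rfl⟩

/-- The ball `Ω_N = {u ∈ L² : ∫ |u|² dθ/2π ≤ N}`. -/
def ball (N : ℝ) : Set Field2 :=
  {u | ∫ θ, ‖u θ‖ ^ 2 ∂circMeasure ≤ N}

/-- The joint law of the mutually independent standard Gaussian variables
`(γ_j, γ_j')`, `j ∈ ℤ \ {0}`. -/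
def gaussianLaw : Measure ({j : ℤ // j ≠ 0} → ℝ × ℝ) :=
  Measure.infinitePi fun _ => (gaussianReal 0 1).prod (gaussianReal 0 1)

/-- The random Fourier series `∑_{j ≠ 0} e^{ijθ} (γ_j + i γ_j') / j`; it converges in `L²` for
almost every choice of the Gaussian variables. -/
def loopSeries (ω : {j : ℤ // j ≠ 0} → ℝ × ℝ) : Field2 :=
  ∑' j : {j : ℤ // j ≠ 0},
    (((ω j).1 + (ω j).2 * Complex.I) / (j : ℤ) : ℂ) • fourierLp 2 (j : ℤ)

/-- The measure `∏_{j ≠ 0} exp(-j² (a_j² + b_j²) / 2) j² da_j db_j / 2π` in the Fourier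
coefficients `a_j + i b_j`, that is, the law of Brownian loop on `L²`. -/
def loopMeasure : Measure Field2 := gaussianLaw.map loopSeries

/-- The Dirichlet projection `P_n` of `L²` onto `span {e^{ijθ} : |j| ≤ n}`. -/
def dirichlet (n : ℕ) (u : Field2) : Field2 :=
  ∑ j ∈ Finset.Icc (-(n : ℤ)) n, fourierCoeff u j • fourierLp 2 j

/-- The unnormalized Gibbs measure on the set `S` of fields, with reference measure `m`:
`I_S(u) exp((lam / 4) ∫ |u|⁴ dθ/2π) m(du)`. (Almost every field for the reference measures that
are used below is in `L⁴`.) -/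
def gibbsWeight (S : Set Field2) (m : Measure Field2) (lam : ℝ) : Measure S :=
  (m.comap Subtype.val).withDensity fun u =>
    ENNReal.ofReal (Real.exp (lam / 4 * ∫ θ, ‖(u : Field2) θ‖ ^ 4 ∂circMeasure))

/-- The Gibbs measure on `S`, normalized by the partition function. -/
def gibbsOn (S : Set Field2) (m : Measure Field2) (lam : ℝ) : Measure S :=
  (gibbsWeight S m lam Set.univ)⁻¹ • gibbsWeight S m lam

/-- The Gibbs measure `ν` of the focussing cubic NLS on `Ω_N`. The part
`exp(-½ ∫ |∂u/∂θ|² dθ/2π)` of `exp(-H(u))` is contained in the loop measure. -/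
def gibbs (N lam : ℝ) : Measure (ball N) := gibbsOn (ball N) loopMeasure lam

/-- The finite-dimensional phase space `X^n = Ω_N ∩ P_n L²`. -/
def truncBall (N : ℝ) (n : ℕ) : Set Field2 := ball N ∩ Set.range (dirichlet n)

/-- The Gibbs measure `ν_n` of the truncated Hamiltonian on `X^n`; its reference measure is the
image of the loop measure under `P_n`, in Fourier coefficients
`∏_{0 < |j| ≤ n} exp(-j² (a_j² + b_j²) / 2) j² da_j db_j / 2π`. -/
def truncGibbs (N lam : ℝ) (n : ℕ) : Measure (truncBall N n) :=
  gibbsOn (truncBall N n) (loopMeasure.map (dirichlet n)) lam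

end NLSGibbs

end

noncomputable section

namespace NLSGibbs

/-! ### The Prékopa–Leindler inequality -/

section PrekopaLeindler

open scoped Pointwise

/-- The one-dimensional Brunn–Minkowski inequality for compact sets. -/
theorem volume_add_le_of_isCompact {t s : ℝ} (ht : 0 < t) (hs : 0 < s) {A B C : Set ℝ}
    (hA : IsCompact A) (hB : IsCompact B) (hA0 : A.Nonempty) (hB0 : B.Nonempty)
    (hC : ∀ x ∈ A, ∀ y ∈ B, t * x + s * y ∈ C) :
    ENNReal.ofReal t * volume A + ENNReal.ofReal s * volume B ≤ volume C := by
  obtain ⟨a, haA, ha⟩ := hA.exists_isGreatest hA0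
  obtain ⟨b, hbB, hb⟩ := hB.exists_isLeast hB0
  set A' : Set ℝ := (fun x => x + s * b) '' (t • A)
  set B' : Set ℝ := (fun x => x + t * a) '' (s • B)
  have hvA : volume A' = ENNReal.ofReal t * volume A := by
    simp [A', Measure.addHaar_smul, abs_of_pos ht]
  have hvB : volume B' = ENNReal.ofReal s * volume B := by
    simp [B', Measure.addHaar_smul, abs_of_pos hs]
  have hsub : A' ∪ B' ⊆ C := by
    rintro _ (⟨_, ⟨x, hx, rfl⟩, rfl⟩ | ⟨_, ⟨x, hx, rfl⟩, rfl⟩)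
    · exact hC x hx b hbB
    · have := hC a haA x hx
      simpa [add_comm] using this
  have hBm : MeasurableSet B' :=
    ((hB.smul s).image (by fun_prop)).isClosed.measurableSet
  have hdis : AEDisjoint volume A' B' := by
    refine measure_mono_null (t := {t * a + s * b}) ?_ (by simp)
    rintro _ ⟨⟨_, ⟨x, hx, rfl⟩, rfl⟩, ⟨_, ⟨y, hy, rfl⟩, h⟩⟩
    have h1 : t * x ≤ t * a := mul_le_mul_of_nonneg_left (ha hx) ht.le
    have h2 : s * b ≤ s * y := mul_le_mul_of_nonneg_left (hb hy) hs.le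
    simp only [smul_eq_mul, Set.mem_singleton_iff] at h ⊢
    linarith
  calc _ = volume (A' ∪ B') := by
        rw [measure_union₀ hBm.nullMeasurableSet hdis, hvA, hvB]
    _ ≤ _ := measure_mono hsub

/-- The one-dimensional Brunn–Minkowski inequality. -/
theorem volume_add_le {t s : ℝ} (ht : 0 < t) (hs : 0 < s) {A B C : Set ℝ}
    (hA : MeasurableSet A) (hB : MeasurableSet B) (hA0 : A.Nonempty) (hB0 : B.Nonempty)
    (hC : ∀ x ∈ A, ∀ y ∈ B, t * x + s * y ∈ C) :
    ENNReal.ofReal t * volume A + ENNReal.ofReal s * volume B ≤ volume C := by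
  obtain ⟨a, ha⟩ := hA0
  obtain ⟨b, hb⟩ := hB0
  have key : ∀ K₁ ⊆ A, IsCompact K₁ → ∀ K₂ ⊆ B, IsCompact K₂ →
      ENNReal.ofReal t * volume K₁ + ENNReal.ofReal s * volume K₂ ≤ volume C := by
    intro K₁ h1 hK1 K₂ h2 hK2
    refine le_trans ?_ (volume_add_le_of_isCompact ht hs (hK1.insert a) (hK2.insert b)
      (Set.insert_nonempty _ _) (Set.insert_nonempty _ _)
      (fun x hx y hy => hC x (Set.insert_subset ha h1 hx) y (Set.insert_subset hb h2 hy)))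
    gcongr <;> exact Set.subset_insert _ _
  rw [hA.measure_eq_iSup_isCompact, hB.measure_eq_iSup_isCompact]
  simp only [ENNReal.mul_iSup]
  refine ENNReal.biSup_add_biSup_le' (p := fun K => K ⊆ A) (q := fun K => K ⊆ B)
    ⟨∅, Set.empty_subset _⟩ ⟨∅, Set.empty_subset _⟩ ?_
  intro K₁ h1 K₂ h2
  by_cases hK1 : IsCompact K₁
  · by_cases hK2 : IsCompact K₂
    · simpa [hK1, hK2] using key K₁ h1 hK1 K₂ h2 hK2
    · simpa [hK1, hK2] using key K₁ h1 hK1 ∅ (Set.empty_subset _) isCompact_empty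
  · by_cases hK2 : IsCompact K₂
    · simpa [hK1, hK2] using key ∅ (Set.empty_subset _) isCompact_empty K₂ h2 hK2
    · simp [hK1, hK2]

/-- An additive form of the one-dimensional Prékopa–Leindler inequality, for functions with
supremum one. -/
theorem lintegral_add_le_of_superlevel {t s : ℝ} (ht : 0 < t) (hs : 0 < s)
    {f g h : ℝ → ℝ} (hf : Measurable f) (hg : Measurable g) (hh : Measurable h)
    (hf0 : ∀ x, 0 ≤ f x) (hg0 : ∀ x, 0 ≤ g x) (hh0 : ∀ x, 0 ≤ h x)
    (hf1 : ∀ x, f x ≤ 1) (hg1 : ∀ x, g x ≤ 1)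
    (hfs : ∀ τ < 1, ∃ x, τ < f x) (hgs : ∀ τ < 1, ∃ x, τ < g x)
    (H : ∀ τ x y, τ < f x → τ < g y → τ < h (t * x + s * y)) :
    (ENNReal.ofReal t * ∫⁻ x, ENNReal.ofReal (f x)) +
      ENNReal.ofReal s * ∫⁻ x, ENNReal.ofReal (g x) ≤ ∫⁻ x, ENNReal.ofReal (h x) := by
  rw [lintegral_eq_lintegral_meas_lt _ (ae_of_all _ hf0) hf.aemeasurable,
    lintegral_eq_lintegral_meas_lt _ (ae_of_all _ hg0) hg.aemeasurable,
    lintegral_eq_lintegral_meas_lt _ (ae_of_all _ hh0) hh.aemeasurable]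
  rw [← lintegral_const_mul' _ _ ENNReal.ofReal_ne_top,
    ← lintegral_const_mul' _ _ ENNReal.ofReal_ne_top, ← lintegral_add_left']
  · refine lintegral_mono fun τ => ?_
    by_cases hτ : τ < 1
    · exact volume_add_le ht hs (measurableSet_lt measurable_const hf)
        (measurableSet_lt measurable_const hg) (hfs τ hτ) (hgs τ hτ)
        (fun x hx y hy => H τ x y hx hy)
    · have h1 : {a | τ < f a} = ∅ := by
        ext x; simpa using (hf1 x).trans (not_lt.mp hτ)
      have h2 : {a | τ < g a} = ∅ := by
        ext x; simpa using (hg1 x).trans (not_lt.mp hτ)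
      simp [h1, h2]
  · refine Measurable.aemeasurable (Measurable.const_mul ?_ _)
    exact Antitone.measurable fun a b hab => measure_mono fun x hx => lt_of_le_of_lt hab hx

theorem ENNReal_geom_mean_le_arith_mean {t s : ℝ} (ht : 0 < t) (hs : 0 < s) (hts : t + s = 1)
    (a b : ℝ≥0∞) : a ^ t * b ^ s ≤ ENNReal.ofReal t * a + ENNReal.ofReal s * b := by
  induction a with
  | top => simp [ENNReal.mul_top, ht]
  | coe a =>
    induction b with
    | top => simp [ENNReal.mul_top, hs]
    | coe b =>
      have := NNReal.geom_mean_le_arith_mean2_weighted ⟨t, ht.le⟩ ⟨s, hs.le⟩ a b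
        (by ext; exact hts)
      rw [← ENNReal.coe_rpow_of_nonneg _ ht.le, ← ENNReal.coe_rpow_of_nonneg _ hs.le,
        ENNReal.ofReal_eq_coe_nnreal ht.le, ENNReal.ofReal_eq_coe_nnreal hs.le]
      exact_mod_cast this

/-- The Prékopa–Leindler inequality holds for the measure `μ`. -/
def PrekopaLeindler {E : Type*} [AddCommGroup E] [Module ℝ E] [MeasurableSpace E]
    (μ : Measure E) : Prop :=
  ∀ t s : ℝ, 0 < t → 0 < s → t + s = 1 → ∀ f g h : E → ℝ≥0∞, Measurable f → Measurable g →
    Measurable h → (∀ x y, f x ^ t * g y ^ s ≤ h (t • x + s • y)) →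
    (∫⁻ x, f x ∂μ) ^ t * (∫⁻ x, g x ∂μ) ^ s ≤ ∫⁻ x, h x ∂μ

theorem prekopaLeindler_real_of_bounded {t s : ℝ} (ht : 0 < t) (hs : 0 < s) (hts : t + s = 1)
    {f g h : ℝ → ℝ≥0∞} (hf : Measurable f) (hg : Measurable g) (hh : Measurable h)
    {M : ℝ≥0∞} (hM : M ≠ ∞) (hfM : ∀ x, f x ≤ M) (hgM : ∀ x, g x ≤ M)
    (H : ∀ x y, f x ^ t * g y ^ s ≤ h (t * x + s * y)) :
    (∫⁻ x, f x) ^ t * (∫⁻ x, g x) ^ s ≤ ∫⁻ x, h x := by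
  set a := ⨆ x, f x
  set b := ⨆ x, g x
  have ha : a ≠ ∞ := ne_top_of_le_ne_top hM (iSup_le hfM)
  have hb : b ≠ ∞ := ne_top_of_le_ne_top hM (iSup_le hgM)
  rcases eq_or_ne a 0 with ha0 | ha0
  · have : ∀ x, f x = 0 := by simpa [a] using ha0
    simp [this, ht]
  rcases eq_or_ne b 0 with hb0 | hb0
  · have : ∀ x, g x = 0 := by simpa [b] using hb0
    simp [this, hs]
  set c := a ^ t * b ^ s
  have hc0 : c ≠ 0 := by simp [c, ha0, hb0, ha, hb]
  have hc : c ≠ ∞ := by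
    simp only [c]; finiteness
  have fa : ∀ x, f x / a ≤ 1 := fun x => ENNReal.div_le_of_le_mul (by simpa using le_iSup f x)
  have gb : ∀ x, g x / b ≤ 1 := fun x => ENNReal.div_le_of_le_mul (by simpa using le_iSup g x)
  have fa' : ∀ x, f x / a ≠ ∞ := fun x => ne_top_of_le_ne_top (by simp) (fa x)
  have gb' : ∀ x, g x / b ≠ ∞ := fun x => ne_top_of_le_ne_top (by simp) (gb x)
  have hs' : ∀ x, min (h x / c) 1 ≠ ∞ := fun x => ne_top_of_le_ne_top (by simp) (min_le_right _ _)
  have key := lintegral_add_le_of_superlevel ht hs (f := fun x => (f x / a).toReal)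
    (g := fun x => (g x / b).toReal) (h := fun x => (min (h x / c) 1).toReal)
    (by fun_prop) (by fun_prop) (by fun_prop)
    (fun _ => ENNReal.toReal_nonneg) (fun _ => ENNReal.toReal_nonneg)
    (fun _ => ENNReal.toReal_nonneg)
    (fun x => ENNReal.toReal_le_of_le_ofReal zero_le_one (by simpa using fa x))
    (fun x => ENNReal.toReal_le_of_le_ofReal zero_le_one (by simpa using gb x)) ?_ ?_ ?_
  · simp only [ENNReal.ofReal_toReal (fa' _), ENNReal.ofReal_toReal (gb' _),
      ENNReal.ofReal_toReal (hs' _)] at key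
    have e1 : ∫⁻ x, f x = a * ∫⁻ x, f x / a := by
      rw [← lintegral_const_mul' _ _ ha]
      exact lintegral_congr fun x => (ENNReal.mul_div_cancel ha0 ha).symm
    have e2 : ∫⁻ x, g x = b * ∫⁻ x, g x / b := by
      rw [← lintegral_const_mul' _ _ hb]
      exact lintegral_congr fun x => (ENNReal.mul_div_cancel hb0 hb).symm
    have e3 : c * ∫⁻ x, min (h x / c) 1 ≤ ∫⁻ x, h x := by
      rw [← lintegral_const_mul' _ _ hc]
      refine lintegral_mono fun x => ?_
      calc c * min (h x / c) 1 ≤ c * (h x / c) := by gcongr; exact min_le_left _ _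
        _ = h x := ENNReal.mul_div_cancel hc0 hc
    rw [e1, e2, ENNReal.mul_rpow_of_nonneg _ _ ht.le, ENNReal.mul_rpow_of_nonneg _ _ hs.le]
    refine le_trans ?_ e3
    calc a ^ t * (∫⁻ x, f x / a) ^ t * (b ^ s * (∫⁻ x, g x / b) ^ s)
        = c * ((∫⁻ x, f x / a) ^ t * (∫⁻ x, g x / b) ^ s) := by simp only [c]; ring
      _ ≤ c * ∫⁻ x, min (h x / c) 1 := by
        gcongr
        exact (ENNReal_geom_mean_le_arith_mean ht hs hts _ _).trans key
  · intro τ hτ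
    by_contra! hcon
    have : a ≤ a * ENNReal.ofReal τ := by
      refine iSup_le fun x => ?_
      calc f x = a * (f x / a) := (ENNReal.mul_div_cancel ha0 ha).symm
        _ ≤ _ := by gcongr; exact (ENNReal.le_ofReal_iff_toReal_le (fa' x)
                      (ENNReal.toReal_nonneg.trans (hcon x))).2 (hcon x)
    have h2 : a * ENNReal.ofReal τ < a * 1 := by
      refine (ENNReal.mul_lt_mul_iff_right ha0 ha).2 ?_
      rw [← ENNReal.ofReal_one]; exact ENNReal.ofReal_lt_ofReal_iff'.2 ⟨hτ, one_pos⟩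
    rw [mul_one] at h2
    exact absurd this (not_le.2 h2)
  · intro τ hτ
    by_contra! hcon
    have : b ≤ b * ENNReal.ofReal τ := by
      refine iSup_le fun x => ?_
      calc g x = b * (g x / b) := (ENNReal.mul_div_cancel hb0 hb).symm
        _ ≤ _ := by gcongr; exact (ENNReal.le_ofReal_iff_toReal_le (gb' x)
                      (ENNReal.toReal_nonneg.trans (hcon x))).2 (hcon x)
    have h2 : b * ENNReal.ofReal τ < b * 1 := by
      refine (ENNReal.mul_lt_mul_iff_right hb0 hb).2 ?_
      rw [← ENNReal.ofReal_one]; exact ENNReal.ofReal_lt_ofReal_iff'.2 ⟨hτ, one_pos⟩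
    rw [mul_one] at h2
    exact absurd this (not_le.2 h2)
  · intro τ x y hx hy
    have h1 : min (f x / a) (g y / b) ≤ min (h (t * x + s * y) / c) 1 := by
      refine le_min ?_ ((min_le_left _ _).trans (fa x))
      set m := min (f x / a) (g y / b)
      calc m = m ^ t * m ^ s := by
            rw [← ENNReal.rpow_add_of_nonneg _ _ ht.le hs.le, hts, ENNReal.rpow_one]
        _ ≤ (f x / a) ^ t * (g y / b) ^ s := by
            gcongr
            · exact min_le_left _ _
            · exact min_le_right _ _
        _ = f x ^ t * g y ^ s / c := by
            rw [ENNReal.div_rpow_of_nonneg _ _ ht.le, ENNReal.div_rpow_of_nonneg _ _ hs.le]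
            simp only [c]
            rw [ENNReal.mul_div_mul_comm]
            · left; finiteness
            · left; simp [ha0, ha]
        _ ≤ _ := by gcongr; exact H x y
    have h2 := ENNReal.toReal_mono (hs' _) h1
    refine lt_of_lt_of_le ?_ h2
    rw [ENNReal.toReal_min (fa' x) (gb' y)]
    exact lt_min hx hy

theorem prekopaLeindler_real : PrekopaLeindler (volume : Measure ℝ) := by
  intro t s ht hs hts f g h hf hg hh H
  have key : ∀ n : ℕ, (∫⁻ x, min (f x) n) ^ t * (∫⁻ x, min (g x) n) ^ s ≤ ∫⁻ x, h x := by
    intro n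
    refine prekopaLeindler_real_of_bounded ht hs hts (hf.min measurable_const)
      (hg.min measurable_const) hh (ENNReal.natCast_ne_top n) (fun x => min_le_right _ _)
      (fun x => min_le_right _ _) fun x y => le_trans ?_ (H x y)
    gcongr <;> exact min_le_left _ _
  have lim : ∀ u : ℝ → ℝ≥0∞, Measurable u →
      Tendsto (fun n : ℕ => ∫⁻ x, min (u x) n) atTop (𝓝 (∫⁻ x, u x)) := by
    intro u hu
    refine lintegral_tendsto_of_tendsto_of_monotone (fun n => (hu.min measurable_const).aemeasurable)
      (ae_of_all _ fun x m n hmn => by dsimp only; gcongr) (ae_of_all _ fun x => ?_)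
    simpa using tendsto_const_nhds.min ENNReal.tendsto_nat_nhds_top
  rcases eq_or_ne (∫⁻ x, f x) 0 with h0 | h0
  · simp [h0, ht]
  rcases eq_or_ne (∫⁻ x, g x) 0 with h0' | h0'
  · simp [h0', hs]
  refine le_of_tendsto (ENNReal.Tendsto.mul (((ENNReal.continuous_rpow_const).tendsto _).comp
    (lim f hf)) (Or.inl ?_) (((ENNReal.continuous_rpow_const).tendsto _).comp (lim g hg))
    (Or.inl ?_)) (Eventually.of_forall key)
  · simp [h0, ht, ht.le]
  · simp [h0', hs, hs.le]

theorem PrekopaLeindler.prod {E F : Type*} [AddCommGroup E] [Module ℝ E] [MeasurableSpace E]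
    [AddCommGroup F] [Module ℝ F] [MeasurableSpace F] {μ : Measure E} {ν : Measure F} [SFinite ν]
    (hμ : PrekopaLeindler μ) (hν : PrekopaLeindler ν) : PrekopaLeindler (μ.prod ν) := by
  intro t s ht hs hts f g h hf hg hh H
  rw [lintegral_prod _ hf.aemeasurable, lintegral_prod _ hg.aemeasurable,
    lintegral_prod _ hh.aemeasurable]
  refine hμ t s ht hs hts _ _ _ hf.lintegral_prod_right' hg.lintegral_prod_right'
    hh.lintegral_prod_right' fun x x' => ?_
  exact hν t s ht hs hts _ _ _ (by fun_prop) (by fun_prop) (by fun_prop)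
    fun y y' => H (x, y) (x', y')

theorem PrekopaLeindler.of_measurePreserving {E F : Type*} [AddCommGroup E] [Module ℝ E]
    [MeasurableSpace E] [AddCommGroup F] [Module ℝ F] [MeasurableSpace F] {μ : Measure E}
    {ν : Measure F} (hμ : PrekopaLeindler μ) (e : E ≃ᵐ F) (he : MeasurePreserving e μ ν)
    (hlin : ∀ (t s : ℝ) (x y : E), e (t • x + s • y) = t • e x + s • e y) :
    PrekopaLeindler ν := by
  intro t s ht hs hts f g h hf hg hh H
  rw [← he.lintegral_comp hf, ← he.lintegral_comp hg, ← he.lintegral_comp hh]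
  refine hμ t s ht hs hts _ _ _ (hf.comp e.measurable) (hg.comp e.measurable)
    (hh.comp e.measurable) fun x y => ?_
  simp only [hlin]
  exact H _ _

theorem PrekopaLeindler.smul {E : Type*} [AddCommGroup E] [Module ℝ E] [MeasurableSpace E]
    {μ : Measure E} (hμ : PrekopaLeindler μ) (c : ℝ≥0∞) :
    PrekopaLeindler (c • μ) := by
  intro t s ht hs hts f g h hf hg hh H
  simp only [lintegral_smul_measure, smul_eq_mul]
  rw [ENNReal.mul_rpow_of_nonneg _ _ ht.le, ENNReal.mul_rpow_of_nonneg _ _ hs.le]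
  calc _ = (c ^ t * c ^ s) * ((∫⁻ x, f x ∂μ) ^ t * (∫⁻ x, g x ∂μ) ^ s) := by ring
    _ = c * ((∫⁻ x, f x ∂μ) ^ t * (∫⁻ x, g x ∂μ) ^ s) := by
      rw [← ENNReal.rpow_add_of_nonneg _ _ ht.le hs.le, hts, ENNReal.rpow_one]
    _ ≤ _ := by gcongr; exact hμ t s ht hs hts f g h hf hg hh H

theorem prekopaLeindler_fin (n : ℕ) : PrekopaLeindler (volume : Measure (Fin n → ℝ)) := by
  induction n with
  | zero =>
    intro t s ht hs hts f g h hf hg hh H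
    rw [volume_pi, Measure.pi_of_empty _ 0, lintegral_dirac, lintegral_dirac, lintegral_dirac]
    simpa using H 0 0
  | succ n ih =>
    refine (prekopaLeindler_real.prod ih).of_measurePreserving
      (MeasurableEquiv.piFinSuccAbove (fun _ => ℝ) 0).symm
      (volume_preserving_piFinSuccAbove (fun _ : Fin (n + 1) => ℝ) 0).symm ?_
    intro t s x y
    ext i
    refine Fin.cases ?_ (fun i => ?_) i <;> simp [MeasurableEquiv.piFinSuccAbove]

theorem prekopaLeindler_addHaar {E : Type*} [NormedAddCommGroup E] [NormedSpace ℝ E]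
    [FiniteDimensional ℝ E] [MeasurableSpace E] [BorelSpace E] (μ : Measure E)
    [μ.IsAddHaarMeasure] : PrekopaLeindler μ := by
  let e : (Fin (Module.finrank ℝ E) → ℝ) ≃L[ℝ] E := by
    apply ContinuousLinearEquiv.ofFinrankEq; simp
  have : (Measure.map e volume).IsAddHaarMeasure := e.isAddHaarMeasure_map _
  have h1 : PrekopaLeindler (Measure.map e volume) :=
    (prekopaLeindler_fin _).of_measurePreserving e.toHomeomorph.toMeasurableEquiv
      ⟨e.continuous.measurable, rfl⟩ (by intro t s x y; simp)
  rw [Measure.isAddLeftInvariant_eq_smul μ (Measure.map e volume)]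
  exact h1.smul _

end PrekopaLeindler

/-! ### The logarithmic Sobolev inequality for uniformly convex potentials -/

section BobkovLedoux

variable {E H : Type*} [NormedAddCommGroup E] [MeasurableSpace E] [BorelSpace E]

theorem lintegral_indicator_ofReal_exp (μ : Measure E) [IsFiniteMeasureOnCompacts μ] {K : Set E}
    (hK : IsCompact K) {u : E → ℝ} (hu : ContinuousOn u K) :
    ∫⁻ x, K.indicator (fun x => ENNReal.ofReal (Real.exp (u x))) x ∂μ
      = ENNReal.ofReal (∫ x in K, Real.exp (u x) ∂μ) := by
  rw [lintegral_indicator hK.measurableSet, ofReal_integral_eq_lintegral_ofReal]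
  · exact (ContinuousOn.rexp hu).integrableOn_compact hK
  · exact ae_of_all _ fun x => (Real.exp_pos _).le

theorem measurable_indicator_ofReal_exp {K : Set E} (hK : IsCompact K) {u : E → ℝ}
    (hu : ContinuousOn u K) :
    Measurable (K.indicator fun x => ENNReal.ofReal (Real.exp (u x))) := by
  classical
  rw [← Set.piecewise_eq_indicator]
  exact ContinuousOn.measurable_piecewise
    (ENNReal.continuous_ofReal.comp_continuousOn (ContinuousOn.rexp hu)) continuousOn_const
    hK.measurableSet

theorem add_mul_entropy_le {K : Set E} {V : E → ℝ} (μ : Measure E) [IsFiniteMeasureOnCompacts μ] (hK : IsCompact K)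
    (hμK : μ K ≠ 0) (hV : ContinuousOn V K)
    {g : E → ℝ} (hg : ContinuousOn g K) {t s : ℝ} (ht : 0 < t)
    (hs : 0 < s) (hts : t + s = 1) :
    (∫ x in K, Real.exp (g x - V x) ∂μ) + s * ((∫ x in K, g x * Real.exp (g x - V x) ∂μ) -
      (∫ x in K, Real.exp (g x - V x) ∂μ) *
        Real.log ((∫ x in K, Real.exp (g x - V x) ∂μ) / ∫ x in K, Real.exp (-V x) ∂μ))
    ≤ (∫ x in K, Real.exp (g x / t - V x) ∂μ) ^ t * (∫ x in K, Real.exp (-V x) ∂μ) ^ s := by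
  have : NeZero (μ.restrict K) := ⟨by simpa using hμK⟩
  have i1 : IntegrableOn (fun x => Real.exp (g x - V x)) K μ :=
    ContinuousOn.integrableOn_compact hK (by fun_prop)
  have i2 : IntegrableOn (fun x => g x * Real.exp (g x - V x)) K μ :=
    ContinuousOn.integrableOn_compact hK (by fun_prop)
  have i3 : IntegrableOn (fun x => Real.exp (-V x)) K μ :=
    ContinuousOn.integrableOn_compact hK (by fun_prop)
  have i4 : IntegrableOn (fun x => Real.exp (g x / t - V x)) K μ :=
    ContinuousOn.integrableOn_compact hK (by fun_prop)
  set A := ∫ x in K, Real.exp (g x - V x) ∂μ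
  set B := ∫ x in K, Real.exp (-V x) ∂μ
  set C := ∫ x in K, g x * Real.exp (g x - V x) ∂μ
  have hA : 0 < A := integral_exp_pos i1
  have hB : 0 < B := integral_exp_pos i3
  set m := s / t * (C / A)
  have jensen : A * Real.exp m ≤ ∫ x in K, Real.exp (g x / t - V x) ∂μ := by
    have e : ∫ x in K, (Real.exp m * (1 - m) * Real.exp (g x - V x) +
        Real.exp m * (s / t) * (g x * Real.exp (g x - V x))) ∂μ = A * Real.exp m := by
      rw [integral_add (i1.const_mul _) (i2.const_mul _), integral_const_mul, integral_const_mul]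
      simp only [m, A, C]
      change Real.exp m * (1 - m) * A + Real.exp m * (s / t) * C = A * Real.exp m
      simp only [m]
      field_simp
      ring
    rw [← e]
    refine integral_mono ((i1.const_mul _).add (i2.const_mul _)) i4 fun x => ?_
    have e1 : Real.exp (g x / t - V x) = Real.exp (g x - V x) * (Real.exp m *
        Real.exp (s / t * g x - m)) := by
      rw [← Real.exp_add, ← Real.exp_add]
      congr 1
      have : s = 1 - t := by linarith
      subst this
      field_simp
      ring
    have e2 := Real.add_one_le_exp (s / t * g x - m)
    rw [e1]
    calc _ = Real.exp (g x - V x) * (Real.exp m * (s / t * g x - m + 1)) := by ring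
      _ ≤ _ := by gcongr
  calc A + s * (C - A * Real.log (A / B))
      = A * (s * (C / A - Real.log (A / B)) + 1) := by field_simp; ring
    _ ≤ A * Real.exp (s * (C / A - Real.log (A / B))) := by
        gcongr; exact Real.add_one_le_exp _
    _ = (A * Real.exp m) ^ t * B ^ s := by
        rw [Real.mul_rpow hA.le (Real.exp_pos _).le, ← Real.exp_mul, Real.rpow_def_of_pos hA,
          Real.rpow_def_of_pos hB, Real.log_div hA.ne' hB.ne', ← Real.exp_add, ← Real.exp_add]
        nth_rw 1 [← Real.exp_log hA]
        rw [← Real.exp_add]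
        congr 1
        have : s = 1 - t := by linarith
        subst this
        simp only [m]
        field_simp
        ring
    _ ≤ _ := by gcongr

variable [NormedSpace ℝ E] [NormedAddCommGroup H] [NormedSpace ℝ H]

/-- The potential `V` is uniformly convex on `K`, with respect to the seminorm `‖L ·‖`. -/
def UniformlyConvexPotential (L : E →L[ℝ] H) (K : Set E) (V : E → ℝ) (c : ℝ) : Prop :=
  ∀ x ∈ K, ∀ y ∈ K, ∀ t s : ℝ, 0 < t → 0 < s → t + s = 1 →
    V (t • x + s • y) + c / 2 * (t * s) * ‖L (x - y)‖ ^ 2 ≤ t * V x + s * V y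

variable {L : E →L[ℝ] H} {K : Set E} {V : E → ℝ} {c : ℝ}

variable [FiniteDimensional ℝ E]

/-- The Prékopa–Leindler inequality for a uniformly convex potential, in the form of an
infimum convolution inequality. -/
theorem rpow_integral_exp_mul_le (μ : Measure E) [μ.IsAddHaarMeasure] (hK : IsCompact K)
    (hKc : Convex ℝ K) (hV : ContinuousOn V K) (hconv : UniformlyConvexPotential L K V c)
    {g Q : E → ℝ} (hg : ContinuousOn g K) (hQ : ContinuousOn Q K) {t s : ℝ} (ht : 0 < t)
    (hs : 0 < s) (hts : t + s = 1)
    (hgQ : ∀ x ∈ K, ∀ z ∈ K, g x - c * t / (2 * s) * ‖L (x - z)‖ ^ 2 ≤ Q z) :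
    (∫ x in K, Real.exp (g x / t - V x) ∂μ) ^ t * (∫ x in K, Real.exp (-V x) ∂μ) ^ s
      ≤ ∫ x in K, Real.exp (Q x - V x) ∂μ := by
  have h1 : ContinuousOn (fun x => g x / t - V x) K := by fun_prop
  have h2 : ContinuousOn (fun x => -V x) K := by fun_prop
  have h3 : ContinuousOn (fun x => Q x - V x) K := by fun_prop
  have key := prekopaLeindler_addHaar μ t s ht hs hts _ _ _
    (measurable_indicator_ofReal_exp hK h1) (measurable_indicator_ofReal_exp hK h2)
    (measurable_indicator_ofReal_exp hK h3) ?_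
  · rw [lintegral_indicator_ofReal_exp μ hK h1, lintegral_indicator_ofReal_exp μ hK h2,
      lintegral_indicator_ofReal_exp μ hK h3, ENNReal.ofReal_rpow_of_nonneg _ ht.le,
      ENNReal.ofReal_rpow_of_nonneg _ hs.le, ← ENNReal.ofReal_mul] at key
    · exact (ENNReal.ofReal_le_ofReal_iff (integral_nonneg fun x => (Real.exp_pos _).le)).1 key
    · exact Real.rpow_nonneg (integral_nonneg fun x => (Real.exp_pos _).le) _
    · exact integral_nonneg fun x => (Real.exp_pos _).le
    · exact integral_nonneg fun x => (Real.exp_pos _).le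
  · intro x y
    by_cases hx : x ∈ K
    swap
    · simp [hx, ht]
    by_cases hy : y ∈ K
    swap
    · simp [hy, hs]
    have hz : t • x + s • y ∈ K := hKc hx hy ht.le hs.le hts
    rw [Set.indicator_of_mem hx, Set.indicator_of_mem hy, Set.indicator_of_mem hz,
      ENNReal.ofReal_rpow_of_nonneg (Real.exp_pos _).le ht.le,
      ENNReal.ofReal_rpow_of_nonneg (Real.exp_pos _).le hs.le,
      ← ENNReal.ofReal_mul (Real.rpow_nonneg (Real.exp_pos _).le _),
      ← Real.exp_mul, ← Real.exp_mul, ← Real.exp_add]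
    refine ENNReal.ofReal_le_ofReal (Real.exp_le_exp.2 ?_)
    have e1 := hgQ x hx _ hz
    have e2 := hconv x hx y hy t s ht hs hts
    have e3 : x - (t • x + s • y) = s • (x - y) := by
      have : s = 1 - t := by linarith
      subst this; module
    rw [e3, map_smul, norm_smul, Real.norm_of_nonneg hs.le] at e1
    have e4 : c * t / (2 * s) * (s * ‖L (x - y)‖) ^ 2 = c / 2 * (t * s) * ‖L (x - y)‖ ^ 2 := by
      field_simp
    rw [e4] at e1
    have e5 : (g x / t - V x) * t = g x - t * V x := by field_simp
    rw [e5]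
    linarith

/-- The logarithmic Sobolev inequality `Ent(e^g) ≤ (2c)⁻¹ ∫ |∇g|² e^g` for a uniformly convex
potential, where `G` is a continuous bound of the slope of `g`. -/
theorem entropy_exp_le (μ : Measure E) [μ.IsAddHaarMeasure] (hK : IsCompact K)
    (hKc : Convex ℝ K) (hV : ContinuousOn V K) (hc : 0 < c)
    (hconv : UniformlyConvexPotential L K V c)
    {g G : E → ℝ} (hg : ContinuousOn g K) (hG : ContinuousOn G K) (hG0 : ∀ x ∈ K, 0 ≤ G x)
    (hgG : ∀ η > 0, ∃ r > 0, ∀ x ∈ K, ∀ z ∈ K, ‖L (x - z)‖ < r →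
      g x - g z ≤ ‖L (x - z)‖ * (G z + η)) :
    (∫ x in K, g x * Real.exp (g x - V x) ∂μ) - (∫ x in K, Real.exp (g x - V x) ∂μ) *
        Real.log ((∫ x in K, Real.exp (g x - V x) ∂μ) / ∫ x in K, Real.exp (-V x) ∂μ)
      ≤ 1 / (2 * c) * ∫ x in K, G x ^ 2 * Real.exp (g x - V x) ∂μ := by
  rcases eq_or_ne (μ K) 0 with h0 | h0
  · simp [Measure.restrict_eq_zero.2 h0]
  obtain ⟨M, hM⟩ := hK.exists_bound_of_continuousOn hg
  obtain ⟨M', hM'⟩ := hK.exists_bound_of_continuousOn hG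
  set T := (∫ x in K, g x * Real.exp (g x - V x) ∂μ) - (∫ x in K, Real.exp (g x - V x) ∂μ) *
        Real.log ((∫ x in K, Real.exp (g x - V x) ∂μ) / ∫ x in K, Real.exp (-V x) ∂μ)
  have i1 : IntegrableOn (fun x => Real.exp (g x - V x)) K μ :=
    ContinuousOn.integrableOn_compact hK (by fun_prop)
  have step : ∀ η > 0, T ≤ 1 / (2 * c) * ∫ x in K, (G x + η) ^ 2 * Real.exp (g x - V x) ∂μ := by
    intro η hη
    obtain ⟨r, hr, hrG⟩ := hgG η hη
    set C₁ := (M' + η) ^ 2 / c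
    set I := ∫ x in K, (G x + η) ^ 2 * Real.exp (g x - V x) ∂μ
    have iI : IntegrableOn (fun x => (G x + η) ^ 2 * Real.exp (g x - V x)) K μ :=
      ContinuousOn.integrableOn_compact hK (by fun_prop)
    have lim : Tendsto (fun s : ℝ => Real.exp (s * C₁) / (2 * c * (1 - s)) * I) (𝓝[>] 0)
        (𝓝 (1 / (2 * c) * I)) := by
      have : ContinuousAt (fun s : ℝ => Real.exp (s * C₁) / (2 * c * (1 - s)) * I) 0 := by
        refine ContinuousAt.mul (ContinuousAt.div (by fun_prop) (by fun_prop) ?_) (by fun_prop)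
        simpa using hc.ne'
      have h := this.tendsto.mono_left (nhdsWithin_le_nhds (s := Set.Ioi 0))
      simpa using h
    refine ge_of_tendsto lim ?_
    have hev1 : ∀ᶠ s : ℝ in 𝓝[>] 0, s < 1 / 2 :=
      nhdsWithin_le_nhds (Iio_mem_nhds (by norm_num))
    have hev2 : ∀ᶠ s : ℝ in 𝓝[>] 0, s * (8 * M) < c * r ^ 2 := by
      refine nhdsWithin_le_nhds ?_
      have : ContinuousAt (fun s : ℝ => s * (8 * M)) 0 := by fun_prop
      exact this.eventually_lt_const (by simp only [zero_mul]; positivity)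
    filter_upwards [hev1, hev2, self_mem_nhdsWithin] with s hs1 hs2 (hs : 0 < s)
    set t := 1 - s
    have ht : 0 < t := by simp only [t]; linarith
    have ht2 : 1 / 2 ≤ t := by simp only [t]; linarith
    have hts : t + s = 1 := by simp [t]
    have low := add_mul_entropy_le μ hK h0 hV hg ht hs hts
    have up := rpow_integral_exp_mul_le μ hK hKc hV hconv hg
      (Q := fun z => g z + s * (G z + η) ^ 2 / (2 * c * t)) (by fun_prop) ht hs hts ?_
    · have up2 : ∫ x in K, Real.exp (g x + s * (G x + η) ^ 2 / (2 * c * t) - V x) ∂μ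
          ≤ (∫ x in K, Real.exp (g x - V x) ∂μ) + s * (Real.exp (s * C₁) / (2 * c * t) * I) := by
        have e : s * (Real.exp (s * C₁) / (2 * c * t) * I) =
            ∫ x in K, s * (Real.exp (s * C₁) / (2 * c * t)) *
              ((G x + η) ^ 2 * Real.exp (g x - V x)) ∂μ := by
          rw [integral_const_mul]; ring
        rw [e, ← integral_add i1 (iI.const_mul _)]
        refine setIntegral_mono_on (ContinuousOn.integrableOn_compact hK (by fun_prop))
          (i1.add (iI.const_mul _)) hK.measurableSet fun x hx => ?_
        set D := s * (G x + η) ^ 2 / (2 * c * t)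
        have hD : D ≤ s * C₁ := by
          have hG1 := hG0 x hx
          have hG2 := (le_abs_self _).trans (hM' x hx)
          simp only [D, C₁, mul_div_assoc]
          gcongr
          nlinarith
        have hD0 : 0 ≤ D := by positivity
        have h1 : Real.exp D - 1 ≤ D * Real.exp (s * C₁) := by
          have h2 := Real.add_one_le_exp (-D)
          have h3 : Real.exp D * Real.exp (-D) = 1 := by rw [← Real.exp_add]; simp
          have h4 : Real.exp D ≤ Real.exp (s * C₁) := Real.exp_le_exp.2 hD
          nlinarith [Real.exp_pos D]
        have h2 : Real.exp (g x + D - V x) = Real.exp (g x - V x) * Real.exp D := by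
          rw [← Real.exp_add]; congr 1; ring
        rw [h2]
        calc Real.exp (g x - V x) * Real.exp D
            = Real.exp (g x - V x) + Real.exp (g x - V x) * (Real.exp D - 1) := by ring
          _ ≤ Real.exp (g x - V x) + Real.exp (g x - V x) * (D * Real.exp (s * C₁)) := by gcongr
          _ = _ := by simp only [D]; ring
      have h3 := low.trans (up.trans up2)
      have h4 : s * T ≤ s * (Real.exp (s * C₁) / (2 * c * t) * I) := by linarith
      exact le_of_mul_le_mul_left h4 hs
    · intro x hx z hz
      set ρ := ‖L (x - z)‖
      have hρ : 0 ≤ ρ := norm_nonneg _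
      have hD0 : 0 ≤ s * (G z + η) ^ 2 / (2 * c * t) := by positivity
      rcases lt_or_ge ρ r with h | h
      · have h1 := hrG x hx z hz h
        have h2 : ρ * (G z + η) - c * t / (2 * s) * ρ ^ 2 ≤ s * (G z + η) ^ 2 / (2 * c * t) := by
          have : s * (G z + η) ^ 2 / (2 * c * t) - (ρ * (G z + η) - c * t / (2 * s) * ρ ^ 2) =
              (s * (G z + η) - c * t * ρ) ^ 2 / (2 * c * t * s) := by
            field_simp; ring
          have h5 : 0 ≤ (s * (G z + η) - c * t * ρ) ^ 2 / (2 * c * t * s) := by positivity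
          linarith
        linarith
      · have h1 := (le_abs_self _).trans (hM x hx)
        have h2 := (neg_le_abs _).trans (hM z hz)
        have h3 : 2 * M ≤ c * t / (2 * s) * ρ ^ 2 := by
          calc 2 * M ≤ c * r ^ 2 / (4 * s) := by
                rw [le_div_iff₀ (by positivity)]; linarith
            _ = c * (1 / 2) / (2 * s) * r ^ 2 := by field_simp; ring
            _ ≤ _ := by gcongr
        linarith
  have lim : Tendsto (fun η : ℝ => 1 / (2 * c) * ∫ x in K, (G x + η) ^ 2 * Real.exp (g x - V x) ∂μ)
      (𝓝[>] 0) (𝓝 (1 / (2 * c) * ∫ x in K, G x ^ 2 * Real.exp (g x - V x) ∂μ)) := by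
    have i2 : IntegrableOn (fun x => G x ^ 2 * Real.exp (g x - V x)) K μ :=
      ContinuousOn.integrableOn_compact hK (by fun_prop)
    have i3 : IntegrableOn (fun x => G x * Real.exp (g x - V x)) K μ :=
      ContinuousOn.integrableOn_compact hK (by fun_prop)
    have e : ∀ η : ℝ, ∫ x in K, (G x + η) ^ 2 * Real.exp (g x - V x) ∂μ =
        (∫ x in K, G x ^ 2 * Real.exp (g x - V x) ∂μ) +
        (2 * η) * (∫ x in K, G x * Real.exp (g x - V x) ∂μ) +
        η ^ 2 * ∫ x in K, Real.exp (g x - V x) ∂μ := by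
      intro η
      rw [← integral_const_mul, ← integral_const_mul, ← integral_add i2 (i3.const_mul _),
        ← integral_add (by exact i2.add (i3.const_mul _)) (i1.const_mul _)]
      congr 1 with x
      ring
    simp only [e]
    refine Tendsto.mono_left ?_ nhdsWithin_le_nhds
    refine (Continuous.tendsto' (by fun_prop) _ _ (by simp))
  exact ge_of_tendsto lim (by filter_upwards [self_mem_nhdsWithin] with η hη using step η hη)

/-- The logarithmic Sobolev inequality `Ent(f²) ≤ (2/c) ∫ |∇f|²` for a uniformly convex
potential, where `G` is a continuous bound of the slope of the positive function `f`. -/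
theorem entropy_sq_le_of_continuousOn (μ : Measure E) [μ.IsAddHaarMeasure] (hK : IsCompact K)
    (hKc : Convex ℝ K) (hV : ContinuousOn V K) (hc : 0 < c)
    (hconv : UniformlyConvexPotential L K V c)
    {f G : E → ℝ} (hf : ContinuousOn f K) (hf0 : ∀ x ∈ K, 0 < f x) (hG : ContinuousOn G K)
    (hG0 : ∀ x ∈ K, 0 ≤ G x)
    (hfG : ∀ η > 0, ∃ r > 0, ∀ x ∈ K, ∀ z ∈ K, ‖L (x - z)‖ < r →
      f x - f z ≤ ‖L (x - z)‖ * (G z + η)) :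
    (∫ x in K, f x ^ 2 * Real.log (f x ^ 2) * Real.exp (-V x) ∂μ) -
      (∫ x in K, f x ^ 2 * Real.exp (-V x) ∂μ) *
        Real.log ((∫ x in K, f x ^ 2 * Real.exp (-V x) ∂μ) / ∫ x in K, Real.exp (-V x) ∂μ)
      ≤ 2 / c * ∫ x in K, G x ^ 2 * Real.exp (-V x) ∂μ := by
  rcases K.eq_empty_or_nonempty with rfl | hne
  · simp
  obtain ⟨x₀, hx₀, hmin⟩ := hK.exists_isMinOn hne hf
  have hlog : ContinuousOn (fun x => 2 * Real.log (f x)) K :=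
    continuousOn_const.mul (hf.log fun x hx => (hf0 x hx).ne')
  have hdiv : ContinuousOn (fun x => 2 * G x / f x) K :=
    (continuousOn_const.mul hG).div hf fun x hx => (hf0 x hx).ne'
  have key := entropy_exp_le μ hK hKc hV hc hconv hlog hdiv
    (fun x hx => div_nonneg (mul_nonneg zero_le_two (hG0 x hx)) (hf0 x hx).le) ?_
  · have e1 : ∀ x ∈ K, Real.exp (2 * Real.log (f x) - V x) = f x ^ 2 * Real.exp (-V x) := by
      intro x hx
      rw [sub_eq_add_neg, Real.exp_add, mul_comm 2, Real.exp_mul, Real.exp_log (hf0 x hx)]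
      simp
    have e2 : ∫ x in K, Real.exp (2 * Real.log (f x) - V x) ∂μ =
        ∫ x in K, f x ^ 2 * Real.exp (-V x) ∂μ := setIntegral_congr_fun hK.measurableSet e1
    have e3 : ∫ x in K, 2 * Real.log (f x) * Real.exp (2 * Real.log (f x) - V x) ∂μ =
        ∫ x in K, f x ^ 2 * Real.log (f x ^ 2) * Real.exp (-V x) ∂μ := by
      refine setIntegral_congr_fun hK.measurableSet fun x hx => ?_
      simp only [e1 x hx, Real.log_pow]
      push_cast; ring
    have e4 : ∫ x in K, (2 * G x / f x) ^ 2 * Real.exp (2 * Real.log (f x) - V x) ∂μ =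
        4 * ∫ x in K, G x ^ 2 * Real.exp (-V x) ∂μ := by
      rw [← integral_const_mul]
      refine setIntegral_congr_fun hK.measurableSet fun x hx => ?_
      simp only [e1 x hx]
      have := (hf0 x hx).ne'
      field_simp
      ring
    rw [e2, e3, e4] at key
    calc _ ≤ _ := key
      _ = _ := by field_simp; ring
  · intro η hη
    obtain ⟨r, hr, h⟩ := hfG (η * f x₀ / 2) (by have := hf0 x₀ hx₀; positivity)
    refine ⟨r, hr, fun x hx z hz hxz => ?_⟩
    have h1 := h x hx z hz hxz
    have hz0 := hf0 z hz
    have h2 : Real.log (f x) - Real.log (f z) ≤ (f x - f z) / f z := by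
      rw [← Real.log_div (hf0 x hx).ne' hz0.ne']
      have := Real.log_le_sub_one_of_pos (div_pos (hf0 x hx) hz0)
      rwa [← div_self hz0.ne', ← sub_div] at this
    have h3 : f x₀ ≤ f z := hmin hz
    calc 2 * Real.log (f x) - 2 * Real.log (f z) ≤ 2 * ((f x - f z) / f z) := by linarith
      _ ≤ 2 * (‖L (x - z)‖ * (G z + η * f x₀ / 2) / f z) := by gcongr
      _ = ‖L (x - z)‖ * (2 * G z / f z + η * (f x₀ / f z)) := by field_simp
      _ ≤ ‖L (x - z)‖ * (2 * G z / f z + η * 1) := by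
          gcongr; exact (div_le_one hz0).2 h3
      _ = _ := by rw [mul_one]

end BobkovLedoux

/-! ### Functions with everywhere finite slope -/

/-- A continuous function of a real variable whose upper right slope is everywhere at most the
integrable function `φ` increases at most by the integral of `φ`. -/
theorem sub_le_integral_of_slope_le {g φ : ℝ → ℝ} {a b : ℝ} (hab : a ≤ b)
    (hcont : ContinuousOn g (Set.Icc a b))
    (hslope : ∀ x ∈ Set.Ico a b, ∀ y, φ x < y → ∀ᶠ u in 𝓝[>] x, g u - g x ≤ (u - x) * y)
    (φint : IntegrableOn φ (Set.Icc a b)) :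
    g b - g a ≤ ∫ y in a..b, φ y := by
  refine le_of_forall_pos_le_add fun ε εpos => ?_
  rcases exists_lt_lowerSemicontinuous_integral_lt φ φint εpos with
    ⟨G', f_lt_G', G'cont, G'int, G'lt_top, hG'⟩
  set s := {t | g t - g a ≤ ∫ u in a..t, (G' u).toReal} ∩ Set.Icc a b
  have s_closed : IsClosed s := by
    have : ContinuousOn (fun t => (g t - g a, ∫ u in a..t, (G' u).toReal)) (Set.Icc a b) := by
      rw [← Set.uIcc_of_le hab] at G'int hcont ⊢
      exact (hcont.sub continuousOn_const).prodMk
        (intervalIntegral.continuousOn_primitive_interval G'int)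
    simp only [s, Set.inter_comm]
    exact this.preimage_isClosed_of_isClosed isClosed_Icc OrderClosedTopology.isClosed_le'
  have main : Set.Icc a b ⊆ {t | g t - g a ≤ ∫ u in a..t, (G' u).toReal} := by
    refine s_closed.Icc_subset_of_forall_exists_gt
      (by simp) fun t ht v t_lt_v => ?_
    obtain ⟨y, g'_lt_y', y_lt_G'⟩ : ∃ y : ℝ, (φ t : EReal) < y ∧ (y : EReal) < G' t :=
      EReal.lt_iff_exists_real_btwn.1 (f_lt_G' t)
    have I1 : ∀ᶠ u in 𝓝[>] t, (u - t) * y ≤ ∫ w in t..u, (G' w).toReal := by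
      have B : ∀ᶠ u in 𝓝 t, (y : EReal) < G' u := G'cont.lowerSemicontinuousAt _ _ y_lt_G'
      rcases mem_nhds_iff_exists_Ioo_subset.1 B with ⟨m, M, ⟨hm, hM⟩, H⟩
      have : Set.Ioo t (min M b) ∈ 𝓝[>] t := Ioo_mem_nhdsGT (lt_min hM ht.right.right)
      filter_upwards [this] with u hu
      have I : Set.Icc t u ⊆ Set.Icc a b :=
        Set.Icc_subset_Icc ht.2.1 (hu.2.le.trans (min_le_right _ _))
      calc
        (u - t) * y = ∫ _ in Set.Icc t u, y := by
          simp only [MeasureTheory.integral_const, MeasurableSet.univ, measureReal_restrict_apply,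
            Set.univ_inter, hu.left.le, Real.volume_real_Icc_of_le, smul_eq_mul]
        _ ≤ ∫ w in t..u, (G' w).toReal := by
          rw [intervalIntegral.integral_of_le hu.1.le, ← integral_Icc_eq_integral_Ioc]
          apply setIntegral_mono_ae_restrict
          · simp
          · exact IntegrableOn.mono_set G'int I
          · have C1 : ∀ᵐ x : ℝ ∂volume.restrict (Set.Icc t u), G' x < ∞ :=
              ae_mono (Measure.restrict_mono I le_rfl) G'lt_top
            have C2 : ∀ᵐ x : ℝ ∂volume.restrict (Set.Icc t u), x ∈ Set.Icc t u :=
              ae_restrict_mem measurableSet_Icc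
            filter_upwards [C1, C2] with x G'x hx
            apply EReal.coe_le_coe_iff.1
            have : x ∈ Set.Ioo m M := by
              simp only [hm.trans_le hx.left,
                (hx.right.trans_lt hu.right).trans_le (min_le_left M b), Set.mem_Ioo, and_self_iff]
            refine (H this).out.le.trans_eq ?_
            exact (EReal.coe_toReal G'x.ne (f_lt_G' x).ne_bot).symm
    have I2 : ∀ᶠ u in 𝓝[>] t, g u - g t ≤ (u - t) * y :=
      hslope t ⟨ht.2.1, ht.2.2⟩ y (EReal.coe_lt_coe_iff.1 g'_lt_y')
    have I4 : ∀ᶠ u in 𝓝[>] t, u ∈ Set.Ioc t (min v b) :=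
      Ioc_mem_nhdsGT <| lt_min t_lt_v ht.2.2
    rcases ((I1.and I2).and I4).exists with ⟨x, hx, h'x⟩
    refine ⟨x, ?_, Set.Ioc_subset_Ioc le_rfl (min_le_left _ _) h'x⟩
    calc
      g x - g a = g t - g a + (g x - g t) := by abel
      _ ≤ (∫ w in a..t, (G' w).toReal) + ∫ w in t..x, (G' w).toReal :=
        add_le_add ht.1 (hx.2.trans hx.1)
      _ = ∫ w in a..x, (G' w).toReal := by
        apply intervalIntegral.integral_add_adjacent_intervals
        · rw [intervalIntegrable_iff_integrableOn_Ioc_of_le ht.2.1]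
          exact IntegrableOn.mono_set G'int
            (Set.Ioc_subset_Icc_self.trans (Set.Icc_subset_Icc le_rfl ht.2.2.le))
        · rw [intervalIntegrable_iff_integrableOn_Ioc_of_le h'x.1.le]
          apply IntegrableOn.mono_set G'int
          exact Set.Ioc_subset_Icc_self.trans
            (Set.Icc_subset_Icc ht.2.1 (h'x.2.trans (min_le_right _ _)))
  calc
    g b - g a ≤ ∫ y in a..b, (G' y).toReal := main (Set.right_mem_Icc.2 hab)
    _ ≤ (∫ y in a..b, φ y) + ε := by
      rw [intervalIntegral.integral_of_le hab, intervalIntegral.integral_of_le hab,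
        ← integral_Icc_eq_integral_Ioc, ← integral_Icc_eq_integral_Ioc]
      exact hG'.le

/-! ### Inner parallel bodies and mollification -/

section Mollify

set_option linter.unusedSectionVars false

variable {E H : Type*} [NormedAddCommGroup E] [NormedSpace ℝ E]
  [NormedAddCommGroup H] [NormedSpace ℝ H]

/-- The points of `K` at distance at least `ε` from the complement of `K`. -/
def innerParallel (K : Set E) (ε : ℝ) : Set E := {x | ∀ b : E, ‖b‖ ≤ ε → x + b ∈ K}

theorem innerParallel_subset {K : Set E} {ε : ℝ} (hε : 0 ≤ ε) : innerParallel K ε ⊆ K :=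
  fun x hx => by simpa using hx 0 (by simpa using hε)

theorem convex_innerParallel {K : Set E} (hK : Convex ℝ K) (ε : ℝ) :
    Convex ℝ (innerParallel K ε) := by
  intro x hx y hy t s ht hs hts b hb
  have h := hK (hx b hb) (hy b hb) ht hs hts
  have e : t • x + s • y + b = t • (x + b) + s • (y + b) := by
    have : s = 1 - t := by linarith
    subst this; module
  rwa [e]

theorem isCompact_innerParallel {K : Set E} (hK : IsCompact K) {ε : ℝ} (hε : 0 ≤ ε) :
    IsCompact (innerParallel K ε) := by
  refine hK.of_isClosed_subset ?_ (innerParallel_subset hε)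
  have : innerParallel K ε = ⋂ (b : E) (_ : ‖b‖ ≤ ε), (fun x => x + b) ⁻¹' K := by
    ext x; simp [innerParallel]
  rw [this]
  exact isClosed_iInter fun b => isClosed_iInter fun _ => hK.isClosed.preimage (by fun_prop)

theorem exists_mem_innerParallel {K : Set E} {x : E} (hx : x ∈ interior K) :
    ∃ ε > 0, ∀ ε' ≤ ε, x ∈ innerParallel K ε' := by
  obtain ⟨ε, hε, h⟩ := Metric.mem_nhds_iff.1 (mem_interior_iff_mem_nhds.1 hx)
  refine ⟨ε / 2, by positivity, fun ε' hε' b hb => h ?_⟩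
  simp only [Metric.mem_ball, dist_self_add_left]
  linarith

variable [MeasurableSpace E]

/-- A continuous probability density on the ball of radius `ε`. -/
structure IsMollifier (μ : Measure E) (ε : ℝ) (φ : E → ℝ) : Prop where
  cont : Continuous φ
  nonneg : ∀ y, 0 ≤ φ y
  integral : ∫ y, φ y ∂μ = 1
  supp : ∀ y, φ y ≠ 0 → ‖y‖ ≤ ε
  bdd : ∃ M, ∀ y, φ y ≤ M

/-- The average of a function on `K` against a mollifier. -/
def mollify (μ : Measure E) (K : Set E) (φ f : E → ℝ) (x : E) : ℝ :=
  ∫ y, φ y * K.indicator f (x + y) ∂μ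

variable [BorelSpace E]

theorem exists_isMollifier [FiniteDimensional ℝ E] (μ : Measure E) [μ.IsAddHaarMeasure] {ε : ℝ}
    (hε : 0 < ε) : ∃ φ, IsMollifier μ ε φ := by
  let φ : ContDiffBump (0 : E) := ⟨ε / 2, ε, by positivity, by linarith⟩
  refine ⟨φ.normed μ, φ.continuous_normed, φ.nonneg_normed, φ.integral_normed, ?_, ?_⟩
  · intro y hy
    have : y ∈ Function.support (φ.normed μ) := hy
    rw [φ.support_normed_eq] at this
    simpa using (mem_ball_zero_iff.1 this).le
  · obtain ⟨M, hM⟩ := φ.continuous_normed.bounded_above_of_compact_support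
      (φ.hasCompactSupport_normed (μ := μ))
    exact ⟨M, fun y => (le_abs_self _).trans (hM y)⟩

variable {μ : Measure E} [μ.IsAddHaarMeasure] {K : Set E} {ε : ℝ} {φ : E → ℝ}

theorem IsMollifier.integrable (hφ : IsMollifier μ ε φ) : Integrable φ μ := by
  by_contra h
  have := hφ.integral
  rw [integral_undef h] at this
  exact zero_ne_one this

theorem IsMollifier.integrable_mul [SFinite μ] (hφ : IsMollifier μ ε φ) {u : E → ℝ}
    (hu : Integrable u μ) (x : E) :
    Integrable (fun y => φ y * u (x + y)) μ := by
  obtain ⟨M, hM⟩ := hφ.bdd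
  exact (hu.comp_add_left x).bdd_mul (c := M) hφ.cont.aestronglyMeasurable
    (ae_of_all _ fun y => by rw [Real.norm_of_nonneg (hφ.nonneg y)]; exact hM y)

theorem continuous_mollify [FiniteDimensional ℝ E] (hφ : IsMollifier μ ε φ) {f : E → ℝ}
    (hf : Integrable (K.indicator f) μ) : Continuous (mollify μ K φ f) := by
  obtain ⟨M, hM⟩ := hφ.bdd
  have e : mollify μ K φ f = fun x => ∫ z, φ (z - x) * K.indicator f z ∂μ := by
    ext x
    rw [← integral_add_left_eq_self (μ := μ) (fun z => φ (z - x) * K.indicator f z) x]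
    simp [mollify]
  rw [e]
  refine continuous_of_dominated (bound := fun z => M * ‖K.indicator f z‖) ?_ ?_ ?_ ?_
  · intro x
    exact (hφ.cont.comp (by fun_prop)).aestronglyMeasurable.mul hf.aestronglyMeasurable
  · intro x
    refine ae_of_all _ fun z => ?_
    rw [norm_mul, Real.norm_of_nonneg (hφ.nonneg _)]
    gcongr
    exact hM _
  · exact hf.norm.const_mul M
  · exact ae_of_all _ fun z => (hφ.cont.comp (by fun_prop)).mul continuous_const

theorem mollify_bounds (hφ : IsMollifier μ ε φ) {f : E → ℝ}
    (hf : Integrable (K.indicator f) μ) {x : E} (hx : x ∈ innerParallel K ε) {a b : ℝ}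
    (hab : ∀ y, ‖y‖ ≤ ε → a ≤ f (x + y) ∧ f (x + y) ≤ b) [SFinite μ] :
    a ≤ mollify μ K φ f x ∧ mollify μ K φ f x ≤ b := by
  have key : ∀ y, φ y * a ≤ φ y * K.indicator f (x + y) ∧
      φ y * K.indicator f (x + y) ≤ φ y * b := by
    intro y
    by_cases h : φ y = 0
    · simp [h]
    · have hy := hφ.supp y h
      rw [Set.indicator_of_mem (hx y hy)]
      exact ⟨mul_le_mul_of_nonneg_left (hab y hy).1 (hφ.nonneg y),
        mul_le_mul_of_nonneg_left (hab y hy).2 (hφ.nonneg y)⟩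
  constructor
  · calc a = ∫ y, φ y * a ∂μ := by rw [integral_mul_const, hφ.integral, one_mul]
      _ ≤ _ := integral_mono (hφ.integrable.mul_const a) (hφ.integrable_mul hf x)
        fun y => (key y).1
  · calc mollify μ K φ f x ≤ ∫ y, φ y * b ∂μ :=
          integral_mono (hφ.integrable_mul hf x) (hφ.integrable.mul_const b) fun y => (key y).2
      _ = b := by rw [integral_mul_const, hφ.integral, one_mul]

variable [FiniteDimensional ℝ E] {L : E →L[ℝ] H}

/-- The increment of a mollified function is bounded by the integral of the mollified slope
along the segment. -/
theorem mollify_sub_le (hφ : IsMollifier μ ε φ) (hK : Convex ℝ K) {f g : E → ℝ}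
    (hfc : ContinuousOn f K) (hf : Integrable (K.indicator f) μ)
    (hgm : Measurable (K.indicator g))
    (hg : Integrable (K.indicator g) μ)
    (hslope : ∀ x ∈ K, ∀ η > 0, ∀ᶠ y in 𝓝[K] x, |f y - f x| ≤ (g x + η) * ‖L (y - x)‖)
    {x z : E} (hx : x ∈ innerParallel K ε) (hz : z ∈ innerParallel K ε) :
    mollify μ K φ f x - mollify μ K φ f z ≤
      ‖L (x - z)‖ * ∫ τ in (0 : ℝ)..1, mollify μ K φ g (z + τ • (x - z)) := by
  obtain ⟨M, hM⟩ := hφ.bdd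
  set h := x - z
  have hprod : Integrable (fun p : ℝ × E => φ p.2 * K.indicator g (z + p.1 • h + p.2))
      ((volume.restrict (Set.Ioc 0 1)).prod μ) := by
    refine (integrable_prod_iff ?_).2 ⟨ae_of_all _ fun τ => hφ.integrable_mul hg (z + τ • h), ?_⟩
    · refine ((hφ.cont.measurable.comp measurable_snd).mul
        (hgm.comp ?_)).aestronglyMeasurable
      fun_prop
    · refine Integrable.mono' (g := fun _ => M * ∫ y, ‖K.indicator g y‖ ∂μ)
        (integrable_const _) ?_ (ae_of_all _ fun τ => ?_)
      · refine (Measurable.stronglyMeasurable ?_).integral_prod_right.aestronglyMeasurable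
        refine ((hφ.cont.measurable.comp measurable_snd).mul (hgm.comp ?_)).norm
        fun_prop
      · rw [Real.norm_of_nonneg (integral_nonneg fun _ => norm_nonneg _), ← integral_const_mul,
          ← integral_add_left_eq_self (μ := μ) (fun y => M * ‖K.indicator g y‖) (z + τ • h)]
        refine integral_mono (hφ.integrable_mul hg (z + τ • h)).norm
          ((hg.norm.const_mul M).comp_add_left (z + τ • h)) fun y => ?_
        simp only [norm_mul, Real.norm_of_nonneg (hφ.nonneg _)]
        gcongr
        exact hM y
  have hswap : ∫ τ in (0 : ℝ)..1, mollify μ K φ g (z + τ • h) =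
      ∫ y, (∫ τ in Set.Ioc (0 : ℝ) 1, φ y * K.indicator g (z + τ • h + y)) ∂μ := by
    rw [intervalIntegral.integral_of_le zero_le_one]
    exact integral_integral_swap
      (f := fun (τ : ℝ) (y : E) => φ y * K.indicator g (z + τ • h + y)) hprod
  rw [hswap, mollify, mollify, ← integral_sub (hφ.integrable_mul hf x) (hφ.integrable_mul hf z),
    ← integral_const_mul]
  refine integral_mono_ae ((hφ.integrable_mul hf x).sub (hφ.integrable_mul hf z))
    (hprod.integral_prod_right.const_mul _) ?_
  filter_upwards [hprod.prod_left_ae] with y hy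
  by_cases h0 : φ y = 0
  · simp [h0]
  have hyε := hφ.supp y h0
  have hxK := hx y hyε
  have hzK := hz y hyε
  have hseg : ∀ τ ∈ Set.Icc (0 : ℝ) 1, z + τ • h + y ∈ K := by
    intro τ hτ
    have := hK hzK hxK (sub_nonneg.2 hτ.2) hτ.1 (by ring)
    convert this using 1
    simp only [h]
    module
  have hline : IntegrableOn (fun τ : ℝ => ‖L h‖ * g (z + τ • h + y)) (Set.Icc 0 1) := by
    have h1 : IntegrableOn (fun τ : ℝ => φ y * K.indicator g (z + τ • h + y)) (Set.Ioc 0 1) := hy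
    rw [integrableOn_Icc_iff_integrableOn_Ioc]
    refine IntegrableOn.congr_fun (h1.const_mul (‖L h‖ * (φ y)⁻¹)) (fun τ hτ => ?_)
      measurableSet_Ioc
    simp only [Set.indicator_of_mem (hseg τ (Set.Ioc_subset_Icc_self hτ))]
    field_simp
  have hmaps : Set.MapsTo (fun τ : ℝ => z + τ • h + y) (Set.Icc 0 1) K := hseg
  have key := sub_le_integral_of_slope_le (g := fun τ : ℝ => f (z + τ • h + y)) zero_le_one
    (hfc.comp (by fun_prop) hmaps) ?_ hline
  · have e1 : z + (1 : ℝ) • h + y = x + y := by simp [h]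
    have e0 : z + (0 : ℝ) • h + y = z + y := by simp
    simp only [e1, e0] at key
    rw [Set.indicator_of_mem hxK, Set.indicator_of_mem hzK, ← mul_sub]
    calc φ y * (f (x + y) - f (z + y))
        ≤ φ y * ∫ τ in (0 : ℝ)..1, ‖L h‖ * g (z + τ • h + y) :=
          mul_le_mul_of_nonneg_left key (hφ.nonneg y)
      _ = _ := by
        rw [intervalIntegral.integral_of_le zero_le_one, ← integral_const_mul,
          ← integral_const_mul]
        refine setIntegral_congr_fun measurableSet_Ioc fun τ hτ => ?_
        simp only [Set.indicator_of_mem (hseg τ (Set.Ioc_subset_Icc_self hτ))]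
        ring
  · intro τ hτ v hv
    have hL0 : 0 ≤ ‖L h‖ := norm_nonneg _
    obtain ⟨η, hη, hηv⟩ : ∃ η > 0, (g (z + τ • h + y) + η) * ‖L h‖ ≤ v := by
      rcases hL0.eq_or_lt with h0 | h0
      · refine ⟨1, one_pos, ?_⟩
        simp only [← h0] at hv ⊢
        linarith
      · refine ⟨(v - ‖L h‖ * g (z + τ • h + y)) / ‖L h‖, by
          apply div_pos _ h0; linarith, ?_⟩
        field_simp
        linarith
    have hs := hslope _ (hseg τ (Set.Ico_subset_Icc_self hτ)) η hη
    have htend : Tendsto (fun u : ℝ => z + u • h + y) (𝓝[>] τ) (𝓝[K] (z + τ • h + y)) := by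
      refine tendsto_nhdsWithin_iff.2 ⟨?_, ?_⟩
      · exact (Continuous.tendsto (by fun_prop) τ).mono_left nhdsWithin_le_nhds
      · filter_upwards [Ioc_mem_nhdsGT hτ.2] with u hu
        exact hseg u ⟨hτ.1.trans hu.1.le, hu.2⟩
    filter_upwards [htend.eventually hs, self_mem_nhdsWithin] with u hu (hu' : τ < u)
    have e : z + u • h + y - (z + τ • h + y) = (u - τ) • h := by module
    rw [e, map_smul, norm_smul, Real.norm_of_nonneg (sub_pos.2 hu').le] at hu
    calc _ ≤ _ := (le_abs_self _).trans hu
      _ = (u - τ) * ((g (z + τ • h + y) + η) * ‖L h‖) := by ring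
      _ ≤ _ := mul_le_mul_of_nonneg_left hηv (sub_pos.2 hu').le

theorem mollify_sq_le (hφ : IsMollifier μ ε φ) {g : E → ℝ}
    (hg : Integrable (K.indicator g) μ) (hg2 : Integrable (fun x => K.indicator g x ^ 2) μ)
    (x : E) :
    mollify μ K φ g x ^ 2 ≤ ∫ y, φ y * K.indicator g (x + y) ^ 2 ∂μ := by
  set m := mollify μ K φ g x
  have i1 := hφ.integrable_mul hg x
  have i2 := hφ.integrable_mul hg2 x
  have h0 : 0 ≤ ∫ y, φ y * (K.indicator g (x + y) - m) ^ 2 ∂μ :=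
    integral_nonneg fun y => mul_nonneg (hφ.nonneg y) (sq_nonneg _)
  have e : ∫ y, φ y * (K.indicator g (x + y) - m) ^ 2 ∂μ =
      (∫ y, φ y * K.indicator g (x + y) ^ 2 ∂μ) - 2 * m * (∫ y, φ y * K.indicator g (x + y) ∂μ) +
        m ^ 2 * ∫ y, φ y ∂μ := by
    rw [← integral_const_mul, ← integral_const_mul, ← integral_sub i2 (i1.const_mul _),
      ← integral_add (by exact i2.sub (i1.const_mul _)) (hφ.integrable.const_mul _)]
    congr 1 with y
    ring
  have e2 : ∫ y, φ y * K.indicator g (x + y) ∂μ = m := rfl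
  rw [e, e2, hφ.integral] at h0
  linarith

/-- Mollification does not increase the weighted energy much. -/
theorem integral_mollify_sq_le (hφ : IsMollifier μ ε φ) (hε : 0 ≤ ε) (hK : IsCompact K)
    {V : E → ℝ} (hV : ContinuousOn V K) {g : E → ℝ} (hgm : Measurable (K.indicator g))
    (hg : Integrable (K.indicator g) μ) (hg2 : Integrable (fun x => K.indicator g x ^ 2) μ)
    {ω : ℝ} (hω : ∀ x ∈ K, ∀ y ∈ K, ‖y - x‖ ≤ ε → V y - V x ≤ ω) :
    ∫ x in innerParallel K ε, mollify μ K φ g x ^ 2 * Real.exp (-V x) ∂μ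
      ≤ Real.exp ω * ∫ x in K, g x ^ 2 * Real.exp (-V x) ∂μ := by
  set K' := innerParallel K ε
  have hK' : IsCompact K' := isCompact_innerParallel hK hε
  have hsub : K' ⊆ K := innerParallel_subset hε
  obtain ⟨M, hM⟩ := hφ.bdd
  set w : E → ℝ := fun x => K.indicator g x ^ 2 * K.indicator (fun x => Real.exp (-V x)) x
  have hVe : ContinuousOn (fun x => Real.exp (-V x)) K := by fun_prop
  obtain ⟨M₂, hM₂⟩ := hK.exists_bound_of_continuousOn hVe
  have hVm : Measurable (K.indicator fun x => Real.exp (-V x)) := by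
    classical
    rw [← Set.piecewise_eq_indicator]
    exact ContinuousOn.measurable_piecewise hVe continuousOn_const hK.measurableSet
  have hwm : Measurable w := (hgm.pow_const 2).mul hVm
  have hw : Integrable w μ := by
    refine hg2.mul_bdd (c := max M₂ 0) hVm.aestronglyMeasurable (ae_of_all _ fun x => ?_)
    by_cases hx : x ∈ K
    · rw [Set.indicator_of_mem hx]; exact (hM₂ x hx).trans (le_max_left _ _)
    · rw [Set.indicator_of_notMem hx]; simp
  have hw0 : ∀ x, 0 ≤ w x := fun x => mul_nonneg (sq_nonneg _)
    (Set.indicator_nonneg (fun _ _ => (Real.exp_pos _).le) _)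
  have hwint : ∫ x, w x ∂μ = ∫ x in K, g x ^ 2 * Real.exp (-V x) ∂μ := by
    rw [← integral_indicator hK.measurableSet]
    congr 1 with x
    by_cases hx : x ∈ K <;> simp [w, hx]
  have hprod : Integrable (fun p : E × E => φ p.2 * w (p.1 + p.2)) (μ.prod μ) := by
    refine (integrable_prod_iff' ?_).2 ⟨ae_of_all _ fun y => ?_, ?_⟩
    · exact ((hφ.cont.measurable.comp measurable_snd).mul
        (hwm.comp (by fun_prop))).aestronglyMeasurable
    · exact (hw.comp_add_right y).const_mul (φ y)
    · have : (fun y => ∫ x, ‖φ y * w (x + y)‖ ∂μ) = fun y => φ y * ∫ x, w x ∂μ := by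
        ext y
        rw [← integral_add_right_eq_self (μ := μ) w y, ← integral_const_mul]
        congr 1 with x
        rw [Real.norm_of_nonneg (mul_nonneg (hφ.nonneg y) (hw0 _))]
      simp only [this]
      exact hφ.integrable.mul_const _
  have e : ∫ x, ∫ y, φ y * w (x + y) ∂μ ∂μ = ∫ x, w x ∂μ := by
    rw [integral_integral_swap hprod]
    have : ∀ y, ∫ x, φ y * w (x + y) ∂μ = φ y * ∫ x, w x ∂μ := by
      intro y
      rw [integral_const_mul, integral_add_right_eq_self]
    simp only [this]
    rw [integral_mul_const, hφ.integral, one_mul]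
  rw [← hwint, ← e, ← integral_const_mul]
  have hcont := continuous_mollify hφ hg
  calc ∫ x in K', mollify μ K φ g x ^ 2 * Real.exp (-V x) ∂μ
      ≤ ∫ x in K', Real.exp ω * ∫ y, φ y * w (x + y) ∂μ ∂μ := by
        refine setIntegral_mono_on (ContinuousOn.integrableOn_compact hK' ?_)
          (hprod.integral_prod_left.const_mul _).integrableOn hK'.measurableSet fun x hx => ?_
        · exact (hcont.pow 2).continuousOn.mul (hVe.mono hsub)
        · calc mollify μ K φ g x ^ 2 * Real.exp (-V x)
              ≤ (∫ y, φ y * K.indicator g (x + y) ^ 2 ∂μ) * Real.exp (-V x) := by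
                gcongr; exact mollify_sq_le hφ hg hg2 x
            _ = ∫ y, φ y * K.indicator g (x + y) ^ 2 * Real.exp (-V x) ∂μ := by
                rw [integral_mul_const]
            _ ≤ ∫ y, Real.exp ω * (φ y * w (x + y)) ∂μ := by
                refine integral_mono ((hφ.integrable_mul hg2 x).mul_const _)
                  ((hφ.integrable_mul hw x).const_mul _) fun y => ?_
                by_cases h0 : φ y = 0
                · simp [h0]
                · have hy := hφ.supp y h0
                  have hxy := hx y hy
                  have h1 := hω x (hsub hx) (x + y) hxy (by simpa using hy)
                  have h2 : Real.exp (-V x) ≤ Real.exp ω * Real.exp (-V (x + y)) := by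
                    rw [← Real.exp_add]; exact Real.exp_le_exp.2 (by linarith)
                  simp only [w, Set.indicator_of_mem hxy]
                  calc φ y * g (x + y) ^ 2 * Real.exp (-V x)
                      ≤ φ y * g (x + y) ^ 2 * (Real.exp ω * Real.exp (-V (x + y))) := by
                        have := hφ.nonneg y
                        gcongr
                    _ = _ := by ring
            _ = _ := integral_const_mul _ _
    _ ≤ _ := by
        refine setIntegral_le_integral (hprod.integral_prod_left.const_mul _)
          (ae_of_all _ fun x => ?_)
        exact mul_nonneg (Real.exp_pos _).le (integral_nonneg fun y =>
          mul_nonneg (hφ.nonneg y) (hw0 _))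

theorem entropy_mollify_le (hφ : IsMollifier μ ε φ) (hε : 0 < ε) (hK : IsCompact K)
    (hKc : Convex ℝ K) {V : E → ℝ} (hV : ContinuousOn V K) {c : ℝ} (hc : 0 < c)
    (hconv : UniformlyConvexPotential L K V c) (hL : Function.Injective L)
    {f g : E → ℝ} (hfc : ContinuousOn f K) {a : ℝ} (ha : 0 < a) (hfa : ∀ x ∈ K, a ≤ f x)
    (hgm : Measurable (K.indicator g)) (hg0 : ∀ x, 0 ≤ g x)
    (hg : Integrable (K.indicator g) μ) (hg2 : Integrable (fun x => K.indicator g x ^ 2) μ)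
    (hslope : ∀ x ∈ K, ∀ η > 0, ∀ᶠ y in 𝓝[K] x, |f y - f x| ≤ (g x + η) * ‖L (y - x)‖)
    {ω : ℝ} (hω : ∀ x ∈ K, ∀ y ∈ K, ‖y - x‖ ≤ ε → V y - V x ≤ ω) :
    (∫ x in innerParallel K ε, mollify μ K φ f x ^ 2 * Real.log (mollify μ K φ f x ^ 2) *
        Real.exp (-V x) ∂μ) -
      (∫ x in innerParallel K ε, mollify μ K φ f x ^ 2 * Real.exp (-V x) ∂μ) *
        Real.log ((∫ x in innerParallel K ε, mollify μ K φ f x ^ 2 * Real.exp (-V x) ∂μ) /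
          ∫ x in innerParallel K ε, Real.exp (-V x) ∂μ)
      ≤ 2 / c * (Real.exp ω * ∫ x in K, g x ^ 2 * Real.exp (-V x) ∂μ) := by
  have hf : Integrable (K.indicator f) μ :=
    (integrable_indicator_iff hK.measurableSet).2 (hfc.integrableOn_compact hK)
  have hsub : innerParallel K ε ⊆ K := innerParallel_subset hε.le
  have hK' : IsCompact (innerParallel K ε) := isCompact_innerParallel hK hε.le
  have hGc := continuous_mollify hφ hg
  refine (entropy_sq_le_of_continuousOn (L := L) (c := c) μ hK'
    (convex_innerParallel hKc ε) (hV.mono hsub) hc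
    (fun x hx y hy => hconv x (hsub hx) y (hsub hy)) (continuous_mollify hφ hf).continuousOn
    ?_ hGc.continuousOn ?_ ?_).trans ?_
  · intro x hx
    refine ha.trans_le ?_
    have e : a = ∫ y, φ y * a ∂μ := by rw [integral_mul_const, hφ.integral, one_mul]
    rw [e]
    refine integral_mono (hφ.integrable.mul_const a) (hφ.integrable_mul hf x) fun y => ?_
    by_cases h : φ y = 0
    · simp [h]
    · have hy := hx y (hφ.supp y h)
      simp only [Set.indicator_of_mem hy]
      exact mul_le_mul_of_nonneg_left (hfa _ hy) (hφ.nonneg y)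
  · intro x _
    exact integral_nonneg fun y => mul_nonneg (hφ.nonneg y)
      (Set.indicator_nonneg (fun _ _ => hg0 _) _)
  · intro η hη
    obtain ⟨C, hC, hLC⟩ := (L : E →ₗ[ℝ] H).exists_antilipschitzWith (LinearMap.ker_eq_bot.2 hL)
    obtain ⟨r, hr, hunif⟩ := Metric.uniformContinuousOn_iff.1
      (hK'.uniformContinuousOn_of_continuous hGc.continuousOn) η hη
    refine ⟨r / C, by positivity, fun x hx z hz hxz => ?_⟩
    refine (mollify_sub_le hφ hKc hfc hf hgm hg hslope hx hz).trans ?_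
    gcongr
    have hdist : ‖x - z‖ < r := by
      have h1 := hLC.le_mul_dist x z
      rw [dist_eq_norm, dist_eq_norm] at h1
      have h2 : (L : E →ₗ[ℝ] H) x - (L : E →ₗ[ℝ] H) z = L (x - z) := by simp
      rw [h2] at h1
      rw [lt_div_iff₀ (by positivity)] at hxz
      linarith
    calc ∫ τ in (0 : ℝ)..1, mollify μ K φ g (z + τ • (x - z))
        ≤ ∫ τ in (0 : ℝ)..1, (mollify μ K φ g z + η) := by
          refine intervalIntegral.integral_mono_on zero_le_one
            (Continuous.intervalIntegrable (by fun_prop) _ _)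
            (Continuous.intervalIntegrable (by fun_prop) _ _) fun τ hτ => ?_
          have hm : z + τ • (x - z) ∈ innerParallel K ε :=
            (convex_innerParallel hKc ε).add_smul_sub_mem hz hx hτ
          have h1 := hunif _ hm z hz (by
            rw [dist_eq_norm, add_sub_cancel_left, norm_smul, Real.norm_of_nonneg hτ.1]
            exact (mul_le_of_le_one_left (norm_nonneg _) hτ.2).trans_lt hdist)
          rw [Real.dist_eq] at h1
          linarith [(abs_lt.1 h1).2]
      _ = _ := by simp
  · gcongr
    exact integral_mollify_sq_le hφ hε.le hK hV hgm hg hg2 hω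

/-- The logarithmic Sobolev inequality for a uniformly convex potential on a compact convex set,
for bounded positive functions whose slope is everywhere finite and square integrable. -/
theorem entropy_sq_le (hK : IsCompact K)
    (hKc : Convex ℝ K) {V : E → ℝ} (hV : ContinuousOn V K) {c : ℝ} (hc : 0 < c)
    (hconv : UniformlyConvexPotential L K V c) (hL : Function.Injective L)
    {f g : E → ℝ} (hfc : ContinuousOn f K) {a : ℝ} (ha : 0 < a) (hfa : ∀ x ∈ K, a ≤ f x)
    (hgm : Measurable (K.indicator g)) (hg0 : ∀ x, 0 ≤ g x)
    (hg2 : IntegrableOn (fun x => g x ^ 2) K μ)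
    (hslope : ∀ x ∈ K, ∀ η > 0, ∀ᶠ y in 𝓝[K] x, |f y - f x| ≤ (g x + η) * ‖L (y - x)‖) :
    (∫ x in K, f x ^ 2 * Real.log (f x ^ 2) * Real.exp (-V x) ∂μ) -
      (∫ x in K, f x ^ 2 * Real.exp (-V x) ∂μ) *
        Real.log ((∫ x in K, f x ^ 2 * Real.exp (-V x) ∂μ) / ∫ x in K, Real.exp (-V x) ∂μ)
      ≤ 2 / c * ∫ x in K, g x ^ 2 * Real.exp (-V x) ∂μ := by
  rcases eq_or_ne (μ K) 0 with h0 | h0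
  · simp [Measure.restrict_eq_zero.2 h0]
  have hKm := hK.measurableSet
  have hgm' : AEStronglyMeasurable g (μ.restrict K) :=
    (aestronglyMeasurable_indicator_iff hKm).1 hgm.aestronglyMeasurable
  have : IsFiniteMeasure (μ.restrict K) := ⟨by simpa using hK.measure_lt_top⟩
  have hg : Integrable (K.indicator g) μ := by
    rw [integrable_indicator_iff hKm]
    have h2 : MemLp g 2 (μ.restrict K) := (memLp_two_iff_integrable_sq hgm').2 hg2
    exact h2.integrable (by norm_num)
  have hg2' : Integrable (fun x => K.indicator g x ^ 2) μ := by
    have := (integrable_indicator_iff hKm).2 hg2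
    refine this.congr (ae_of_all _ fun x => ?_)
    by_cases hx : x ∈ K <;> simp [hx]
  have hf : Integrable (K.indicator f) μ :=
    (integrable_indicator_iff hKm).2 (hfc.integrableOn_compact hK)
  obtain ⟨b, hb⟩ := hK.exists_bound_of_continuousOn hfc
  set ε : ℕ → ℝ := fun n => 1 / ((n : ℝ) + 1)
  have hε : ∀ n, 0 < ε n := fun n => Nat.one_div_pos_of_nat
  have hε0 : Tendsto ε atTop (𝓝 0) := tendsto_one_div_add_atTop_nhds_zero_nat
  choose φ hφ using fun n => exists_isMollifier μ (hε n)
  have hint : ∀ᵐ x ∂(μ.restrict K), x ∈ interior K := by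
    have : ∀ᵐ x ∂μ, x ∉ frontier K := measure_eq_zero_iff_ae_notMem.1 (hKc.addHaar_frontier μ)
    filter_upwards [ae_restrict_of_ae this, ae_restrict_mem hKm] with x h1 h2
    by_contra h3
    exact h1 ⟨subset_closure h2, h3⟩
  have lim : ∀ Φ : ℝ → ℝ, ContinuousOn Φ (Set.Icc a b) →
      Tendsto (fun n => ∫ x in innerParallel K (ε n), Φ (mollify μ K (φ n) f x) *
        Real.exp (-V x) ∂μ) atTop (𝓝 (∫ x in K, Φ (f x) * Real.exp (-V x) ∂μ)) := by
    intro Φ hΦ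
    obtain ⟨C, hC⟩ := isCompact_Icc.exists_bound_of_continuousOn hΦ
    have hb' : ∀ n, ∀ x ∈ innerParallel K (ε n), mollify μ K (φ n) f x ∈ Set.Icc a b :=
      fun n x hx => mollify_bounds (hφ n) hf hx fun y hy =>
        ⟨hfa _ (hx y hy), (le_abs_self _).trans (hb _ (hx y hy))⟩
    have e : ∀ n, ∫ x in innerParallel K (ε n), Φ (mollify μ K (φ n) f x) * Real.exp (-V x) ∂μ
        = ∫ x in K, (innerParallel K (ε n)).indicator
          (fun x => Φ (mollify μ K (φ n) f x) * Real.exp (-V x)) x ∂μ := by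
      intro n
      rw [setIntegral_indicator (isCompact_innerParallel hK (hε n).le).measurableSet,
        Set.inter_eq_self_of_subset_right (innerParallel_subset (hε n).le)]
    simp only [e]
    have hVi : IntegrableOn (fun x => Real.exp (-V x)) K μ :=
      ContinuousOn.integrableOn_compact hK (by fun_prop)
    refine tendsto_integral_of_dominated_convergence (fun x => C * Real.exp (-V x)) ?_
      (hVi.const_mul C) ?_ ?_
    · intro n
      have hKn := isCompact_innerParallel hK (hε n).le
      refine (aestronglyMeasurable_indicator_iff hKn.measurableSet).2 ?_
      have h1 : IntegrableOn (fun x => Φ (mollify μ K (φ n) f x) * Real.exp (-V x))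
          (innerParallel K (ε n)) μ := by
        refine ContinuousOn.integrableOn_compact hKn (ContinuousOn.mul ?_ ?_)
        · exact hΦ.comp (continuous_mollify (hφ n) hf).continuousOn (hb' n)
        · have := hV.mono (innerParallel_subset (hε n).le)
          fun_prop
      exact h1.aestronglyMeasurable.mono_measure
        (Measure.restrict_mono le_rfl Measure.restrict_le_self)
    · intro n
      filter_upwards [ae_restrict_mem hKm] with x hx
      by_cases hxn : x ∈ innerParallel K (ε n)
      · rw [Set.indicator_of_mem hxn, norm_mul, Real.norm_of_nonneg (Real.exp_pos _).le]
        gcongr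
        exact hC _ (hb' n x hxn)
      · rw [Set.indicator_of_notMem hxn, norm_zero]
        have : 0 ≤ C := (norm_nonneg _).trans (hC (f x)
          ⟨hfa x hx, (le_abs_self _).trans (hb _ hx)⟩)
        positivity
    · filter_upwards [hint] with x hx
      have hxK := interior_subset hx
      have hev : ∀ᶠ n in atTop, x ∈ innerParallel K (ε n) := by
        obtain ⟨r, hr, h⟩ := exists_mem_innerParallel hx
        filter_upwards [hε0.eventually (Iio_mem_nhds hr)] with n hn
        exact h _ (le_of_lt hn)
      have hconvf : Tendsto (fun n => mollify μ K (φ n) f x) atTop (𝓝 (f x)) := by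
        rw [Metric.tendsto_atTop]
        intro η hη
        obtain ⟨r, hr, h⟩ := Metric.continuousWithinAt_iff.1 (hfc x hxK) (η / 2) (by positivity)
        obtain ⟨n₀, hn₀⟩ := eventually_atTop.1 (hev.and (hε0.eventually (Iio_mem_nhds hr)))
        refine ⟨n₀, fun n hn => ?_⟩
        obtain ⟨h1, h2⟩ := hn₀ n hn
        have := mollify_bounds (hφ n) hf h1 (a := f x - η / 2) (b := f x + η / 2) fun y hy => by
          have := h (h1 y hy) (by
            rw [dist_self_add_left]; exact lt_of_le_of_lt hy h2)
          rw [Real.dist_eq] at this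
          obtain ⟨h3, h4⟩ := abs_lt.1 this
          constructor <;> linarith
        rw [Real.dist_eq, abs_lt]
        constructor <;> linarith [this.1, this.2]
      have h1 : Tendsto (fun n => Φ (mollify μ K (φ n) f x)) atTop (𝓝 (Φ (f x))) := by
        refine (hΦ (f x) ⟨hfa x hxK, (le_abs_self _).trans (hb _ hxK)⟩).tendsto.comp
          (tendsto_nhdsWithin_iff.2 ⟨hconvf, ?_⟩)
        filter_upwards [hev] with n hn using hb' n x hn
      refine (h1.mul_const _).congr' ?_
      filter_upwards [hev] with n hn
      rw [Set.indicator_of_mem hn]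
  have hlog : ContinuousOn (fun r : ℝ => r ^ 2 * Real.log (r ^ 2)) (Set.Icc a b) := by
    refine ContinuousOn.mul (by fun_prop) (ContinuousOn.log (by fun_prop) fun r hr => ?_)
    have : 0 < r := ha.trans_le hr.1
    positivity
  have lim1 := lim _ hlog
  have lim2 := lim (fun r => r ^ 2) (by fun_prop)
  have lim3 := lim (fun _ => 1) (by fun_prop)
  simp only [one_mul] at lim3
  have : NeZero (μ.restrict K) := ⟨by simpa using h0⟩
  have hB : 0 < ∫ x in K, Real.exp (-V x) ∂μ :=
    integral_exp_pos (ContinuousOn.integrableOn_compact hK (by fun_prop))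
  have hA : 0 < ∫ x in K, f x ^ 2 * Real.exp (-V x) ∂μ := by
    refine lt_of_lt_of_le (mul_pos (pow_pos ha 2) hB) ?_
    rw [← integral_const_mul]
    refine setIntegral_mono_on (ContinuousOn.integrableOn_compact hK (by fun_prop))
      (ContinuousOn.integrableOn_compact hK (by fun_prop)) hKm fun x hx => ?_
    gcongr
    exact hfa x hx
  have lim4 := lim1.sub (lim2.mul ((lim2.div lim3 hB.ne').log (div_pos hA hB).ne'))
  refine le_of_forall_pos_le_add fun δ hδ => ?_
  set I := 2 / c * ∫ x in K, g x ^ 2 * Real.exp (-V x) ∂μ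
  obtain ⟨ω, hω, hωδ⟩ : ∃ ω > 0, Real.exp ω * I ≤ I + δ := by
    have : ContinuousAt (fun ω : ℝ => Real.exp ω * I) 0 := by fun_prop
    have h1 : ∀ᶠ ω in 𝓝[>] (0 : ℝ), Real.exp ω * I < I + δ := by
      refine (this.eventually_lt_const ?_).filter_mono nhdsWithin_le_nhds
      simp only [Real.exp_zero, one_mul]; linarith
    obtain ⟨ω, h, h'⟩ := (h1.and self_mem_nhdsWithin).exists
    exact ⟨ω, h', h.le⟩
  obtain ⟨r, hr, hunif⟩ := Metric.uniformContinuousOn_iff.1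
    (hK.uniformContinuousOn_of_continuous hV) ω hω
  refine le_trans (le_of_tendsto lim4 ?_) hωδ
  filter_upwards [hε0.eventually (Iio_mem_nhds hr)] with n hn
  refine (entropy_mollify_le (hφ n) (hε n) hK hKc hV hc hconv hL hfc ha hfa hgm hg0 hg hg2' hslope
    (ω := ω) ?_).trans (le_of_eq ?_)
  · intro x hx y hy hxy
    have := hunif y hy x hx (by rw [dist_eq_norm]; exact lt_of_le_of_lt hxy hn)
    rw [Real.dist_eq] at this
    exact (le_abs_self _).trans this.le
  · simp only [I]; ring

end Mollify

/-! ### Random Fourier series -/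

instance separableSpace_field2 : TopologicalSpace.SeparableSpace Field2 := by
  have h1 : TopologicalSpace.IsSeparable (Set.range (fourierLp (T := 2 * Real.pi) 2)) :=
    (Set.countable_range _).isSeparable
  have h2 := (h1.span (R := ℂ)).closure
  have h3 : closure (Submodule.span ℂ (Set.range (fourierLp (T := 2 * Real.pi) 2)) : Set Field2)
      = Set.univ := by
    have := span_fourierLp_closure_eq_top (T := 2 * Real.pi) (p := 2) (by norm_num)
    rw [← Submodule.topologicalClosure_coe, this]; rfl
  rw [h3] at h2
  exact TopologicalSpace.isSeparable_univ_iff.1 h2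

instance secondCountableTopology_field2 : SecondCountableTopology Field2 :=
  UniformSpace.secondCountable_of_separable _

theorem integral_norm_sq_eq (u : Field2) : ∫ θ, ‖u θ‖ ^ 2 ∂circMeasure = ‖u‖ ^ 2 := by
  have h := L2.inner_def (𝕜 := ℂ) u u
  rw [inner_self_eq_norm_sq_to_K] at h
  have h2 : ∀ θ, inner ℂ (u θ) (u θ) = ((‖u θ‖ ^ 2 : ℝ) : ℂ) := fun θ => by
    rw [inner_self_eq_norm_sq_to_K]; simp
  simp only [h2, integral_complex_ofReal] at h
  have h3 : ((‖u‖ ^ 2 : ℝ) : ℂ) = ((∫ θ, ‖u θ‖ ^ 2 ∂circMeasure : ℝ) : ℂ) := by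
    rw [← h]; simp
  exact (Complex.ofReal_injective h3).symm

theorem mem_ball_iff {N : ℝ} {u : Field2} : u ∈ ball N ↔ ‖u‖ ^ 2 ≤ N := by
  rw [← integral_norm_sq_eq]; rfl

theorem isClosed_ball (N : ℝ) : IsClosed (ball N) := by
  have : ball N = {u | ‖u‖ ^ 2 ≤ N} := Set.ext fun u => mem_ball_iff
  rw [this]
  exact isClosed_le (by fun_prop) (by fun_prop)

/-- The nonzero frequencies. -/
abbrev Freq : Type := {j : ℤ // j ≠ 0}

/-- The values of the Gaussian variables. -/
abbrev Sample : Type := Freq → ℝ × ℝ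

instance isProbabilityMeasure_gaussianLaw : IsProbabilityMeasure gaussianLaw := by
  unfold gaussianLaw; infer_instance

/-- The Fourier coefficient `(γ_j + i γ_j') / j`. -/
def coef (ω : Sample) (j : Freq) : ℂ := ((ω j).1 + (ω j).2 * Complex.I) / (j : ℤ)

/-- The part of the random Fourier series with frequencies in `J`. -/
def modeSum (J : Finset Freq) (ω : Sample) : Field2 :=
  ∑ j ∈ J, coef ω j • fourierLp 2 (j : ℤ)

/-- The frequencies `0 < |j| ≤ n`. -/
def freqs (n : ℕ) : Finset Freq := (Finset.Icc (-(n : ℤ)) n).subtype (· ≠ 0)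

theorem mem_freqs {n : ℕ} {j : Freq} : j ∈ freqs n ↔ |(j : ℤ)| ≤ n := by
  simp [freqs, abs_le]

theorem freqs_mono : Monotone freqs := by
  intro m n hmn j hj
  rw [mem_freqs] at hj ⊢
  exact hj.trans (by exact_mod_cast hmn)

theorem tendsto_freqs : Tendsto freqs atTop atTop :=
  tendsto_atTop_finset_of_monotone freqs_mono fun j =>
    ⟨(j : ℤ).natAbs, mem_freqs.2 (by simp)⟩

theorem norm_coef_sq (ω : Sample) (j : Freq) :
    ‖coef ω j‖ ^ 2 = ((ω j).1 ^ 2 + (ω j).2 ^ 2) / (j : ℝ) ^ 2 := by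
  rw [coef, norm_div, div_pow, Complex.sq_norm, Complex.normSq_add_mul_I]
  simp

theorem orthonormal_freq :
    Orthonormal ℂ fun j : Freq => (fourierLp 2 (j : ℤ) : Field2) :=
  orthonormal_fourier.comp _ Subtype.val_injective

theorem norm_modeSum_sq (J : Finset Freq) (ω : Sample) :
    ‖modeSum J ω‖ ^ 2 = ∑ j ∈ J, ‖coef ω j‖ ^ 2 := by
  have h := orthonormal_freq.inner_sum (coef ω) (coef ω) J
  have h1 : inner ℂ (modeSum J ω) (modeSum J ω) = ((‖modeSum J ω‖ ^ 2 : ℝ) : ℂ) := by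
    rw [inner_self_eq_norm_sq_to_K]; simp
  have h2 : ((‖modeSum J ω‖ ^ 2 : ℝ) : ℂ) = ((∑ j ∈ J, ‖coef ω j‖ ^ 2 : ℝ) : ℂ) := by
    rw [← h1]
    refine h.trans ?_
    push_cast
    refine Finset.sum_congr rfl fun j _ => ?_
    rw [← Complex.normSq_eq_conj_mul_self, Complex.normSq_eq_norm_sq]
    push_cast; rfl
  exact Complex.ofReal_injective h2

theorem continuous_coef (j : Freq) : Continuous fun ω : Sample => coef ω j := by
  unfold coef; fun_prop

theorem continuous_modeSum (J : Finset Freq) : Continuous (modeSum J) := by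
  unfold modeSum
  exact continuous_finsetSum _ fun j _ => (continuous_coef j).smul continuous_const

/-- The series of the squares of the Fourier coefficients converges. -/
def SqSummable (ω : Sample) : Prop := Summable fun j => ‖coef ω j‖ ^ 2

theorem hasSum_loopSeries {ω : Sample} (h : SqSummable ω) :
    HasSum (fun j : Freq => coef ω j • (fourierLp 2 (j : ℤ) : Field2)) (loopSeries ω) := by
  have := (orthonormal_freq.orthogonalFamily.summable_iff_norm_sq_summable (coef ω)).2 h
  exact this.hasSum

theorem tendsto_modeSum_finset {ω : Sample} (h : SqSummable ω) :
    Tendsto (fun J => modeSum J ω) atTop (𝓝 (loopSeries ω)) := by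
  have := hasSum_loopSeries h
  simp only [HasSum, SummationFilter.unconditional_filter] at this
  exact this

theorem tendsto_modeSum {ω : Sample} (h : SqSummable ω) :
    Tendsto (fun n => modeSum (freqs n) ω) atTop (𝓝 (loopSeries ω)) :=
  (tendsto_modeSum_finset h).comp tendsto_freqs

theorem hasSum_norm_loopSeries_sq {ω : Sample} (h : SqSummable ω) :
    HasSum (fun j => ‖coef ω j‖ ^ 2) (‖loopSeries ω‖ ^ 2) := by
  have h1 : Tendsto (fun J => ‖modeSum J ω‖ ^ 2) atTop (𝓝 (‖loopSeries ω‖ ^ 2)) :=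
    (tendsto_modeSum_finset h).norm.pow 2
  simpa [HasSum, norm_modeSum_sq] using h1

theorem fourierCoeff_eq_inner (u : Field2) (k : ℤ) :
    fourierCoeff u k = inner ℂ (fourierLp 2 k : Field2) u := by
  rw [← fourierBasis_repr, fourierBasis.repr_apply_apply, coe_fourierBasis]

theorem continuous_fourierCoeff (k : ℤ) : Continuous fun u : Field2 => fourierCoeff u k := by
  simp only [fourierCoeff_eq_inner]; fun_prop

theorem continuous_dirichlet (n : ℕ) : Continuous (dirichlet n) := by
  unfold dirichlet
  exact continuous_finsetSum _ fun j _ => (continuous_fourierCoeff j).smul continuous_const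

theorem inner_modeSum (k : ℤ) (J : Finset Freq) (ω : Sample) :
    inner ℂ (fourierLp 2 k : Field2) (modeSum J ω) =
      ∑ j ∈ J, if k = j then coef ω j else 0 := by
  rw [modeSum, inner_sum]
  refine Finset.sum_congr rfl fun j _ => ?_
  rw [inner_smul_right, orthonormal_iff_ite.1 orthonormal_fourier k j]
  simp

theorem dirichlet_modeSum {n m : ℕ} (hnm : n ≤ m) (ω : Sample) :
    dirichlet n (modeSum (freqs m) ω) = modeSum (freqs n) ω := by
  have hc : ∀ k ∈ Finset.Icc (-(n : ℤ)) n, ∀ hk : k ≠ 0,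
      fourierCoeff (modeSum (freqs m) ω) k = coef ω ⟨k, hk⟩ := by
    intro k hkn hk
    rw [fourierCoeff_eq_inner, inner_modeSum, Finset.sum_eq_single ⟨k, hk⟩]
    · simp
    · intro j _ hj
      rw [if_neg fun h => hj (Subtype.ext h.symm)]
    · intro h
      refine absurd (freqs_mono hnm (mem_freqs.2 ?_)) h
      simpa [abs_le] using hkn
  have h0 : fourierCoeff (modeSum (freqs m) ω) 0 = 0 := by
    rw [fourierCoeff_eq_inner, inner_modeSum]
    exact Finset.sum_eq_zero fun j _ => if_neg fun h => j.2 h.symm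
  rw [dirichlet, ← Finset.sum_filter_of_ne (p := fun k : ℤ => k ≠ 0),
    ← Finset.sum_subtype_eq_sum_filter
      (f := fun k : ℤ => fourierCoeff (modeSum (freqs m) ω) k • (fourierLp 2 k : Field2))]
  · refine Finset.sum_congr rfl fun j hj => ?_
    rw [hc j (by simpa [abs_le] using mem_freqs.1 hj) j.2]
  · intro k _ hk h
    rw [h, h0, zero_smul] at hk
    exact hk rfl

theorem dirichlet_loopSeries {ω : Sample} (h : SqSummable ω) (n : ℕ) :
    dirichlet n (loopSeries ω) = modeSum (freqs n) ω := by
  have h1 := ((continuous_dirichlet n).tendsto _).comp (tendsto_modeSum h)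
  refine tendsto_nhds_unique h1 (tendsto_const_nhds.congr' ?_)
  filter_upwards [eventually_ge_atTop n] with m hm
  exact (dirichlet_modeSum hm ω).symm

theorem summable_freq_rpow {b : ℝ} (hb : 1 < b) :
    Summable fun j : Freq => |((j : ℤ) : ℝ)| ^ (-b) :=
  (Real.summable_abs_int_rpow hb).subtype _

theorem hasSum_int_inv_sq : HasSum (fun k : ℤ => 1 / (k : ℝ) ^ 2) (Real.pi ^ 2 / 3) := by
  have h := HasSum.of_nat_of_neg (f := fun k : ℤ => 1 / (k : ℝ) ^ 2)
    (by simpa using hasSum_zeta_two) (by simpa using hasSum_zeta_two)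
  have h0 : 1 / (((0 : ℤ) : ℝ)) ^ 2 = 0 := by simp
  have e : Real.pi ^ 2 / 3 = Real.pi ^ 2 / 6 + Real.pi ^ 2 / 6 - 0 := by ring
  rw [h0] at h
  rw [e]
  exact h

theorem summable_freq_inv_sq : Summable fun j : Freq => 1 / ((j : ℤ) : ℝ) ^ 2 :=
  hasSum_int_inv_sq.summable.subtype _

theorem sum_inv_sq_le (J : Finset Freq) : ∑ j ∈ J, 1 / ((j : ℤ) : ℝ) ^ 2 ≤ Real.pi ^ 2 / 3 := by
  have h := sum_le_hasSum (J.map (Function.Embedding.subtype _)) (fun k _ => by positivity)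
    hasSum_int_inv_sq
  simpa using h

theorem lintegral_eval_gaussianLaw (j : Freq) {F : ℝ × ℝ → ℝ≥0∞} (hF : Measurable F) :
    ∫⁻ ω, F (ω j) ∂gaussianLaw = ∫⁻ p, F p ∂((gaussianReal 0 1).prod (gaussianReal 0 1)) := by
  have h : MeasurePreserving (Function.eval j) gaussianLaw
    ((gaussianReal 0 1).prod (gaussianReal 0 1)) := measurePreserving_eval_infinitePi
      (fun _ : Freq => (gaussianReal 0 1).prod (gaussianReal 0 1)) j
  exact h.lintegral_comp hF

theorem integrable_sq_gaussianReal : Integrable (fun x : ℝ => x ^ 2) (gaussianReal 0 1) := by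
  have h : MemLp (fun x : ℝ => x) 2 (gaussianReal 0 1) := memLp_id_gaussianReal 2
  exact (memLp_two_iff_integrable_sq measurable_id.aestronglyMeasurable).1 h

/-- The second moment of a standard complex Gaussian variable. -/
def secondMoment : ℝ≥0∞ :=
  ∫⁻ p : ℝ × ℝ, ENNReal.ofReal (p.1 ^ 2 + p.2 ^ 2) ∂((gaussianReal 0 1).prod (gaussianReal 0 1))

theorem secondMoment_ne_top : secondMoment ≠ ∞ := by
  have h1 : Integrable (fun p : ℝ × ℝ => p.1 ^ 2)
      ((gaussianReal 0 1).prod (gaussianReal 0 1)) := integrable_sq_gaussianReal.comp_fst _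
  have h2 : Integrable (fun p : ℝ × ℝ => p.2 ^ 2)
      ((gaussianReal 0 1).prod (gaussianReal 0 1)) := integrable_sq_gaussianReal.comp_snd _
  exact (Integrable.lintegral_lt_top (h1.add h2)).ne

theorem lintegral_norm_coef_sq (j : Freq) :
    ∫⁻ ω, ENNReal.ofReal (‖coef ω j‖ ^ 2) ∂gaussianLaw =
      secondMoment * ENNReal.ofReal (1 / ((j : ℤ) : ℝ) ^ 2) := by
  simp only [norm_coef_sq]
  rw [lintegral_eval_gaussianLaw j
    (F := fun p => ENNReal.ofReal ((p.1 ^ 2 + p.2 ^ 2) / ((j : ℤ) : ℝ) ^ 2)) (by fun_prop),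
    secondMoment, ← lintegral_mul_const _ (by fun_prop)]
  refine lintegral_congr fun p => ?_
  rw [← ENNReal.ofReal_mul (by positivity)]
  congr 1
  ring

theorem lintegral_tsum_norm_coef_sq_ne_top :
    ∫⁻ ω, ∑' j : Freq, ENNReal.ofReal (‖coef ω j‖ ^ 2) ∂gaussianLaw ≠ ∞ := by
  rw [lintegral_tsum]
  · simp only [lintegral_norm_coef_sq]
    rw [ENNReal.tsum_mul_left]
    refine ENNReal.mul_ne_top secondMoment_ne_top ?_
    rw [← ENNReal.ofReal_tsum_of_nonneg (fun j => by positivity) summable_freq_inv_sq]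
    exact ENNReal.ofReal_ne_top
  · intro j
    exact (ENNReal.continuous_ofReal.comp ((continuous_coef j).norm.pow 2)).measurable.aemeasurable

theorem ae_sqSummable : ∀ᵐ ω ∂gaussianLaw, SqSummable ω := by
  have h := ae_lt_top' (μ := gaussianLaw)
    (f := fun ω => ∑' j : Freq, ENNReal.ofReal (‖coef ω j‖ ^ 2)) ?_
    lintegral_tsum_norm_coef_sq_ne_top
  · filter_upwards [h] with ω hω
    have := ENNReal.summable_toReal hω.ne
    refine this.congr fun j => ?_
    rw [ENNReal.toReal_ofReal (by positivity)]
  · exact AEMeasurable.tsum fun j =>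
      (ENNReal.continuous_ofReal.comp ((continuous_coef j).norm.pow 2)).measurable.aemeasurable

theorem aemeasurable_loopSeries : AEMeasurable loopSeries gaussianLaw := by
  refine aemeasurable_of_tendsto_metrizable_ae atTop
    (fun n => (continuous_modeSum (freqs n)).measurable.aemeasurable) ?_
  filter_upwards [ae_sqSummable] with ω hω using tendsto_modeSum hω

/-! ### Pointwise Gaussian estimates -/

theorem map_sum_gaussianLaw (a b : Freq → ℝ) (J : Finset Freq) :
    gaussianLaw.map (fun ω => ∑ j ∈ J, (a j * (ω j).1 + b j * (ω j).2)) =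
      gaussianReal 0 (∑ j ∈ J, (a j ^ 2 + b j ^ 2).toNNReal) := by
  classical
  have hind : iIndepFun (fun (j : Freq) (ω : Sample) => a j * (ω j).1 + b j * (ω j).2)
      gaussianLaw :=
    iIndepFun_infinitePi (X := fun (j : Freq) (p : ℝ × ℝ) => a j * p.1 + b j * p.2)
      (fun j => by fun_prop)
  have hone : ∀ j, gaussianLaw.map (fun ω => a j * (ω j).1 + b j * (ω j).2) =
      gaussianReal 0 (a j ^ 2 + b j ^ 2).toNNReal := by
    intro j
    have hmp : MeasurePreserving (Function.eval j) gaussianLaw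
      ((gaussianReal 0 1).prod (gaussianReal 0 1)) := measurePreserving_eval_infinitePi
        (fun _ : Freq => (gaussianReal 0 1).prod (gaussianReal 0 1)) j
    have h1 : gaussianLaw.map (fun ω => a j * (ω j).1 + b j * (ω j).2) =
        ((gaussianReal 0 1).prod (gaussianReal 0 1)).map (fun p => a j * p.1 + b j * p.2) := by
      rw [← hmp.map_eq, Measure.map_map (by fun_prop) (by fun_prop)]
      rfl
    rw [h1]
    have hxy : IndepFun (fun p : ℝ × ℝ => a j * p.1) (fun p : ℝ × ℝ => b j * p.2)
        ((gaussianReal 0 1).prod (gaussianReal 0 1)) :=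
      indepFun_prod (X := fun x : ℝ => a j * x) (Y := fun x : ℝ => b j * x)
        (by fun_prop) (by fun_prop)
    have hx : ((gaussianReal 0 1).prod (gaussianReal 0 1)).map (fun p : ℝ × ℝ => a j * p.1) =
        gaussianReal 0 (a j ^ 2).toNNReal := by
      have : (fun p : ℝ × ℝ => a j * p.1) = (fun x => a j * x) ∘ Prod.fst := rfl
      rw [this, ← Measure.map_map (by fun_prop) (by fun_prop), Measure.map_fst_prod]
      simp only [measure_univ, one_smul, gaussianReal_map_const_mul, mul_zero, mul_one]
      congr 1
      ext
      simp [sq_nonneg]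
    have hy : ((gaussianReal 0 1).prod (gaussianReal 0 1)).map (fun p : ℝ × ℝ => b j * p.2) =
        gaussianReal 0 (b j ^ 2).toNNReal := by
      have : (fun p : ℝ × ℝ => b j * p.2) = (fun x => b j * x) ∘ Prod.snd := rfl
      rw [this, ← Measure.map_map (by fun_prop) (by fun_prop), Measure.map_snd_prod]
      simp only [measure_univ, one_smul, gaussianReal_map_const_mul, mul_zero, mul_one]
      congr 1
      ext
      simp [sq_nonneg]
    have := gaussianReal_add_gaussianReal_of_indepFun hxy hx hy
    rw [add_zero, ← Real.toNNReal_add (sq_nonneg _) (sq_nonneg _)] at this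
    exact this
  induction J using Finset.induction_on with
  | empty => simp
  | insert k J hk ih =>
    have hi := hind.indepFun_finsetSum_of_notMem (fun j => by fun_prop) hk
    have e : ∑ j ∈ J, (fun ω : Sample => a j * (ω j).1 + b j * (ω j).2) =
        fun ω => ∑ j ∈ J, (a j * (ω j).1 + b j * (ω j).2) := by
      ext ω; simp
    rw [e] at hi
    have := gaussianReal_add_gaussianReal_of_indepFun hi.symm (hone k) ih
    rw [Finset.sum_insert hk]
    simp only [Finset.sum_insert hk]
    rw [zero_add] at this
    exact this

theorem lintegral_sum_gaussianLaw (a b : Freq → ℝ) (J : Finset Freq) {F : ℝ → ℝ≥0∞}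
    (hF : Measurable F) :
    ∫⁻ ω, F (∑ j ∈ J, (a j * (ω j).1 + b j * (ω j).2)) ∂gaussianLaw =
      ∫⁻ x, F (√(∑ j ∈ J, (a j ^ 2 + b j ^ 2)) * x) ∂(gaussianReal 0 1) := by
  have hm : Measurable fun ω : Sample => ∑ j ∈ J, (a j * (ω j).1 + b j * (ω j).2) := by
    fun_prop
  rw [← lintegral_map hF hm, map_sum_gaussianLaw,
    ← lintegral_map (f := F) (g := fun x => √(∑ j ∈ J, (a j ^ 2 + b j ^ 2)) * x) hF (by fun_prop),
    gaussianReal_map_const_mul]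
  congr 2
  · simp
  · ext
    simp only [NNReal.coe_sum, mul_one, NNReal.coe_mk]
    rw [Real.sq_sqrt (Finset.sum_nonneg fun j _ => by positivity)]
    exact Finset.sum_congr rfl fun j _ => Real.coe_toNNReal _ (by positivity)

/-- The trigonometric polynomial with the random coefficients in `J`. -/
def trigPoly (J : Finset Freq) (ω : Sample) (θ : Circ) : ℂ :=
  ∑ j ∈ J, coef ω j * fourier (j : ℤ) θ

theorem coeFn_modeSum (J : Finset Freq) (ω : Sample) :
    (modeSum J ω : Circ → ℂ) =ᵐ[circMeasure] trigPoly J ω := by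
  have h1 := Lp.coeFn_finsetSum J (fun j : Freq => coef ω j • (fourierLp 2 (j : ℤ) : Field2))
  have h2 : ∀ᵐ θ ∂circMeasure, ∀ j : Freq,
      (coef ω j • (fourierLp 2 (j : ℤ) : Field2)) θ = coef ω j * fourier (j : ℤ) θ := by
    rw [ae_all_iff]
    intro j
    filter_upwards [Lp.coeFn_smul (coef ω j) (fourierLp 2 (j : ℤ) : Field2),
      coeFn_fourierLp (T := 2 * Real.pi) 2 (j : ℤ)] with θ h3 h4
    rw [h3, Pi.smul_apply, h4, smul_eq_mul]
  filter_upwards [h1, h2] with θ h3 h4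
  rw [modeSum, h3, Finset.sum_apply]
  exact Finset.sum_congr rfl fun j _ => h4 j

theorem continuous_trigPoly (J : Finset Freq) :
    Continuous fun p : Sample × Circ => trigPoly J p.1 p.2 := by
  unfold trigPoly
  refine continuous_finsetSum _ fun j _ => ?_
  exact ((continuous_coef j).comp continuous_fst).mul ((map_continuous _).comp continuous_snd)

theorem continuous_trigPoly_left (J : Finset Freq) (θ : Circ) :
    Continuous fun ω : Sample => trigPoly J ω θ := by
  unfold trigPoly
  exact continuous_finsetSum _ fun j _ => (continuous_coef j).mul continuous_const

theorem norm_fourier_eq_one (k : ℤ) (θ : Circ) : ‖fourier k θ‖ = 1 := by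
  rw [fourier_apply]; exact Circle.norm_coe _

theorem re_trigPoly (J : Finset Freq) (ω : Sample) (θ : Circ) :
    (trigPoly J ω θ).re = ∑ j ∈ J, ((fourier (j : ℤ) θ).re / (j : ℤ) * (ω j).1 +
      -(fourier (j : ℤ) θ).im / (j : ℤ) * (ω j).2) := by
  rw [trigPoly, Complex.re_sum]
  refine Finset.sum_congr rfl fun j _ => ?_
  have : (coef ω j) = ((((ω j).1 / (j : ℤ) : ℝ)) : ℂ) + (((ω j).2 / (j : ℤ) : ℝ) : ℂ) * Complex.I := by
    rw [coef]; push_cast; ring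
  rw [this]
  simp
  ring

theorem im_trigPoly (J : Finset Freq) (ω : Sample) (θ : Circ) :
    (trigPoly J ω θ).im = ∑ j ∈ J, ((fourier (j : ℤ) θ).im / (j : ℤ) * (ω j).1 +
      (fourier (j : ℤ) θ).re / (j : ℤ) * (ω j).2) := by
  rw [trigPoly, Complex.im_sum]
  refine Finset.sum_congr rfl fun j _ => ?_
  have : (coef ω j) = ((((ω j).1 / (j : ℤ) : ℝ)) : ℂ) + (((ω j).2 / (j : ℤ) : ℝ) : ℂ) * Complex.I := by
    rw [coef]; push_cast; ring
  rw [this]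
  simp
  ring

theorem re_sq_add_im_sq_fourier (k : ℤ) (θ : Circ) :
    (fourier k θ).re ^ 2 + (fourier k θ).im ^ 2 = 1 := by
  have h := Complex.sq_norm (fourier k θ)
  rw [norm_fourier_eq_one, Complex.normSq_apply] at h
  linarith

theorem lintegral_re_trigPoly (J : Finset Freq) (θ : Circ) {F : ℝ → ℝ≥0∞} (hF : Measurable F) :
    ∫⁻ ω, F (trigPoly J ω θ).re ∂gaussianLaw =
      ∫⁻ x, F (√(∑ j ∈ J, 1 / ((j : ℤ) : ℝ) ^ 2) * x) ∂(gaussianReal 0 1) := by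
  simp only [re_trigPoly]
  rw [lintegral_sum_gaussianLaw _ _ J hF]
  have : ∀ j : Freq, ((fourier (j : ℤ) θ).re / (j : ℤ)) ^ 2 + (-(fourier (j : ℤ) θ).im / (j : ℤ)) ^ 2
      = 1 / ((j : ℤ) : ℝ) ^ 2 := fun j => by
    rw [div_pow, div_pow, neg_sq, ← add_div, re_sq_add_im_sq_fourier]
  simp only [this]

theorem lintegral_im_trigPoly (J : Finset Freq) (θ : Circ) {F : ℝ → ℝ≥0∞} (hF : Measurable F) :
    ∫⁻ ω, F (trigPoly J ω θ).im ∂gaussianLaw =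
      ∫⁻ x, F (√(∑ j ∈ J, 1 / ((j : ℤ) : ℝ) ^ 2) * x) ∂(gaussianReal 0 1) := by
  simp only [im_trigPoly]
  rw [lintegral_sum_gaussianLaw _ _ J hF]
  have : ∀ j : Freq, ((fourier (j : ℤ) θ).im / (j : ℤ)) ^ 2 + ((fourier (j : ℤ) θ).re / (j : ℤ)) ^ 2
      = 1 / ((j : ℤ) : ℝ) ^ 2 := fun j => by
    rw [div_pow, div_pow, ← add_div, add_comm, re_sq_add_im_sq_fourier]
  simp only [this]

/-- The exponential moment of the square of a standard Gaussian variable. -/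
def expMoment (a : ℝ) : ℝ≥0∞ := ∫⁻ x, ENNReal.ofReal (Real.exp (a * x ^ 2)) ∂(gaussianReal 0 1)

theorem expMoment_ne_top {a : ℝ} (ha : a < 1 / 2) : expMoment a ≠ ∞ := by
  rw [expMoment, gaussianReal_of_var_ne_zero _ one_ne_zero,
    lintegral_withDensity_eq_lintegral_mul _ (measurable_gaussianPDF _ _) (by fun_prop)]
  have h := (integrable_exp_neg_mul_sq (b := 1 / 2 - a) (by linarith)).const_mul
    ((√(2 * Real.pi))⁻¹)
  refine ne_of_eq_of_ne (lintegral_congr fun x => ?_) h.lintegral_lt_top.ne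
  simp only [Pi.mul_apply, gaussianPDF, gaussianPDFReal]
  rw [← ENNReal.ofReal_mul (by positivity), mul_assoc, ← Real.exp_add]
  congr 3
  · simp
  · simp; ring

/-- The fourth moment of a standard Gaussian variable. -/
def fourthMoment : ℝ≥0∞ := ∫⁻ x, ENNReal.ofReal (x ^ 4) ∂(gaussianReal 0 1)

theorem fourthMoment_ne_top : fourthMoment ≠ ∞ := by
  refine ne_top_of_le_ne_top (ENNReal.mul_ne_top (ENNReal.ofReal_ne_top (r := 32))
    (expMoment_ne_top (a := 1 / 4) (by norm_num))) ?_
  rw [fourthMoment, expMoment, ← lintegral_const_mul _ (by fun_prop)]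
  refine lintegral_mono fun x => ?_
  rw [← ENNReal.ofReal_mul (by norm_num)]
  refine ENNReal.ofReal_le_ofReal ?_
  have := Real.quadratic_le_exp_of_nonneg (x := 1 / 4 * x ^ 2) (by positivity)
  nlinarith [sq_nonneg x]

theorem lintegral_exp_norm_trigPoly_sq_le (J : Finset Freq) (θ : Circ) {b : ℝ} (hb : 0 ≤ b) :
    ∫⁻ ω, ENNReal.ofReal (Real.exp (b * ‖trigPoly J ω θ‖ ^ 2)) ∂gaussianLaw ≤
      2 * expMoment (2 * b * (Real.pi ^ 2 / 3)) := by
  have hm : Measurable fun x : ℝ => ENNReal.ofReal (Real.exp (2 * b * x ^ 2)) := by fun_prop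
  have hc := continuous_trigPoly_left J θ
  have hS : 0 ≤ ∑ j ∈ J, 1 / ((j : ℤ) : ℝ) ^ 2 := Finset.sum_nonneg fun j _ => by positivity
  have hle : ∫⁻ x, ENNReal.ofReal (Real.exp (2 * b * (√(∑ j ∈ J, 1 / ((j : ℤ) : ℝ) ^ 2) * x) ^ 2))
      ∂(gaussianReal 0 1) ≤ expMoment (2 * b * (Real.pi ^ 2 / 3)) := by
    refine lintegral_mono fun x => ENNReal.ofReal_le_ofReal (Real.exp_le_exp.2 ?_)
    rw [mul_pow, Real.sq_sqrt hS, ← mul_assoc]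
    have := sum_inv_sq_le J
    gcongr
  have hre : Measurable fun ω => ENNReal.ofReal (Real.exp (2 * b * (trigPoly J ω θ).re ^ 2)) := by
    have := (Complex.continuous_re.comp hc).measurable
    exact hm.comp this
  have hre' := lintegral_re_trigPoly J θ hm
  have him' := lintegral_im_trigPoly J θ hm
  calc ∫⁻ ω, ENNReal.ofReal (Real.exp (b * ‖trigPoly J ω θ‖ ^ 2)) ∂gaussianLaw
      ≤ ∫⁻ ω, (ENNReal.ofReal (Real.exp (2 * b * (trigPoly J ω θ).re ^ 2)) +
        ENNReal.ofReal (Real.exp (2 * b * (trigPoly J ω θ).im ^ 2))) ∂gaussianLaw := by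
        refine lintegral_mono fun ω => ?_
        rw [← ENNReal.ofReal_add (by positivity) (by positivity)]
        refine ENNReal.ofReal_le_ofReal ?_
        set z := trigPoly J ω θ
        have e : b * ‖z‖ ^ 2 = b * z.re ^ 2 + b * z.im ^ 2 := by
          rw [Complex.sq_norm, Complex.normSq_apply]; ring
        have e1 : Real.exp (2 * b * z.re ^ 2) = Real.exp (b * z.re ^ 2) ^ 2 := by
          rw [← Real.exp_nat_mul]; congr 1; push_cast; ring
        have e2 : Real.exp (2 * b * z.im ^ 2) = Real.exp (b * z.im ^ 2) ^ 2 := by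
          rw [← Real.exp_nat_mul]; congr 1; push_cast; ring
        rw [e, Real.exp_add, e1, e2]
        nlinarith [sq_nonneg (Real.exp (b * z.re ^ 2) - Real.exp (b * z.im ^ 2)),
          sq_nonneg (Real.exp (b * z.re ^ 2)), sq_nonneg (Real.exp (b * z.im ^ 2))]
    _ ≤ expMoment (2 * b * (Real.pi ^ 2 / 3)) + expMoment (2 * b * (Real.pi ^ 2 / 3)) := by
        rw [lintegral_add_left hre, hre', him']
        exact add_le_add hle hle
    _ = _ := (two_mul _).symm

theorem lintegral_norm_trigPoly_pow_four_le (J : Finset Freq) (θ : Circ) :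
    ∫⁻ ω, ENNReal.ofReal (‖trigPoly J ω θ‖ ^ 4) ∂gaussianLaw ≤
      4 * fourthMoment * ENNReal.ofReal ((∑ j ∈ J, 1 / ((j : ℤ) : ℝ) ^ 2) ^ 2) := by
  have hm : Measurable fun x : ℝ => ENNReal.ofReal (2 * x ^ 4) := by fun_prop
  have hc := continuous_trigPoly_left J θ
  have hS : 0 ≤ ∑ j ∈ J, 1 / ((j : ℤ) : ℝ) ^ 2 := Finset.sum_nonneg fun j _ => by positivity
  have heq : ∫⁻ x, ENNReal.ofReal (2 * (√(∑ j ∈ J, 1 / ((j : ℤ) : ℝ) ^ 2) * x) ^ 4)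
      ∂(gaussianReal 0 1) =
        2 * fourthMoment * ENNReal.ofReal ((∑ j ∈ J, 1 / ((j : ℤ) : ℝ) ^ 2) ^ 2) := by
    rw [fourthMoment, mul_right_comm, ← lintegral_const_mul _ (by fun_prop)]
    refine lintegral_congr fun x => ?_
    rw [← ENNReal.ofReal_ofNat, ← ENNReal.ofReal_mul (by norm_num),
      ← ENNReal.ofReal_mul (by positivity)]
    congr 1
    rw [mul_pow, show (4 : ℕ) = 2 * 2 from rfl, pow_mul, Real.sq_sqrt hS]
    ring
  have hre : Measurable fun ω => ENNReal.ofReal (2 * (trigPoly J ω θ).re ^ 4) := by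
    have := (Complex.continuous_re.comp hc).measurable
    exact hm.comp this
  have hre' := lintegral_re_trigPoly J θ hm
  have him' := lintegral_im_trigPoly J θ hm
  calc ∫⁻ ω, ENNReal.ofReal (‖trigPoly J ω θ‖ ^ 4) ∂gaussianLaw
      ≤ ∫⁻ ω, (ENNReal.ofReal (2 * (trigPoly J ω θ).re ^ 4) +
        ENNReal.ofReal (2 * (trigPoly J ω θ).im ^ 4)) ∂gaussianLaw := by
        refine lintegral_mono fun ω => ?_
        rw [← ENNReal.ofReal_add (by positivity) (by positivity)]
        refine ENNReal.ofReal_le_ofReal ?_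
        set z := trigPoly J ω θ
        have e : ‖z‖ ^ 4 = (z.re ^ 2 + z.im ^ 2) ^ 2 := by
          rw [show (4 : ℕ) = 2 * 2 from rfl, pow_mul, Complex.sq_norm, Complex.normSq_apply]; ring
        rw [e]
        nlinarith [sq_nonneg (z.re ^ 2 - z.im ^ 2)]
    _ = _ := by
        rw [lintegral_add_left hre, hre', him', heq]
        ring

/-! ### The quartic energy -/

/-- The norm of `L⁴`, with values in `[0, ∞]`. -/
def norm4 (u : Field2) : ℝ≥0∞ := eLpNorm u 4 circMeasure

theorem isClosed_norm4_le (c : ℝ≥0∞) : IsClosed {u : Field2 | norm4 u ≤ c} := by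
  refine IsSeqClosed.isClosed fun u v hu hv => ?_
  have h1 : TendstoInMeasure circMeasure (fun n => (u n : Circ → ℂ)) atTop (v : Circ → ℂ) :=
    tendstoInMeasure_of_tendsto_Lp hv
  obtain ⟨ns, _, hns⟩ := h1.exists_seq_tendsto_ae
  have h2 := Lp.eLpNorm_lim_le_liminf_eLpNorm (p := 4) (μ := circMeasure)
    (f := fun n => (u (ns n) : Circ → ℂ)) (fun n => (Lp.memLp (u (ns n))).1) (v : Circ → ℂ) hns
  refine h2.trans ?_
  refine liminf_le_of_le (by isBoundedDefault) fun b hb => ?_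
  obtain ⟨n, hn⟩ := hb.exists
  exact hn.trans (hu (ns n))

theorem measurable_norm4 : Measurable norm4 :=
  measurable_of_Iic fun c => (isClosed_norm4_le c).measurableSet

theorem norm4_le_liminf {u : ℕ → Field2} {v : Field2} (h : Tendsto u atTop (𝓝 v)) :
    norm4 v ≤ liminf (fun n => norm4 (u n)) atTop := by
  refine le_of_forall_gt fun c hc => ?_
  obtain ⟨d, hd, hdc⟩ := exists_between hc
  have h1 : ∃ᶠ n in atTop, norm4 (u n) < d := frequently_lt_of_liminf_lt (by isBoundedDefault) hd
  exact lt_of_le_of_lt ((isClosed_norm4_le d).mem_of_frequently_of_tendsto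
    (h1.mono fun n hn => hn.le) h) hdc

theorem norm4_pow_four (u : Field2) :
    norm4 u ^ 4 = ∫⁻ θ, ENNReal.ofReal (‖u θ‖ ^ 4) ∂circMeasure := by
  have h := eLpNorm_nnreal_pow_eq_lintegral (f := (u : Circ → ℂ)) (μ := circMeasure) (p := 4)
    (by norm_num)
  have e : ((4 : NNReal) : ℝ) = (4 : ℕ) := by norm_num
  rw [e] at h
  simp only [ENNReal.rpow_natCast] at h
  refine h.trans (lintegral_congr fun θ => ?_)
  rw [ENNReal.ofReal_pow (norm_nonneg _), ofReal_norm]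

theorem integral_pow_four (u : Field2) :
    ∫ θ, ‖u θ‖ ^ 4 ∂circMeasure = (norm4 u ^ 4).toReal := by
  rw [norm4_pow_four, integral_eq_lintegral_of_nonneg_ae (ae_of_all _ fun θ => by positivity)]
  exact ((Lp.memLp u).1.norm.pow 4)

theorem norm4_add_le (u v : Field2) : norm4 (u + v) ≤ norm4 u + norm4 v := by
  rw [norm4, eLpNorm_congr_ae (Lp.coeFn_add u v)]
  exact eLpNorm_add_le (Lp.memLp u).1 (Lp.memLp v).1 (by norm_num)

theorem norm4_sub_comm (u v : Field2) : norm4 (u - v) = norm4 (v - u) := by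
  rw [norm4, norm4, eLpNorm_congr_ae (Lp.coeFn_sub u v), eLpNorm_congr_ae (Lp.coeFn_sub v u),
    eLpNorm_sub_comm]

theorem tendsto_norm4 {u : ℕ → Field2} {v : Field2} (hv : norm4 v ≠ ∞)
    (h : Tendsto (fun n => norm4 (v - u n)) atTop (𝓝 0)) :
    Tendsto (fun n => norm4 (u n)) atTop (𝓝 (norm4 v)) := by
  have h1 : Tendsto (fun n => norm4 v - norm4 (v - u n)) atTop (𝓝 (norm4 v)) := by
    simpa using ENNReal.Tendsto.sub tendsto_const_nhds h (Or.inl hv)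
  have h2 : Tendsto (fun n => norm4 v + norm4 (v - u n)) atTop (𝓝 (norm4 v)) := by
    simpa using tendsto_const_nhds.add h
  refine tendsto_of_tendsto_of_tendsto_of_le_of_le h1 h2 (fun n => ?_) (fun n => ?_)
  · refine tsub_le_iff_right.2 ?_
    have := norm4_add_le (u n) (v - u n)
    rwa [add_sub_cancel] at this
  · have := norm4_add_le v (u n - v)
    rw [add_sub_cancel, norm4_sub_comm] at this
    exact this

theorem norm4_modeSum_pow_four (J : Finset Freq) (ω : Sample) :
    norm4 (modeSum J ω) ^ 4 = ∫⁻ θ, ENNReal.ofReal (‖trigPoly J ω θ‖ ^ 4) ∂circMeasure := by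
  rw [norm4_pow_four]
  refine lintegral_congr_ae ?_
  filter_upwards [coeFn_modeSum J ω] with θ hθ
  rw [hθ]

theorem lintegral_norm4_modeSum_le (J : Finset Freq) :
    ∫⁻ ω, norm4 (modeSum J ω) ^ 4 ∂gaussianLaw ≤
      4 * fourthMoment * ENNReal.ofReal ((∑ j ∈ J, 1 / ((j : ℤ) : ℝ) ^ 2) ^ 2) := by
  simp only [norm4_modeSum_pow_four]
  rw [lintegral_lintegral_swap]
  · calc _ ≤ ∫⁻ _ : Circ, 4 * fourthMoment *
          ENNReal.ofReal ((∑ j ∈ J, 1 / ((j : ℤ) : ℝ) ^ 2) ^ 2) ∂circMeasure :=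
        lintegral_mono fun θ => lintegral_norm_trigPoly_pow_four_le J θ
      _ = _ := by simp
  · have := (continuous_trigPoly J).norm.pow 4
    exact (ENNReal.continuous_ofReal.comp this).measurable.aemeasurable

theorem continuous_trigPoly_right (J : Finset Freq) (ω : Sample) : Continuous (trigPoly J ω) := by
  unfold trigPoly
  exact continuous_finsetSum _ fun j _ => continuous_const.mul (map_continuous _)

theorem norm4_modeSum_ne_top (J : Finset Freq) (ω : Sample) : norm4 (modeSum J ω) ≠ ∞ := by
  rw [norm4, eLpNorm_congr_ae (coeFn_modeSum J ω)]
  exact ((continuous_trigPoly_right J ω).memLp_of_hasCompactSupport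
    (HasCompactSupport.of_compactSpace _)).eLpNorm_ne_top

theorem sum_sdiff_freqs_le (n m : ℕ) :
    ∑ j ∈ freqs m \ freqs n, 1 / ((j : ℤ) : ℝ) ^ 2 ≤
      ((n : ℝ) + 1) ^ (-(3 / 4) : ℝ) * ∑' j : Freq, |((j : ℤ) : ℝ)| ^ (-(5 / 4) : ℝ) := by
  have hs := summable_freq_rpow (b := 5 / 4) (by norm_num)
  refine le_trans ?_ (mul_le_mul_of_nonneg_left (hs.sum_le_tsum (freqs m \ freqs n)
    fun j _ => by positivity) (by positivity))
  rw [Finset.mul_sum]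
  refine Finset.sum_le_sum fun j hj => ?_
  have hj' : (n : ℝ) + 1 ≤ |((j : ℤ) : ℝ)| := by
    have h1 := (Finset.mem_sdiff.1 hj).2
    rw [mem_freqs, not_le] at h1
    have : ((n : ℤ) + 1 : ℤ) ≤ |(j : ℤ)| := h1
    exact_mod_cast this
  have hpos : 0 < |((j : ℤ) : ℝ)| := by
    have : (0 : ℝ) ≤ n := Nat.cast_nonneg n
    linarith
  have e : 1 / ((j : ℤ) : ℝ) ^ 2 = |((j : ℤ) : ℝ)| ^ (-(3 / 4) : ℝ) *
      |((j : ℤ) : ℝ)| ^ (-(5 / 4) : ℝ) := by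
    rw [← Real.rpow_add hpos, ← sq_abs]
    norm_num
  rw [e]
  exact mul_le_mul_of_nonneg_right
    (Real.rpow_le_rpow_of_nonpos (by positivity) hj' (by norm_num)) (by positivity)

theorem lintegral_norm4_tail_le (n : ℕ) :
    ∫⁻ ω, norm4 (loopSeries ω - modeSum (freqs n) ω) ^ 4 ∂gaussianLaw ≤
      4 * fourthMoment * ENNReal.ofReal ((((n : ℝ) + 1) ^ (-(3 / 4) : ℝ) *
        ∑' j : Freq, |((j : ℤ) : ℝ)| ^ (-(5 / 4) : ℝ)) ^ 2) := by
  have h1 : ∀ᵐ ω ∂gaussianLaw, norm4 (loopSeries ω - modeSum (freqs n) ω) ^ 4 ≤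
      liminf (fun m => norm4 (modeSum (freqs m \ freqs n) ω) ^ 4) atTop := by
    filter_upwards [ae_sqSummable] with ω hω
    have h2 : Tendsto (fun m => modeSum (freqs m \ freqs n) ω) atTop
        (𝓝 (loopSeries ω - modeSum (freqs n) ω)) := by
      refine ((tendsto_modeSum hω).sub_const _).congr' ?_
      filter_upwards [eventually_ge_atTop n] with m hm
      rw [modeSum, modeSum, modeSum, ← Finset.sum_sdiff (freqs_mono hm), add_sub_cancel_right]
    have h3 := norm4_le_liminf h2
    calc _ ≤ (liminf (fun m => norm4 (modeSum (freqs m \ freqs n) ω)) atTop) ^ 4 := by gcongr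
      _ = _ := Monotone.map_liminf_of_continuousAt (f := fun x : ℝ≥0∞ => x ^ 4)
        (fun a b hab => by dsimp only; gcongr) _ (ENNReal.continuous_pow 4).continuousAt
  refine (lintegral_mono_ae h1).trans ((lintegral_liminf_le fun m => ?_).trans ?_)
  · exact (measurable_norm4.comp (continuous_modeSum _).measurable).pow_const 4
  · refine liminf_le_of_le (by isBoundedDefault) fun b hb => ?_
    obtain ⟨m, hm⟩ := hb.exists
    refine hm.trans ((lintegral_norm4_modeSum_le _).trans ?_)
    have := sum_sdiff_freqs_le n m
    have : 0 ≤ ∑ j ∈ freqs m \ freqs n, 1 / ((j : ℤ) : ℝ) ^ 2 :=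
      Finset.sum_nonneg fun j _ => by positivity
    gcongr

/-- Almost surely the partial sums of the random Fourier series converge in `L⁴`. -/
theorem ae_tendsto_norm4_tail :
    ∀ᵐ ω ∂gaussianLaw,
      Tendsto (fun n => norm4 (loopSeries ω - modeSum (freqs n) ω)) atTop (𝓝 0) := by
  have hmeas : ∀ n, AEMeasurable
      (fun ω => norm4 (loopSeries ω - modeSum (freqs n) ω) ^ 4) gaussianLaw := fun n =>
    (measurable_norm4.comp_aemeasurable (aemeasurable_loopSeries.sub
      (continuous_modeSum _).measurable.aemeasurable)).pow_const 4
  have hfin : ∫⁻ ω, ∑' n, norm4 (loopSeries ω - modeSum (freqs n) ω) ^ 4 ∂gaussianLaw ≠ ∞ := by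
    rw [lintegral_tsum hmeas]
    refine ne_top_of_le_ne_top ?_ (ENNReal.tsum_le_tsum lintegral_norm4_tail_le)
    rw [ENNReal.tsum_mul_left]
    refine ENNReal.mul_ne_top (ENNReal.mul_ne_top (by norm_num) fourthMoment_ne_top) ?_
    have hs : Summable fun n : ℕ => (((n : ℝ) + 1) ^ (-(3 / 4) : ℝ) *
        ∑' j : Freq, |((j : ℤ) : ℝ)| ^ (-(5 / 4) : ℝ)) ^ 2 := by
      simp only [mul_pow]
      refine Summable.mul_right _ ?_
      have h1 : Summable fun n : ℕ => ((n + 1 : ℕ) : ℝ) ^ (-(3 / 2) : ℝ) :=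
        (summable_nat_add_iff 1).2 (Real.summable_nat_rpow.2 (by norm_num))
      refine h1.congr fun n => ?_
      push_cast
      rw [← Real.rpow_natCast, ← Real.rpow_mul (by positivity)]
      norm_num
    rw [← ENNReal.ofReal_tsum_of_nonneg (fun n => by positivity) hs]
    exact ENNReal.ofReal_ne_top
  filter_upwards [ae_lt_top' (AEMeasurable.tsum hmeas) hfin] with ω hω
  have h1 := ENNReal.tendsto_atTop_zero_of_tsum_ne_top hω.ne
  have h2 := ((ENNReal.continuous_rpow_const (y := (1 / 4 : ℝ))).tendsto 0).comp h1
  simp only [ENNReal.zero_rpow_of_pos (by norm_num : (0 : ℝ) < 1 / 4)] at h2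
  refine h2.congr fun n => ?_
  simp only [Function.comp]
  rw [← ENNReal.rpow_natCast, ← ENNReal.rpow_mul]
  norm_num

/-- The Fourier series converges in `L²` and in `L⁴`. -/
structure Regular (ω : Sample) : Prop where
  sqSummable : SqSummable ω
  tail : Tendsto (fun n => norm4 (loopSeries ω - modeSum (freqs n) ω)) atTop (𝓝 0)

theorem ae_regular : ∀ᵐ ω ∂gaussianLaw, Regular ω := by
  filter_upwards [ae_sqSummable, ae_tendsto_norm4_tail] with ω h1 h2 using ⟨h1, h2⟩

theorem Regular.norm4_ne_top {ω : Sample} (h : Regular ω) : norm4 (loopSeries ω) ≠ ∞ := by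
  obtain ⟨n, hn⟩ := (h.tail.eventually (Iio_mem_nhds (zero_lt_one (α := ℝ≥0∞)))).exists
  have := norm4_add_le (modeSum (freqs n) ω) (loopSeries ω - modeSum (freqs n) ω)
  rw [add_sub_cancel] at this
  refine ne_top_of_le_ne_top (ENNReal.add_ne_top.2 ⟨norm4_modeSum_ne_top _ _, ?_⟩) this
  exact (lt_trans hn ENNReal.one_lt_top).ne

/-! ### The density of the Gibbs measure -/

/-- The unnormalized density of the Gibbs measure with respect to the loop measure. -/
def dens (N lam : ℝ) (u : Field2) : ℝ :=
  (ball N).indicator (fun u => Real.exp (lam / 4 * ∫ θ, ‖u θ‖ ^ 4 ∂circMeasure)) u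

theorem measurable_exp_quartic (lam : ℝ) :
    Measurable fun u : Field2 => Real.exp (lam / 4 * ∫ θ, ‖u θ‖ ^ 4 ∂circMeasure) := by
  simp only [integral_pow_four]
  exact ((measurable_norm4.pow_const 4).ennreal_toReal.const_mul _).exp

theorem measurable_dens (N lam : ℝ) : Measurable (dens N lam) :=
  (measurable_exp_quartic lam).indicator (isClosed_ball N).measurableSet

theorem dens_nonneg (N lam : ℝ) (u : Field2) : 0 ≤ dens N lam u :=
  Set.indicator_nonneg (fun _ _ => (Real.exp_pos _).le) _

theorem dens_sq (N lam : ℝ) (u : Field2) : dens N lam u ^ 2 = dens N (2 * lam) u := by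
  by_cases h : u ∈ ball N
  · rw [dens, dens, Set.indicator_of_mem h, Set.indicator_of_mem h, ← Real.exp_nat_mul]
    congr 1; push_cast; ring
  · rw [dens, dens, Set.indicator_of_notMem h, Set.indicator_of_notMem h]; simp

/-- A form of Jensen's inequality. -/
theorem exp_integral_pow_four_le {f : Circ → ℂ} (hf : Continuous f) {N a : ℝ} (hN : 0 < N)
    (hfN : ∫ θ, ‖f θ‖ ^ 2 ∂circMeasure ≤ N) :
    Real.exp (a * ∫ θ, ‖f θ‖ ^ 4 ∂circMeasure) ≤
      1 + ∫ θ, 1 / N * (‖f θ‖ ^ 2 * Real.exp (a * N * ‖f θ‖ ^ 2)) ∂circMeasure := by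
  have int : ∀ g : Circ → ℝ, Continuous g → Integrable g circMeasure := fun g hg =>
    hg.integrable_of_hasCompactSupport (HasCompactSupport.of_compactSpace _)
  set X := a * ∫ θ, ‖f θ‖ ^ 4 ∂circMeasure
  set p := 1 / N * ∫ θ, ‖f θ‖ ^ 2 ∂circMeasure
  have hp : p ≤ 1 := by
    simp only [p]; rw [one_div, inv_mul_le_iff₀ hN]; linarith
  have h1 : Real.exp X * ((1 - X) * p + X) ≤
      ∫ θ, 1 / N * (‖f θ‖ ^ 2 * Real.exp (a * N * ‖f θ‖ ^ 2)) ∂circMeasure := by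
    have e : ∫ θ, (Real.exp X * (1 - X) * (1 / N) * ‖f θ‖ ^ 2 + Real.exp X * a * ‖f θ‖ ^ 4)
        ∂circMeasure = Real.exp X * ((1 - X) * p + X) := by
      rw [integral_add (int _ (by fun_prop)) (int _ (by fun_prop)), integral_const_mul,
        integral_const_mul]
      simp only [p, X]
      ring
    rw [← e]
    refine integral_mono (int _ (by fun_prop)) (int _ (by fun_prop)) fun θ => ?_
    have h2 := Real.add_one_le_exp (a * N * ‖f θ‖ ^ 2 - X)
    rw [Real.exp_sub, le_div_iff₀ (Real.exp_pos _)] at h2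
    calc _ = 1 / N * (‖f θ‖ ^ 2 * ((a * N * ‖f θ‖ ^ 2 - X + 1) * Real.exp X)) := by
          field_simp; ring
      _ ≤ _ := by gcongr
  have h3 : Real.exp X * (1 - X) ≤ 1 := by
    have := Real.add_one_le_exp (-X)
    rw [Real.exp_neg] at this
    calc Real.exp X * (1 - X) ≤ Real.exp X * (Real.exp X)⁻¹ := by gcongr; linarith
      _ = 1 := mul_inv_cancel₀ (Real.exp_pos _).ne'
  have hp0 : 0 ≤ p := by
    have : 0 ≤ ∫ θ, ‖f θ‖ ^ 2 ∂circMeasure := integral_nonneg fun θ => by positivity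
    simp only [p]; positivity
  nlinarith [Real.exp_pos X]

/-- A uniform bound for the partition functions. -/
def partitionBound (N lam : ℝ) : ℝ≥0∞ :=
  1 + ENNReal.ofReal (1 / N * (1 / (lam / 4 * N))) *
    (2 * expMoment (2 * (2 * (lam / 4 * N)) * (Real.pi ^ 2 / 3)))

theorem partitionBound_ne_top {N lam : ℝ} (h : N * lam < 3 / (7 * Real.pi ^ 2)) :
    partitionBound N lam ≠ ∞ := by
  have : expMoment (2 * (2 * (lam / 4 * N)) * (Real.pi ^ 2 / 3)) ≠ ∞ := by
    refine expMoment_ne_top ?_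
    rw [lt_div_iff₀ (by positivity)] at h
    nlinarith
  simp only [partitionBound]
  finiteness

theorem lintegral_dens_modeSum_le {N lam : ℝ} (hN : 0 < N) (hlam : 0 < lam) (J : Finset Freq) :
    ∫⁻ ω, ENNReal.ofReal (dens N lam (modeSum J ω)) ∂gaussianLaw ≤ partitionBound N lam := by
  set b := lam / 4 * N
  have hb : 0 < b := by positivity
  have int : ∀ g : Circ → ℝ, Continuous g → Integrable g circMeasure := fun g hg =>
    hg.integrable_of_hasCompactSupport (HasCompactSupport.of_compactSpace _)
  have h1 : ∀ ω, ENNReal.ofReal (dens N lam (modeSum J ω)) ≤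
      1 + ENNReal.ofReal (1 / N * (1 / b)) *
        ∫⁻ θ, ENNReal.ofReal (Real.exp (2 * b * ‖trigPoly J ω θ‖ ^ 2)) ∂circMeasure := by
    intro ω
    by_cases h : modeSum J ω ∈ ball N
    swap
    · rw [dens, Set.indicator_of_notMem h]; simp
    have hc := continuous_trigPoly_right J ω
    have h2 : ∫ θ, ‖trigPoly J ω θ‖ ^ 2 ∂circMeasure ≤ N := by
      refine le_trans (le_of_eq (integral_congr_ae ?_)) h
      filter_upwards [coeFn_modeSum J ω] with θ hθ
      rw [hθ]
    have h4 : ∫ θ, ‖modeSum J ω θ‖ ^ 4 ∂circMeasure = ∫ θ, ‖trigPoly J ω θ‖ ^ 4 ∂circMeasure := by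
      refine integral_congr_ae ?_
      filter_upwards [coeFn_modeSum J ω] with θ hθ
      rw [hθ]
    have h3 := exp_integral_pow_four_le (a := lam / 4) hc hN h2
    have h5 : ∫ θ, 1 / N * (‖trigPoly J ω θ‖ ^ 2 * Real.exp (lam / 4 * N * ‖trigPoly J ω θ‖ ^ 2))
        ∂circMeasure ≤
        ∫ θ, 1 / N * (1 / b) * Real.exp (2 * b * ‖trigPoly J ω θ‖ ^ 2) ∂circMeasure := by
      refine integral_mono (int _ (by fun_prop)) (int _ (by fun_prop)) fun θ => ?_
      set x := ‖trigPoly J ω θ‖ ^ 2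
      have hx : x ≤ 1 / b * Real.exp (b * x) := by
        rw [one_div, ← div_eq_inv_mul, le_div_iff₀ hb]
        linarith [Real.add_one_le_exp (b * x)]
      have e : Real.exp (2 * b * x) = Real.exp (b * x) * Real.exp (b * x) := by
        rw [← Real.exp_add]; congr 1; ring
      change 1 / N * (x * Real.exp (b * x)) ≤ _
      rw [e]
      calc 1 / N * (x * Real.exp (b * x)) ≤ 1 / N * (1 / b * Real.exp (b * x) * Real.exp (b * x)) := by
            gcongr
        _ = _ := by ring
    rw [dens, Set.indicator_of_mem h, h4]
    refine (ENNReal.ofReal_le_ofReal (h3.trans (add_le_add_right h5 1))).trans ?_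
    rw [ENNReal.ofReal_add zero_le_one (integral_nonneg fun θ => by positivity),
      ENNReal.ofReal_one, integral_const_mul, ENNReal.ofReal_mul (by positivity),
      ofReal_integral_eq_lintegral_ofReal (int _ (by fun_prop))
        (ae_of_all _ fun θ => (Real.exp_pos _).le)]
  have hmeas : Measurable fun p : Sample × Circ =>
      ENNReal.ofReal (Real.exp (2 * b * ‖trigPoly J p.1 p.2‖ ^ 2)) := by
    have := (Real.continuous_exp.comp (((continuous_trigPoly J).norm.pow 2).const_mul (2 * b)))
    exact (ENNReal.continuous_ofReal.comp this).measurable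
  refine (lintegral_mono h1).trans ?_
  rw [lintegral_add_left measurable_const, lintegral_const_mul _ hmeas.lintegral_prod_right',
    lintegral_lintegral_swap hmeas.aemeasurable]
  simp only [lintegral_const, measure_univ, mul_one]
  rw [partitionBound]
  gcongr
  calc _ ≤ ∫⁻ _ : Circ, 2 * expMoment (2 * (2 * b) * (Real.pi ^ 2 / 3)) ∂circMeasure :=
        lintegral_mono fun θ => lintegral_exp_norm_trigPoly_sq_le J θ (by positivity)
    _ = _ := by simp [b]

theorem Regular.tendsto_dens {ω : Sample} (h : Regular ω) (N lam : ℝ) :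
    Tendsto (fun n => dens N lam (modeSum (freqs n) ω)) atTop (𝓝 (dens N lam (loopSeries ω))) := by
  have hmono : ∀ n, ‖modeSum (freqs n) ω‖ ^ 2 ≤ ‖loopSeries ω‖ ^ 2 := fun n => by
    rw [norm_modeSum_sq]
    exact sum_le_hasSum _ (fun j _ => by positivity) (hasSum_norm_loopSeries_sq h.sqSummable)
  by_cases hb : loopSeries ω ∈ ball N
  · have hn : ∀ n, modeSum (freqs n) ω ∈ ball N := fun n =>
      mem_ball_iff.2 ((hmono n).trans (mem_ball_iff.1 hb))
    simp only [dens, Set.indicator_of_mem hb, Set.indicator_of_mem (hn _), integral_pow_four]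
    have h1 := tendsto_norm4 h.norm4_ne_top h.tail
    have h2 := ((ENNReal.continuous_pow 4).tendsto _).comp h1
    have h3 := (ENNReal.tendsto_toReal (ENNReal.pow_ne_top h.norm4_ne_top)).comp h2
    exact (Real.continuous_exp.tendsto _).comp (h3.const_mul (lam / 4))
  · have h1 : ∀ᶠ n in atTop, modeSum (freqs n) ω ∉ ball N :=
      (tendsto_modeSum h.sqSummable).eventually ((isClosed_ball N).isOpen_compl.mem_nhds hb)
    simp only [dens, Set.indicator_of_notMem hb]
    refine tendsto_const_nhds.congr' ?_
    filter_upwards [h1] with n hn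
    rw [Set.indicator_of_notMem hn]

theorem lintegral_dens_loopSeries_le {N lam : ℝ} (hN : 0 < N) (hlam : 0 < lam) :
    ∫⁻ ω, ENNReal.ofReal (dens N lam (loopSeries ω)) ∂gaussianLaw ≤ partitionBound N lam := by
  have h1 : ∀ᵐ ω ∂gaussianLaw, ENNReal.ofReal (dens N lam (loopSeries ω)) ≤
      liminf (fun n => ENNReal.ofReal (dens N lam (modeSum (freqs n) ω))) atTop := by
    filter_upwards [ae_regular] with ω hω
    exact ((ENNReal.continuous_ofReal.tendsto _).comp (hω.tendsto_dens N lam)).liminf_eq.ge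
  refine (lintegral_mono_ae h1).trans ((lintegral_liminf_le fun n => ?_).trans ?_)
  · exact ((measurable_dens N lam).comp (continuous_modeSum _).measurable).ennreal_ofReal
  · refine liminf_le_of_le (by isBoundedDefault) fun b hb => ?_
    obtain ⟨n, hn⟩ := hb.exists
    exact hn.trans (lintegral_dens_modeSum_le hN hlam _)

/-! ### Splitting off finitely many modes -/

/-- Replace the variables in `J` by independent copies. -/
def merge (J : Finset Freq) (ω' ω : Sample) : Sample := fun j => if j ∈ J then ω' j else ω j

theorem measurable_merge (J : Finset Freq) :
    Measurable fun p : Sample × Sample => merge J p.1 p.2 := by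
  refine measurable_pi_lambda _ fun j => ?_
  by_cases h : j ∈ J
  · simp only [merge, h, if_true]; fun_prop
  · simp only [merge, h, if_false]; fun_prop

theorem measurePreserving_merge (J : Finset Freq) :
    MeasurePreserving (fun p : Sample × Sample => merge J p.1 p.2)
      (gaussianLaw.prod gaussianLaw) gaussianLaw := by
  refine ⟨measurable_merge J, ?_⟩
  refine Measure.eq_infinitePi _ fun s t ht => ?_
  rw [Measure.map_apply (measurable_merge J)
    (MeasurableSet.pi s.countable_toSet fun i _ => ht i)]
  have e : (fun p : Sample × Sample => merge J p.1 p.2) ⁻¹' ((s : Set Freq).pi t) =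
      (((s ∩ J : Finset Freq) : Set Freq).pi t) ×ˢ (((s \ J : Finset Freq) : Set Freq).pi t) := by
    ext ⟨ω', ω⟩
    simp only [Set.mem_preimage, Set.mem_pi, Finset.mem_coe, Set.mem_prod, Finset.mem_inter,
      Finset.mem_sdiff, merge]
    constructor
    · intro h
      exact ⟨fun i hi => by simpa [hi.2] using h i hi.1, fun i hi => by simpa [hi.2] using h i hi.1⟩
    · rintro ⟨h1, h2⟩ i hi
      by_cases hJ : i ∈ J
      · simpa [hJ] using h1 i ⟨hi, hJ⟩
      · simpa [hJ] using h2 i ⟨hi, hJ⟩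
  rw [e, Measure.prod_prod, gaussianLaw, Measure.infinitePi_pi _ fun i _ => ht i,
    Measure.infinitePi_pi _ fun i _ => ht i, Finset.prod_inter_mul_prod_sdiff]

/-- The `σ`-algebras of the variables with frequencies at most `n`. -/
def freqFiltration : Filtration ℕ (inferInstance : MeasurableSpace Sample) where
  seq n := Filtration.piFinset (X := fun _ : Freq => ℝ × ℝ) (freqs n)
  mono' _ _ h := Filtration.piFinset.mono (freqs_mono h)
  le' n := Filtration.piFinset.le (freqs n)

theorem iSup_freqFiltration :
    ⨆ n, freqFiltration n = (inferInstance : MeasurableSpace Sample) := by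
  refine le_antisymm (iSup_le fun n => freqFiltration.le n) ?_
  refine iSup_le fun j => ?_
  refine le_trans ?_ (le_iSup _ ((j : ℤ).natAbs))
  have hj : j ∈ freqs (j : ℤ).natAbs := mem_freqs.2 (by simp)
  have : (fun ω : Sample => ω j) = (fun x : (freqs (j : ℤ).natAbs) → ℝ × ℝ => x ⟨j, hj⟩) ∘
      (freqs (j : ℤ).natAbs).restrict := rfl
  change MeasurableSpace.comap (fun ω : Sample => ω j) _ ≤
    MeasurableSpace.comap ((freqs (j : ℤ).natAbs).restrict) _
  rw [this, ← MeasurableSpace.comap_comp]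
  exact MeasurableSpace.comap_mono (measurable_pi_apply _).comap_le

/-- Averages over many modes are almost constant. -/
theorem tendsto_integral_merge {h : Sample → ℝ} (hh : Integrable h gaussianLaw) :
    Tendsto (fun n => ∫ ω, |(∫ ω', h (merge (freqs n) ω' ω) ∂gaussianLaw) -
      ∫ ω', h ω' ∂gaussianLaw| ∂gaussianLaw) atTop (𝓝 0) := by
  set hk : ℕ → Sample → ℝ := fun k => gaussianLaw[h | freqFiltration k]
  have hki : ∀ k, Integrable (hk k) gaussianLaw := fun k => integrable_condExp
  have hlim : Tendsto (fun k => ∫ ω, |hk k ω - h ω| ∂gaussianLaw) atTop (𝓝 0) := by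
    have h1 := tendsto_eLpNorm_condExp (μ := gaussianLaw) (ℱ := freqFiltration) h
    rw [iSup_freqFiltration] at h1
    have h2 : gaussianLaw[h | (inferInstance : MeasurableSpace Sample)] =ᵐ[gaussianLaw] h :=
      condExp_of_aestronglyMeasurable' le_rfl hh.1 hh
    have h3 := (ENNReal.tendsto_toReal ENNReal.zero_ne_top).comp h1
    rw [ENNReal.toReal_zero] at h3
    refine h3.congr fun k => ?_
    simp only [Function.comp]
    rw [eLpNorm_congr_ae (ae_eq_rfl.sub h2), eLpNorm_one_eq_lintegral_enorm,
      integral_eq_lintegral_of_nonneg_ae (f := fun ω => |hk k ω - h ω|)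
        (ae_of_all _ fun ω => abs_nonneg _) ((hki k).sub hh).1.norm]
    congr 1
    refine lintegral_congr fun ω => ?_
    rw [← ofReal_norm]; rfl
  have key : ∀ k, ∀ n ≥ k, ∫ ω, |(∫ ω', h (merge (freqs n) ω' ω) ∂gaussianLaw) -
      ∫ ω', h ω' ∂gaussianLaw| ∂gaussianLaw ≤ 2 * ∫ ω, |hk k ω - h ω| ∂gaussianLaw := by
    intro k n hn
    have mp := measurePreserving_merge (freqs n)
    have i1 : Integrable (fun p : Sample × Sample => h (merge (freqs n) p.1 p.2))
        (gaussianLaw.prod gaussianLaw) := mp.integrable_comp_of_integrable hh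
    have i2 : Integrable (fun p : Sample × Sample => |hk k (merge (freqs n) p.1 p.2) -
        h (merge (freqs n) p.1 p.2)|) (gaussianLaw.prod gaussianLaw) :=
      mp.integrable_comp_of_integrable (g := fun ω => |hk k ω - h ω|) ((hki k).sub hh).abs
    have hdep : ∀ ω' ω, hk k (merge (freqs n) ω' ω) = hk k ω' := by
      intro ω' ω
      have hd : DependsOn (hk k) (freqs k : Set Freq) :=
        StronglyMeasurable.dependsOn_of_piFinset
          (stronglyMeasurable_condExp (m := freqFiltration k) (μ := gaussianLaw) (f := h))
      refine hd fun j hj => ?_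
      simp only [merge, if_pos (freqs_mono hn (Finset.mem_coe.1 hj))]
    have e : ∫ ω, ∫ ω', |hk k (merge (freqs n) ω' ω) - h (merge (freqs n) ω' ω)| ∂gaussianLaw
        ∂gaussianLaw = ∫ ω, |hk k ω - h ω| ∂gaussianLaw := by
      rw [← integral_prod_symm _ i2]
      have h1 := integral_map (f := fun ω => |hk k ω - h ω|) mp.measurable.aemeasurable
        (by rw [mp.map_eq]; exact ((hki k).sub hh).abs.1)
      rw [mp.map_eq] at h1
      exact h1.symm
    have hc : |(∫ ω', hk k ω' ∂gaussianLaw) - ∫ ω', h ω' ∂gaussianLaw| ≤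
        ∫ ω, |hk k ω - h ω| ∂gaussianLaw := by
      rw [← integral_sub (hki k) hh]
      exact abs_integral_le_integral_abs
    calc _ ≤ ∫ ω, ((∫ ω', |hk k (merge (freqs n) ω' ω) - h (merge (freqs n) ω' ω)| ∂gaussianLaw) +
          ∫ ω, |hk k ω - h ω| ∂gaussianLaw) ∂gaussianLaw := by
          refine integral_mono_ae (i1.integral_prod_right.sub (integrable_const _)).abs
            (i2.integral_prod_right.add (integrable_const _)) ?_
          filter_upwards [i1.prod_left_ae, i2.prod_left_ae] with ω h1 h2
          have h3 : (∫ ω', h (merge (freqs n) ω' ω) ∂gaussianLaw) - ∫ ω', h ω' ∂gaussianLaw =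
              -(∫ ω', (hk k (merge (freqs n) ω' ω) - h (merge (freqs n) ω' ω)) ∂gaussianLaw) +
              ((∫ ω', hk k ω' ∂gaussianLaw) - ∫ ω', h ω' ∂gaussianLaw) := by
            simp only [hdep]
            rw [integral_sub (hki k) h1]
            ring
          rw [h3]
          refine (abs_add_le _ _).trans (add_le_add ?_ hc)
          rw [abs_neg]
          exact abs_integral_le_integral_abs
      _ = _ := by
          rw [integral_add i2.integral_prod_right (integrable_const _), e]
          simp; ring
  rw [Metric.tendsto_atTop]
  intro ε hε
  obtain ⟨k, hk'⟩ := (hlim.eventually (Iio_mem_nhds (by positivity : (0 : ℝ) < ε / 2))).exists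
  refine ⟨k, fun n hn => ?_⟩
  rw [Real.dist_0_eq_abs, abs_of_nonneg (integral_nonneg fun ω => abs_nonneg _)]
  have := key k n hn
  have h4 : ∫ ω, |hk k ω - h ω| ∂gaussianLaw < ε / 2 := hk'
  linarith

/-! ### Slices -/

/-- Replace the variables in `J` by the given values. -/
def extend (J : Finset Freq) (x : J → ℝ × ℝ) (ω : Sample) : Sample :=
  fun j => if h : j ∈ J then x ⟨j, h⟩ else ω j

theorem extend_restrict (J : Finset Freq) (ω' ω : Sample) :
    extend J (J.restrict ω') ω = merge J ω' ω := by
  ext1 j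
  by_cases h : j ∈ J <;> simp [extend, merge, h]

theorem measurable_extend (J : Finset Freq) :
    Measurable fun p : (J → ℝ × ℝ) × Sample => extend J p.1 p.2 := by
  refine measurable_pi_lambda _ fun j => ?_
  by_cases h : j ∈ J
  · simp only [extend, h, dite_true]; fun_prop
  · simp only [extend, h, dite_false]; fun_prop

theorem measurable_extend_left (J : Finset Freq) (ω : Sample) :
    Measurable fun x => extend J x ω :=
  (measurable_extend J).comp (measurable_id.prodMk measurable_const)

/-- Half the sum of the squares of the variables. -/
def halfSq (J : Finset Freq) (x : J → ℝ × ℝ) : ℝ := ∑ j, ((x j).1 ^ 2 + (x j).2 ^ 2) / 2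

/-- The standard Gaussian measure in the variables in `J`. -/
theorem map_restrict_gaussianLaw (J : Finset Freq) :
    gaussianLaw.map J.restrict = (volume : Measure (J → ℝ × ℝ)).withDensity
      fun x => ENNReal.ofReal (Real.exp (-(halfSq J x + J.card * Real.log (2 * Real.pi)))) := by
  rw [gaussianLaw, Measure.infinitePi_map_restrict]
  set pdf : ℝ × ℝ → ℝ := fun p => gaussianPDFReal 0 1 p.1 * gaussianPDFReal 0 1 p.2
  have hint : Integrable pdf :=
    (integrable_gaussianPDFReal 0 1).mul_prod (integrable_gaussianPDFReal 0 1)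
  have hpos : ∀ p, 0 ≤ pdf p := fun p =>
    mul_nonneg (gaussianPDFReal_nonneg _ _ _) (gaussianPDFReal_nonneg _ _ _)
  have hone : (gaussianReal 0 1).prod (gaussianReal 0 1) =
      (volume : Measure (ℝ × ℝ)).withDensity fun p => ENNReal.ofReal (pdf p) := by
    rw [gaussianReal_of_var_ne_zero _ one_ne_zero,
      prod_withDensity (measurable_gaussianPDF _ _) (measurable_gaussianPDF _ _)]
    congr 1
    ext p
    simp only [gaussianPDF, pdf]
    rw [ENNReal.ofReal_mul (gaussianPDFReal_nonneg _ _ _)]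
  have hprod : ∀ x : J → ℝ × ℝ,
      Real.exp (-(halfSq J x + J.card * Real.log (2 * Real.pi))) = ∏ j, pdf (x j) := by
    intro x
    have h1 : ∀ p, pdf p = Real.exp (-((p.1 ^ 2 + p.2 ^ 2) / 2 + Real.log (2 * Real.pi))) := by
      intro p
      simp only [pdf, gaussianPDFReal]
      rw [neg_add, Real.exp_add, Real.exp_neg (Real.log _), Real.exp_log Real.two_pi_pos]
      have h2 : √(2 * Real.pi) * √(2 * Real.pi) = 2 * Real.pi :=
        Real.mul_self_sqrt Real.two_pi_pos.le
      have h3 : Real.exp (-((p.1 ^ 2 + p.2 ^ 2) / 2)) =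
          Real.exp (-p.1 ^ 2 / 2) * Real.exp (-p.2 ^ 2 / 2) := by
        rw [← Real.exp_add]; congr 1; ring
      rw [h3, ← h2, mul_inv]
      simp
      ring
    simp only [h1]
    rw [← Real.exp_sum]
    congr 1
    simp [halfSq, Finset.sum_add_distrib]
  simp only [hprod]
  refine Measure.pi_eq fun s hs => ?_
  have hbox : MeasurableSet (Set.univ.pi s) := MeasurableSet.univ_pi hs
  rw [withDensity_apply _ hbox, ← lintegral_indicator hbox]
  have e1 : ∀ x : J → ℝ × ℝ, (Set.univ.pi s).indicator
      (fun x => ENNReal.ofReal (∏ j, pdf (x j))) x =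
        ENNReal.ofReal (∏ j, (s j).indicator pdf (x j)) := by
    intro x
    by_cases hx : x ∈ Set.univ.pi s
    · rw [Set.indicator_of_mem hx]
      congr 1
      refine Finset.prod_congr rfl fun j _ => ?_
      rw [Set.indicator_of_mem (hx j (Set.mem_univ j))]
    · rw [Set.indicator_of_notMem hx]
      obtain ⟨j, hj⟩ : ∃ j, x j ∉ s j := by simpa using hx
      rw [Finset.prod_eq_zero (Finset.mem_univ j) (Set.indicator_of_notMem hj _)]
      simp
  have hi : ∀ j : J, Integrable ((s j).indicator pdf) := fun j => hint.indicator (hs j)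
  have hnn : ∀ (j : J) p, 0 ≤ (s j).indicator pdf p := fun j p =>
    Set.indicator_nonneg (fun _ _ => hpos _) _
  simp only [e1]
  rw [volume_pi, ← ofReal_integral_eq_lintegral_ofReal (Integrable.fintype_prod hi)
    (ae_of_all _ fun x => Finset.prod_nonneg fun j _ => hnn j _),
    integral_fintype_prod_eq_prod, ENNReal.ofReal_prod_of_nonneg
      fun j _ => integral_nonneg (hnn j)]
  refine Finset.prod_congr rfl fun j _ => ?_
  rw [hone, withDensity_apply _ (hs j), integral_indicator (hs j),
    ofReal_integral_eq_lintegral_ofReal hint.integrableOn (ae_of_all _ hpos)]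

theorem measurable_halfSq (J : Finset Freq) : Measurable (halfSq J) := by
  unfold halfSq; fun_prop

theorem integral_merge_eq (J : Finset Freq) (ω : Sample) (h : Sample → ℝ)
    (hh : Measurable h) :
    ∫ ω', h (merge J ω' ω) ∂gaussianLaw = ∫ x : J → ℝ × ℝ, h (extend J x ω) *
      Real.exp (-(halfSq J x + J.card * Real.log (2 * Real.pi))) := by
  have hm : Measurable fun x => h (extend J x ω) :=
    hh.comp (measurable_extend_left J ω)
  have hJ : Measurable (J.restrict : Sample → _) := by fun_prop
  simp only [← extend_restrict]
  rw [← integral_map (f := fun x => h (extend J x ω)) hJ.aemeasurable hm.aestronglyMeasurable,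
    map_restrict_gaussianLaw, integral_withDensity_eq_integral_toReal_smul]
  · refine integral_congr_ae (ae_of_all _ fun x => ?_)
    simp only [smul_eq_mul]
    rw [ENNReal.toReal_ofReal (Real.exp_pos _).le, mul_comm]
  · have := measurable_halfSq J
    fun_prop
  · exact ae_of_all _ fun x => ENNReal.ofReal_lt_top

theorem integrable_merge_iff (J : Finset Freq) (ω : Sample) (h : Sample → ℝ)
    (hh : Measurable h) :
    Integrable (fun ω' => h (merge J ω' ω)) gaussianLaw ↔
      Integrable fun x : J → ℝ × ℝ => h (extend J x ω) *
      Real.exp (-(halfSq J x + J.card * Real.log (2 * Real.pi))) := by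
  have hm : Measurable fun x => h (extend J x ω) :=
    hh.comp (measurable_extend_left J ω)
  have hJ : Measurable (J.restrict : Sample → _) := by fun_prop
  simp only [← extend_restrict]
  have h1 := integrable_map_measure (μ := gaussianLaw) (f := (J.restrict : Sample → _))
    (g := fun x => h (extend J x ω)) hm.aestronglyMeasurable hJ.aemeasurable
  have h2 : ((fun x => h (extend J x ω)) ∘ (J.restrict : Sample → _)) =
    fun ω' : Sample => h (extend J (J.restrict ω') ω) := rfl
  rw [← h2, ← h1, map_restrict_gaussianLaw, integrable_withDensity_iff]
  · refine integrable_congr (ae_of_all _ fun x => ?_)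
    simp only
    rw [ENNReal.toReal_ofReal (Real.exp_pos _).le]
  · have := measurable_halfSq J
    fun_prop
  · exact ae_of_all _ fun x => ENNReal.ofReal_lt_top

/-! ### The potential on a slice -/

theorem coef_add (ω ω' : Sample) (j : Freq) : coef (ω + ω') j = coef ω j + coef ω' j := by
  simp only [coef, Pi.add_apply, Prod.fst_add, Prod.snd_add]
  push_cast; ring

theorem coef_smul (r : ℝ) (ω : Sample) (j : Freq) : coef (r • ω) j = r • coef ω j := by
  simp only [coef, Pi.smul_apply, Prod.smul_fst, Prod.smul_snd, smul_eq_mul, Complex.real_smul]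
  push_cast; ring

theorem modeSum_add (J : Finset Freq) (ω ω' : Sample) :
    modeSum J (ω + ω') = modeSum J ω + modeSum J ω' := by
  simp only [modeSum, coef_add, add_smul, Finset.sum_add_distrib]

theorem modeSum_smul (J : Finset Freq) (r : ℝ) (ω : Sample) :
    modeSum J (r • ω) = r • modeSum J ω := by
  simp only [modeSum, coef_smul, smul_assoc, Finset.smul_sum]

theorem coef_extend_of_mem {J : Finset Freq} {j : Freq} (hj : j ∈ J) (x : J → ℝ × ℝ) (ω : Sample) :
    coef (extend J x ω) j = coef (extend J x 0) j := by
  simp [coef, extend, hj]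

theorem coef_extend_of_notMem {J : Finset Freq} {j : Freq} (hj : j ∉ J) (x : J → ℝ × ℝ)
    (ω : Sample) : coef (extend J x ω) j = coef ω j := by
  simp [coef, extend, hj]

/-- The field with the given values of the variables in `J`, and no other modes. -/
def sliceMap (J : Finset Freq) : (J → ℝ × ℝ) →L[ℝ] Field2 :=
  LinearMap.toContinuousLinearMap
    { toFun := fun x => modeSum J (extend J x 0)
      map_add' := fun x y => by
        rw [← modeSum_add]
        congr 1
        ext1 j
        by_cases h : j ∈ J <;> simp [extend, h]
      map_smul' := fun r x => by
        rw [RingHom.id_apply, ← modeSum_smul]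
        congr 1
        ext1 j
        by_cases h : j ∈ J <;> simp [extend, h] }

theorem sliceMap_apply (J : Finset Freq) (x : J → ℝ × ℝ) :
    sliceMap J x = modeSum J (extend J x 0) := rfl

theorem sum_extend_sq (J : Finset Freq) (x : J → ℝ × ℝ) :
    ∑ j ∈ J, ((extend J x 0 j).1 ^ 2 + (extend J x 0 j).2 ^ 2) = 2 * halfSq J x := by
  rw [halfSq, Finset.mul_sum, ← Finset.sum_coe_sort]
  refine Finset.sum_congr rfl fun j _ => ?_
  simp only [extend, j.2, dite_true]
  ring

theorem one_le_sq_freq (j : Freq) : (1 : ℝ) ≤ ((j : ℤ) : ℝ) ^ 2 := by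
  have h : (1 : ℤ) ≤ (j : ℤ) ^ 2 := by
    have := pow_pos (abs_pos.2 j.2) 2
    rw [sq_abs] at this
    exact this
  exact_mod_cast h

theorem norm_sliceMap_sq_le (J : Finset Freq) (x : J → ℝ × ℝ) :
    ‖sliceMap J x‖ ^ 2 ≤ 2 * halfSq J x := by
  rw [sliceMap_apply, norm_modeSum_sq, ← sum_extend_sq]
  refine Finset.sum_le_sum fun j _ => ?_
  rw [norm_coef_sq]
  exact div_le_self (by positivity) (one_le_sq_freq j)

theorem halfSq_nonneg (J : Finset Freq) (x : J → ℝ × ℝ) : 0 ≤ halfSq J x :=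
  Finset.sum_nonneg fun j _ => by positivity

theorem sliceMap_injective (J : Finset Freq) : Function.Injective (sliceMap J) := by
  refine (injective_iff_map_eq_zero _).2 fun x hx => ?_
  have h : ∑ j ∈ J, ‖coef (extend J x 0) j‖ ^ 2 = 0 := by
    rw [← norm_modeSum_sq, ← sliceMap_apply, hx]; simp
  rw [Finset.sum_eq_zero_iff_of_nonneg fun j _ => by positivity] at h
  ext1 j
  have hj := h j j.2
  rw [norm_coef_sq, div_eq_zero_iff] at hj
  have h2 : (((j : Freq) : ℤ) : ℝ) ^ 2 ≠ 0 := (zero_lt_one.trans_le (one_le_sq_freq j)).ne'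
  have h3 := hj.resolve_right h2
  simp only [extend, j.2, dite_true] at h3
  have h4 : (x j).1 = 0 := by nlinarith [sq_nonneg (x j).1, sq_nonneg (x j).2]
  have h5 : (x j).2 = 0 := by nlinarith [sq_nonneg (x j).1, sq_nonneg (x j).2]
  exact Prod.ext h4 h5

theorem norm_trigPoly_sq_le (J : Finset Freq) (ω : Sample) (θ : Circ) :
    ‖trigPoly J ω θ‖ ^ 2 ≤ Real.pi ^ 2 / 3 * ∑ j ∈ J, ((ω j).1 ^ 2 + (ω j).2 ^ 2) := by
  have h1 : ‖trigPoly J ω θ‖ ≤ ∑ j ∈ J, 1 / |((j : ℤ) : ℝ)| * √((ω j).1 ^ 2 + (ω j).2 ^ 2) := by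
    refine (norm_sum_le _ _).trans (Finset.sum_le_sum fun j _ => le_of_eq ?_)
    rw [norm_mul, norm_fourier_eq_one, mul_one, ← Real.sqrt_sq (norm_nonneg (coef ω j)),
      norm_coef_sq, Real.sqrt_div (by positivity), Real.sqrt_sq_eq_abs]
    ring
  calc ‖trigPoly J ω θ‖ ^ 2
      ≤ (∑ j ∈ J, 1 / |((j : ℤ) : ℝ)| * √((ω j).1 ^ 2 + (ω j).2 ^ 2)) ^ 2 := by gcongr
    _ ≤ (∑ j ∈ J, (1 / |((j : ℤ) : ℝ)|) ^ 2) * ∑ j ∈ J, √((ω j).1 ^ 2 + (ω j).2 ^ 2) ^ 2 :=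
        Finset.sum_mul_sq_le_sq_mul_sq _ _ _
    _ = (∑ j ∈ J, 1 / ((j : ℤ) : ℝ) ^ 2) * ∑ j ∈ J, ((ω j).1 ^ 2 + (ω j).2 ^ 2) := by
        congr 1
        · refine Finset.sum_congr rfl fun j _ => ?_
          rw [div_pow, one_pow, sq_abs]
        · refine Finset.sum_congr rfl fun j _ => Real.sq_sqrt (by positivity)
    _ ≤ _ := by
        gcongr
        exact sum_inv_sq_le J

/-- The square of the supremum norm is bounded by the energy. -/
theorem ae_norm_sliceMap_sq_le (J : Finset Freq) (x : J → ℝ × ℝ) :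
    ∀ᵐ θ ∂circMeasure, ‖sliceMap J x θ‖ ^ 2 ≤ Real.pi ^ 2 / 3 * (2 * halfSq J x) := by
  filter_upwards [coeFn_modeSum J (extend J x 0)] with θ hθ
  rw [sliceMap_apply, hθ, ← sum_extend_sq]
  exact norm_trigPoly_sq_le J _ θ

/-- The modulus of convexity of `|·|⁴`. -/
theorem norm_pow_four_convexity (a b : ℂ) {t s : ℝ} (ht : 0 < t) (hs : 0 < s) (hts : t + s = 1) :
    t * ‖a‖ ^ 4 + s * ‖b‖ ^ 4 ≤ ‖t • a + s • b‖ ^ 4 +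
      t * s * (‖a - b‖ ^ 2 * (2 * ‖a‖ ^ 2 + 2 * ‖b‖ ^ 2 + 2 * (t * ‖a‖ ^ 2 + s * ‖b‖ ^ 2))) := by
  have hM : ‖t • a + s • b‖ ^ 2 = t * ‖a‖ ^ 2 + s * ‖b‖ ^ 2 - t * s * ‖a - b‖ ^ 2 := by
    have hs' : s = 1 - t := by linarith
    subst hs'
    simp only [Complex.sq_norm, Complex.normSq_apply]
    simp
    ring
  have h4 : ∀ r : ℝ, r ^ 4 = (r ^ 2) ^ 2 := fun r => by ring
  rw [h4 ‖t • a + s • b‖, hM, h4 ‖a‖, h4 ‖b‖]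
  set A := ‖a‖ ^ 2
  set B := ‖b‖ ^ 2
  set D := ‖a - b‖ ^ 2
  have hA : 0 ≤ A := by positivity
  have hB : 0 ≤ B := by positivity
  have hD : 0 ≤ D := by positivity
  have hAB : (A - B) ^ 2 ≤ D * (2 * A + 2 * B) := by
    have h1 : |‖a‖ - ‖b‖| ≤ ‖a - b‖ := abs_norm_sub_norm_le a b
    have h2 : (‖a‖ - ‖b‖) ^ 2 ≤ D := by
      rw [← sq_abs]; simp only [D]; gcongr
    calc (A - B) ^ 2 = (‖a‖ - ‖b‖) ^ 2 * (‖a‖ + ‖b‖) ^ 2 := by simp only [A, B]; ring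
      _ ≤ D * (2 * A + 2 * B) := by
        gcongr
        simp only [A, B]
        nlinarith [sq_nonneg (‖a‖ - ‖b‖)]
  have hs' : s = 1 - t := by linarith
  have key : t * A ^ 2 + s * B ^ 2 = (t * A + s * B - t * s * D) ^ 2 +
      (t * s * (A - B) ^ 2 + 2 * (t * s) * D * (t * A + s * B) - t ^ 2 * s ^ 2 * D ^ 2) := by
    subst hs'; ring
  rw [key]
  have hts0 : 0 < t * s := mul_pos ht hs
  have h6 := mul_le_mul_of_nonneg_left hAB hts0.le
  have h5 : 0 ≤ t ^ 2 * s ^ 2 * D ^ 2 := by positivity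
  nlinarith

theorem integrable_pow_four {u : Field2} (h : norm4 u ≠ ∞) :
    Integrable (fun θ => ‖u θ‖ ^ 4) circMeasure := by
  have hm : AEStronglyMeasurable (fun θ => ‖u θ‖ ^ 4) circMeasure := (Lp.memLp u).1.norm.pow 4
  refine ⟨hm, ?_⟩
  rw [hasFiniteIntegral_iff_ofReal (ae_of_all _ fun θ => by positivity), ← norm4_pow_four]
  exact lt_top_iff_ne_top.2 (ENNReal.pow_ne_top h)

theorem integrable_norm_sq (u : Field2) : Integrable (fun θ => ‖u θ‖ ^ 2) circMeasure :=
  (memLp_two_iff_integrable_sq_norm (Lp.memLp u).1).1 (Lp.memLp u)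

theorem integral_pow_four_convexity {N B t s : ℝ} {u v : Field2} (hu : u ∈ ball N) (hv : v ∈ ball N)
    (hu4 : norm4 u ≠ ∞) (hv4 : norm4 v ≠ ∞) (hz4 : norm4 (t • u + s • v) ≠ ∞)
    (hB : ∀ᵐ θ ∂circMeasure, ‖(u - v : Field2) θ‖ ^ 2 ≤ B) (hB0 : 0 ≤ B)
    (ht : 0 < t) (hs : 0 < s) (hts : t + s = 1) :
    t * (∫ θ, ‖u θ‖ ^ 4 ∂circMeasure) + s * (∫ θ, ‖v θ‖ ^ 4 ∂circMeasure) ≤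
      (∫ θ, ‖(t • u + s • v : Field2) θ‖ ^ 4 ∂circMeasure) + t * s * (B * (6 * N)) := by
  have iu := integrable_norm_sq u
  have iv := integrable_norm_sq v
  have iu4 := integrable_pow_four hu4
  have iv4 := integrable_pow_four hv4
  have iz4 := integrable_pow_four hz4
  have e1 : t * (∫ θ, ‖u θ‖ ^ 4 ∂circMeasure) + s * (∫ θ, ‖v θ‖ ^ 4 ∂circMeasure) =
      ∫ θ, (t * ‖u θ‖ ^ 4 + s * ‖v θ‖ ^ 4) ∂circMeasure := by
    rw [integral_add (iu4.const_mul _) (iv4.const_mul _), integral_const_mul, integral_const_mul]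
  have iw : Integrable (fun θ => t * s * B * (2 + 2 * t) * ‖u θ‖ ^ 2 +
      t * s * B * (2 + 2 * s) * ‖v θ‖ ^ 2) circMeasure :=
    (iu.const_mul _).add (iv.const_mul _)
  have e2 : ∫ θ, (t * s * B * (2 + 2 * t) * ‖u θ‖ ^ 2 +
      t * s * B * (2 + 2 * s) * ‖v θ‖ ^ 2) ∂circMeasure ≤ t * s * (B * (6 * N)) := by
    rw [integral_add (iu.const_mul _) (iv.const_mul _), integral_const_mul, integral_const_mul]
    have h1 : ∫ θ, ‖u θ‖ ^ 2 ∂circMeasure ≤ N := hu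
    have h2 : ∫ θ, ‖v θ‖ ^ 2 ∂circMeasure ≤ N := hv
    calc _ ≤ t * s * B * (2 + 2 * t) * N + t * s * B * (2 + 2 * s) * N := by gcongr
      _ = t * s * B * N * (4 + 2 * (t + s)) := by ring
      _ = _ := by rw [hts]; ring
  rw [e1]
  refine le_trans ?_ (add_le_add_right e2 _)
  rw [← integral_add iz4 iw]
  refine integral_mono_ae ((iu4.const_mul _).add (iv4.const_mul _)) (iz4.add iw) ?_
  filter_upwards [hB, Lp.coeFn_sub u v, Lp.coeFn_add (t • u) (s • v), Lp.coeFn_smul t u,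
    Lp.coeFn_smul s v] with θ h1 h2 h3 h4 h5
  rw [h3, Pi.add_apply, h4, h5, Pi.smul_apply, Pi.smul_apply]
  rw [h2, Pi.sub_apply] at h1
  refine (norm_pow_four_convexity (u θ) (v θ) ht hs hts).trans ?_
  have h6 : ‖u θ - v θ‖ ^ 2 * (2 * ‖u θ‖ ^ 2 + 2 * ‖v θ‖ ^ 2 + 2 * (t * ‖u θ‖ ^ 2 + s * ‖v θ‖ ^ 2))
      ≤ B * (2 * ‖u θ‖ ^ 2 + 2 * ‖v θ‖ ^ 2 + 2 * (t * ‖u θ‖ ^ 2 + s * ‖v θ‖ ^ 2)) := by gcongr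
  have h7 := mul_le_mul_of_nonneg_left h6 (mul_pos ht hs).le
  linarith

/-- The slice of the ball through the field `w`. -/
def slice (J : Finset Freq) (N : ℝ) (w : Field2) : Set (J → ℝ × ℝ) :=
  {x | sliceMap J x + w ∈ ball N}

/-- The negative logarithm of the density on the slice through `w`. -/
def slicePotential (J : Finset Freq) (lam : ℝ) (w : Field2) (x : J → ℝ × ℝ) : ℝ :=
  halfSq J x + J.card * Real.log (2 * Real.pi) -
    lam / 4 * ∫ θ, ‖(sliceMap J x + w : Field2) θ‖ ^ 4 ∂circMeasure

theorem convex_ball (N : ℝ) : Convex ℝ (ball N) := by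
  have : ball N = {u : Field2 | u ∈ Set.univ ∧ ‖u‖ ^ 2 ≤ N} := by
    ext u; simp [mem_ball_iff]
  rw [this]
  exact (convexOn_univ_norm.pow (fun _ _ => norm_nonneg _) 2).convex_le N

theorem convex_slice (J : Finset Freq) (N : ℝ) (w : Field2) : Convex ℝ (slice J N w) := by
  intro x hx y hy t s ht hs hts
  have h := convex_ball N hx hy ht hs hts
  have e : sliceMap J (t • x + s • y) + w = t • (sliceMap J x + w) + s • (sliceMap J y + w) := by
    rw [map_add, map_smul, map_smul]
    have : s = 1 - t := by linarith
    subst this; module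
  change sliceMap J (t • x + s • y) + w ∈ ball N
  rwa [e]

theorem isCompact_slice (J : Finset Freq) (N : ℝ) (w : Field2) : IsCompact (slice J N w) := by
  refine Metric.isCompact_of_isClosed_isBounded ?_ ?_
  · exact (isClosed_ball N).preimage (by fun_prop)
  · obtain ⟨C, hC, hLC⟩ := (sliceMap J : (J → ℝ × ℝ) →ₗ[ℝ] Field2).exists_antilipschitzWith
      (LinearMap.ker_eq_bot.2 (sliceMap_injective J))
    refine isBounded_iff_forall_norm_le.2 ⟨C * (√N + ‖w‖), fun x hx => ?_⟩
    have h1 := hLC.le_mul_dist x 0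
    simp only [dist_zero_right, map_zero, ContinuousLinearMap.coe_coe] at h1
    refine h1.trans ?_
    gcongr
    have h2 : ‖sliceMap J x + w‖ ≤ √N := Real.le_sqrt_of_sq_le (mem_ball_iff.1 hx)
    calc ‖sliceMap J x‖ = ‖(sliceMap J x + w) - w‖ := by rw [add_sub_cancel_right]
      _ ≤ ‖sliceMap J x + w‖ + ‖w‖ := norm_sub_le _ _
      _ ≤ _ := by gcongr

theorem continuous_halfSq (J : Finset Freq) : Continuous (halfSq J) := by
  unfold halfSq; fun_prop

theorem norm4_sliceMap_le (J : Finset Freq) (x : J → ℝ × ℝ) :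
    norm4 (sliceMap J x) ≤ ENNReal.ofReal (√(Real.pi ^ 2 / 3 * (2 * halfSq J x))) := by
  have h := eLpNorm_le_of_ae_bound (μ := circMeasure) (p := 4) (f := (sliceMap J x : Circ → ℂ))
    (C := √(Real.pi ^ 2 / 3 * (2 * halfSq J x))) (by
      filter_upwards [ae_norm_sliceMap_sq_le J x] with θ hθ
      exact Real.le_sqrt_of_sq_le hθ)
  simpa [norm4] using h

theorem norm4_sliceMap_add_ne_top (J : Finset Freq) {w : Field2} (hw : norm4 w ≠ ∞)
    (x : J → ℝ × ℝ) : norm4 (sliceMap J x + w) ≠ ∞ :=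
  ne_top_of_le_ne_top (ENNReal.add_ne_top.2
    ⟨ne_top_of_le_ne_top ENNReal.ofReal_ne_top (norm4_sliceMap_le J x), hw⟩) (norm4_add_le _ _)

theorem continuous_slicePotential (J : Finset Freq) (lam : ℝ) {w : Field2} (hw : norm4 w ≠ ∞) :
    Continuous (slicePotential J lam w) := by
  have h : Continuous fun x : J → ℝ × ℝ =>
      ∫ θ, ‖(sliceMap J x + w : Field2) θ‖ ^ 4 ∂circMeasure := by
    simp only [integral_pow_four]
    refine continuous_iff_seqContinuous.2 fun u x hu => ?_
    have h1 : Tendsto (fun n => norm4 ((sliceMap J x + w) - (sliceMap J (u n) + w))) atTop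
        (𝓝 0) := by
      have h2 : Tendsto (fun n => ENNReal.ofReal (√(Real.pi ^ 2 / 3 * (2 * halfSq J (x - u n)))))
          atTop (𝓝 0) := by
        have hc : Continuous fun y : J → ℝ × ℝ =>
            ENNReal.ofReal (√(Real.pi ^ 2 / 3 * (2 * halfSq J (x - y)))) := by
          have := continuous_halfSq J
          exact ENNReal.continuous_ofReal.comp (by fun_prop)
        have h3 := (hc.tendsto x).comp hu
        have e0 : ENNReal.ofReal (√(Real.pi ^ 2 / 3 * (2 * halfSq J (x - x)))) = 0 := by
          simp [halfSq]
        rw [← e0]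
        exact h3
      refine tendsto_of_tendsto_of_tendsto_of_le_of_le tendsto_const_nhds h2
        (fun n => zero_le) fun n => ?_
      have e : sliceMap J x + w - (sliceMap J (u n) + w) = sliceMap J (x - u n) := by
        rw [map_sub]; abel
      simp only [e]
      exact norm4_sliceMap_le J _
    have h4 := tendsto_norm4 (norm4_sliceMap_add_ne_top J hw x) h1
    have h5 := ((ENNReal.continuous_pow 4).tendsto _).comp h4
    exact (ENNReal.tendsto_toReal (ENNReal.pow_ne_top (norm4_sliceMap_add_ne_top J hw x))).comp h5
  unfold slicePotential
  exact ((continuous_halfSq J).add continuous_const).sub (continuous_const.mul h)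

theorem halfSq_convexity (J : Finset Freq) (x y : J → ℝ × ℝ) {t s : ℝ} (hts : t + s = 1) :
    t * halfSq J x + s * halfSq J y = halfSq J (t • x + s • y) + t * s * halfSq J (x - y) := by
  have hs' : s = 1 - t := by linarith
  subst hs'
  simp only [halfSq, Finset.mul_sum, ← Finset.sum_add_distrib]
  refine Finset.sum_congr rfl fun j _ => ?_
  simp only [Pi.add_apply, Pi.smul_apply, Pi.sub_apply, Prod.fst_add, Prod.smul_fst, Prod.snd_add,
    Prod.smul_snd, Prod.fst_sub, Prod.snd_sub, smul_eq_mul]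
  ring

/-- The potential is uniformly convex on every slice of the ball. -/
theorem uniformlyConvexPotential_slice (J : Finset Freq) {N lam c : ℝ}
    (hlam : 0 < lam) (hc : c ≤ 1 - Real.pi ^ 2 * N * lam) (hc0 : 0 ≤ c)
    {w : Field2} (hw : norm4 w ≠ ∞) :
    UniformlyConvexPotential (sliceMap J) (slice J N w) (slicePotential J lam w) c := by
  intro x hx y hy t s ht hs hts
  have e : sliceMap J (t • x + s • y) + w = t • (sliceMap J x + w) + s • (sliceMap J y + w) := by
    rw [map_add, map_smul, map_smul]
    have : s = 1 - t := by linarith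
    subst this; module
  have hd : (sliceMap J x + w) - (sliceMap J y + w) = sliceMap J (x - y) := by
    rw [map_sub]; abel
  have hq := halfSq_nonneg J (x - y)
  have h1 := integral_pow_four_convexity (B := Real.pi ^ 2 / 3 * (2 * halfSq J (x - y))) hx hy
    (norm4_sliceMap_add_ne_top J hw x)
    (norm4_sliceMap_add_ne_top J hw y) (by rw [← e]; exact norm4_sliceMap_add_ne_top J hw _)
    (by rw [hd]; exact ae_norm_sliceMap_sq_le J (x - y)) (by positivity) ht hs hts
  rw [← e] at h1
  have h2 := halfSq_convexity J x y hts
  have h3 := norm_sliceMap_sq_le J (x - y)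
  have hts0 : 0 < t * s := mul_pos ht hs
  simp only [slicePotential]
  set I₁ := ∫ θ, ‖(sliceMap J x + w : Field2) θ‖ ^ 4 ∂circMeasure
  set I₂ := ∫ θ, ‖(sliceMap J y + w : Field2) θ‖ ^ 4 ∂circMeasure
  set I₃ := ∫ θ, ‖(sliceMap J (t • x + s • y) + w : Field2) θ‖ ^ 4 ∂circMeasure
  set q := halfSq J (x - y)
  set κ := (J.card : ℝ) * Real.log (2 * Real.pi)
  have h4 : c / 2 * (t * s) * ‖sliceMap J (x - y)‖ ^ 2 ≤ t * s * q * (1 - Real.pi ^ 2 * N * lam) := by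
    calc c / 2 * (t * s) * ‖sliceMap J (x - y)‖ ^ 2 ≤ c / 2 * (t * s) * (2 * q) := by gcongr
      _ = t * s * q * c := by ring
      _ ≤ _ := by gcongr
  have h5 := mul_le_mul_of_nonneg_left h1 (by positivity : 0 ≤ lam / 4)
  have h6 : t * κ + s * κ = κ := by rw [← add_mul, hts, one_mul]
  nlinarith

theorem sqSummable_extend {ω : Sample} (h : SqSummable ω) (J : Finset Freq) (x : J → ℝ × ℝ) :
    SqSummable (extend J x ω) := by
  refine Summable.congr_cofinite h ?_
  have : (J : Set Freq)ᶜ ∈ cofinite := J.finite_toSet.compl_mem_cofinite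
  filter_upwards [this] with j hj
  rw [coef_extend_of_notMem (by simpa using hj)]

/-- The random series splits into its modes in `J` and the other modes. -/
theorem loopSeries_extend {ω : Sample} (h : SqSummable ω) (J : Finset Freq) (x : J → ℝ × ℝ) :
    loopSeries (extend J x ω) = sliceMap J x + (loopSeries ω - modeSum J ω) := by
  have h1 := tendsto_modeSum_finset (sqSummable_extend h J x)
  have h2 : Tendsto (fun A => sliceMap J x + (modeSum A ω - modeSum J ω)) atTop
      (𝓝 (sliceMap J x + (loopSeries ω - modeSum J ω))) :=
    ((tendsto_modeSum_finset h).sub_const _).const_add _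
  refine tendsto_nhds_unique h1 (h2.congr' ?_)
  filter_upwards [eventually_ge_atTop J] with A hA
  rw [modeSum, modeSum, modeSum, ← Finset.sum_sdiff hA, ← Finset.sum_sdiff hA,
    add_sub_cancel_right, add_comm, sliceMap_apply, modeSum]
  congr 1
  · refine Finset.sum_congr rfl fun j hj => ?_
    rw [coef_extend_of_notMem (Finset.mem_sdiff.1 hj).2]
  · refine Finset.sum_congr rfl fun j hj => ?_
    rw [coef_extend_of_mem hj x ω]

theorem Regular.norm4_tail_ne_top {ω : Sample} (h : Regular ω) (J : Finset Freq) :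
    norm4 (loopSeries ω - modeSum J ω) ≠ ∞ := by
  have h1 := norm4_add_le (loopSeries ω) ((-1 : ℝ) • modeSum J ω)
  rw [← modeSum_smul] at h1
  have h2 : loopSeries ω - modeSum J ω = loopSeries ω + modeSum J ((-1 : ℝ) • ω) := by
    rw [modeSum_smul, neg_one_smul, sub_eq_add_neg]
  rw [h2]
  exact ne_top_of_le_ne_top (ENNReal.add_ne_top.2 ⟨h.norm4_ne_top, norm4_modeSum_ne_top _ _⟩) h1

/-- The density on a slice. -/
theorem dens_mul_exp_eq (J : Finset Freq) (N lam : ℝ) (w : Field2) (x : J → ℝ × ℝ) :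
    dens N lam (sliceMap J x + w) *
      Real.exp (-(halfSq J x + J.card * Real.log (2 * Real.pi))) =
      (slice J N w).indicator (fun x => Real.exp (-slicePotential J lam w x)) x := by
  by_cases h : x ∈ slice J N w
  · have h' : sliceMap J x + w ∈ ball N := h
    rw [Set.indicator_of_mem h, dens, Set.indicator_of_mem h', ← Real.exp_add]
    congr 1
    rw [slicePotential]; ring
  · have h' : sliceMap J x + w ∉ ball N := h
    rw [Set.indicator_of_notMem h, dens, Set.indicator_of_notMem h', zero_mul]

/-! ### The logarithmic Sobolev inequality for bounded functions -/

theorem measurable_loopSeries : Measurable loopSeries := by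
  have hS : MeasurableSet {ω | SqSummable ω} := by
    have e : {ω | SqSummable ω} =
        {ω | ∑' j : Freq, ENNReal.ofReal (‖coef ω j‖ ^ 2) ≠ ∞} := by
      ext ω
      refine ⟨fun h => h.tsum_ofReal_ne_top, fun h => ?_⟩
      refine (ENNReal.summable_toReal h).congr fun j => ?_
      rw [ENNReal.toReal_ofReal (by positivity)]
    rw [e]
    have : Measurable fun ω : Sample => ∑' j : Freq, ENNReal.ofReal (‖coef ω j‖ ^ 2) :=
      Measurable.tsum fun j =>
        (ENNReal.continuous_ofReal.comp ((continuous_coef j).norm.pow 2)).measurable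
    exact this (measurableSet_singleton ∞).compl
  refine measurable_of_tendsto_metrizable
    (f := fun n => {ω | SqSummable ω}.indicator (modeSum (freqs n)))
    (fun n => (continuous_modeSum _).measurable.indicator hS) ?_
  refine tendsto_pi_nhds.2 fun ω => ?_
  by_cases h : SqSummable ω
  · have h' : ω ∈ {ω | SqSummable ω} := h
    simpa only [Set.indicator_of_mem h'] using tendsto_modeSum h
  · have h' : ω ∉ {ω | SqSummable ω} := h
    simp only [Set.indicator_of_notMem h']
    have h0 : loopSeries ω = 0 := tsum_eq_zero_of_not_summable fun hs =>
      h ((orthonormal_freq.orthogonalFamily.summable_iff_norm_sq_summable (coef ω)).1 hs)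
    rw [h0]
    exact tendsto_const_nhds

/-- Integration of a function of the field against the Gibbs weight. -/
def weighted (N lam : ℝ) (h : Field2 → ℝ) (ω : Sample) : ℝ :=
  h (loopSeries ω) * dens N lam (loopSeries ω)

theorem measurable_weighted (N lam : ℝ) {h : Field2 → ℝ} (hh : Measurable h) :
    Measurable (weighted N lam h) :=
  (hh.comp measurable_loopSeries).mul ((measurable_dens N lam).comp measurable_loopSeries)

theorem weighted_extend_mul {N lam : ℝ} {h : Field2 → ℝ} (J : Finset Freq)
    {ω : Sample} (hω : SqSummable ω) (x : J → ℝ × ℝ) :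
    weighted N lam h (extend J x ω) * Real.exp (-(halfSq J x + J.card * Real.log (2 * Real.pi))) =
      (slice J N (loopSeries ω - modeSum J ω)).indicator (fun x =>
        h (sliceMap J x + (loopSeries ω - modeSum J ω)) *
          Real.exp (-slicePotential J lam (loopSeries ω - modeSum J ω) x)) x := by
  rw [weighted, loopSeries_extend hω, mul_assoc, dens_mul_exp_eq]
  by_cases hx : x ∈ slice J N (loopSeries ω - modeSum J ω)
  · rw [Set.indicator_of_mem hx, Set.indicator_of_mem hx]
  · rw [Set.indicator_of_notMem hx, Set.indicator_of_notMem hx, mul_zero]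

theorem integral_weighted_merge {N lam : ℝ} {h : Field2 → ℝ} (hh : Measurable h) (J : Finset Freq)
    {ω : Sample} (hω : SqSummable ω) :
    ∫ ω', weighted N lam h (merge J ω' ω) ∂gaussianLaw =
      ∫ x in slice J N (loopSeries ω - modeSum J ω),
        h (sliceMap J x + (loopSeries ω - modeSum J ω)) *
          Real.exp (-slicePotential J lam (loopSeries ω - modeSum J ω) x) := by
  rw [integral_merge_eq J ω _ (measurable_weighted N lam hh),
    ← integral_indicator (isCompact_slice J N _).measurableSet]
  exact integral_congr_ae (ae_of_all _ fun x => weighted_extend_mul J hω x)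

theorem integrableOn_slice {N lam : ℝ} {h : Field2 → ℝ} (hh : Measurable h) (J : Finset Freq)
    {ω : Sample} (hω : Regular ω)
    (hi : Integrable (fun ω' => weighted N lam h (merge J ω' ω)) gaussianLaw) :
    IntegrableOn (fun x => h (sliceMap J x + (loopSeries ω - modeSum J ω)))
      (slice J N (loopSeries ω - modeSum J ω)) := by
  rw [integrable_merge_iff J ω _ (measurable_weighted N lam hh)] at hi
  simp only [weighted_extend_mul J hω.sqSummable] at hi
  have hK := isCompact_slice J N (loopSeries ω - modeSum J ω)
  rw [integrable_indicator_iff hK.measurableSet] at hi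
  have hc : Continuous fun x => Real.exp (slicePotential J lam (loopSeries ω - modeSum J ω) x) :=
    Real.continuous_exp.comp (continuous_slicePotential J lam (hω.norm4_tail_ne_top J))
  refine (hi.mul_continuousOn hc.continuousOn hK).congr_fun (fun x _ => ?_) hK.measurableSet
  simp only
  rw [mul_assoc, ← Real.exp_add, neg_add_cancel, Real.exp_zero, mul_one]

theorem entropy_slice_le {N lam c : ℝ} (hlam : 0 < lam) (hc : c ≤ 1 - Real.pi ^ 2 * N * lam)
    (hc0 : 0 < c) {F G : Field2 → ℝ} (hF : Measurable F) (hFc : ContinuousOn F (ball N)) {a : ℝ}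
    (ha : 0 < a) (hFa : ∀ u ∈ ball N, a ≤ F u) (hG : Measurable G) (hG0 : ∀ u, 0 ≤ G u)
    (hslope : ∀ u ∈ ball N, ∀ η > 0, ∀ᶠ v in 𝓝[ball N] u, |F v - F u| ≤ (G u + η) * ‖v - u‖)
    (J : Finset Freq) {ω : Sample} (hω : Regular ω)
    (hi : Integrable (fun ω' => weighted N lam (fun u => G u ^ 2) (merge J ω' ω)) gaussianLaw) :
    (∫ ω', weighted N lam (fun u => F u ^ 2 * Real.log (F u ^ 2)) (merge J ω' ω) ∂gaussianLaw) -
      (∫ ω', weighted N lam (fun u => F u ^ 2) (merge J ω' ω) ∂gaussianLaw) *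
        Real.log ((∫ ω', weighted N lam (fun u => F u ^ 2) (merge J ω' ω) ∂gaussianLaw) /
          ∫ ω', weighted N lam (fun _ => 1) (merge J ω' ω) ∂gaussianLaw)
      ≤ 2 / c * ∫ ω', weighted N lam (fun u => G u ^ 2) (merge J ω' ω) ∂gaussianLaw := by
  have hw := hω.norm4_tail_ne_top J
  have hgi := integrableOn_slice (hG.pow_const 2) J hω hi
  rw [integral_weighted_merge (by fun_prop) J hω.sqSummable,
    integral_weighted_merge (by fun_prop) J hω.sqSummable,
    integral_weighted_merge (by fun_prop) J hω.sqSummable,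
    integral_weighted_merge (by fun_prop) J hω.sqSummable]
  generalize loopSeries ω - modeSum J ω = w at *
  simp only [one_mul]
  have hmaps : Set.MapsTo (fun x => sliceMap J x + w) (slice J N w) (ball N) := fun x hx => hx
  have hcont : Continuous fun x => sliceMap J x + w := by fun_prop
  refine entropy_sq_le (isCompact_slice J N w) (convex_slice J N w)
    (continuous_slicePotential J lam hw).continuousOn hc0
    (uniformlyConvexPotential_slice J hlam hc hc0.le hw) (sliceMap_injective J)
    (f := fun x => F (sliceMap J x + w)) (g := fun x => G (sliceMap J x + w))
    (hFc.comp hcont.continuousOn hmaps) ha (fun x hx => hFa _ hx)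
    ((hG.comp hcont.measurable).indicator (isCompact_slice J N w).measurableSet)
    (fun x => hG0 _) hgi fun x hx η hη => ?_
  have h1 : Tendsto (fun x => sliceMap J x + w) (𝓝[slice J N w] x)
      (𝓝[ball N] (sliceMap J x + w)) :=
    (hcont.continuousWithinAt (s := slice J N w) (x := x)).tendsto_nhdsWithin hmaps
  filter_upwards [h1.eventually (hslope _ hx η hη)] with y hy
  have e : sliceMap J (y - x) = sliceMap J y + w - (sliceMap J x + w) := by rw [map_sub]; abel
  rw [e]
  exact hy

/-- A Lipschitz bound for the relative entropy function `A log (A / B)`. -/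
theorem mul_log_div_le {A B a₀ b₀ r s t : ℝ} (hs : 0 < s) (hsr : s ≤ r) (hrt : r ≤ t) (hA : A = r * B)
    (ha₀ : 0 < a₀) (hb₀ : 0 < b₀) :
    A * Real.log (A / B) ≤ a₀ * Real.log (a₀ / b₀) +
      (|Real.log s| + |Real.log t| + 1 + t) * (|A - a₀| + |B - b₀|) := by
  have hr : 0 < r := hs.trans_le hsr
  have e1 : A * Real.log (A / B) = A * Real.log r := by
    rcases eq_or_ne B 0 with h | h
    · rw [hA, h]; simp
    · rw [hA, mul_div_assoc, div_self h, mul_one]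
  have h1 : a₀ * Real.log r + a₀ - r * b₀ ≤ a₀ * Real.log (a₀ / b₀) := by
    have h2 := Real.log_le_sub_one_of_pos (x := r * b₀ / a₀) (by positivity)
    rw [Real.log_div (by positivity) ha₀.ne', Real.log_mul hr.ne' hb₀.ne'] at h2
    rw [Real.log_div ha₀.ne' hb₀.ne']
    have h3 := mul_le_mul_of_nonneg_left h2 ha₀.le
    have h4 : a₀ * (r * b₀ / a₀ - 1) = r * b₀ - a₀ := by field_simp
    linarith
  have hl : |Real.log r| ≤ |Real.log s| + |Real.log t| := by
    have h5 := Real.log_le_log hs hsr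
    have h6 := Real.log_le_log hr hrt
    refine abs_le.2 ⟨?_, ?_⟩
    · linarith [neg_abs_le (Real.log s), abs_nonneg (Real.log t)]
    · linarith [le_abs_self (Real.log t), abs_nonneg (Real.log s)]
  have h7 : (A - a₀) * Real.log r ≤ |A - a₀| * (|Real.log s| + |Real.log t|) := by
    refine (le_abs_self _).trans ?_
    rw [abs_mul]; gcongr
  have h8 : A - a₀ ≤ |A - a₀| := le_abs_self _
  have h9 : r * (b₀ - B) ≤ t * |B - b₀| := by
    rw [abs_sub_comm]
    exact (mul_le_mul_of_nonneg_left (le_abs_self _) hr.le).trans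
      (mul_le_mul_of_nonneg_right hrt (abs_nonneg _))
  have h10 : 0 ≤ t * |A - a₀| := mul_nonneg (hr.le.trans hrt) (abs_nonneg _)
  have h11 : 0 ≤ (|Real.log s| + |Real.log t| + 1) * |B - b₀| := by positivity
  rw [e1]
  subst hA
  nlinarith

theorem integrable_weighted_of_bounded {N lam : ℝ} (hρ : Integrable (weighted N lam fun _ => 1) gaussianLaw)
    {h : Field2 → ℝ} (hh : Measurable h) {C : ℝ} (hC : ∀ u ∈ ball N, |h u| ≤ C) :
    Integrable (weighted N lam h) gaussianLaw := by
  refine (hρ.const_mul C).mono' (measurable_weighted N lam hh).aestronglyMeasurable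
    (ae_of_all _ fun ω => ?_)
  rw [weighted, weighted, one_mul, norm_mul, Real.norm_eq_abs,
    Real.norm_of_nonneg (dens_nonneg _ _ _)]
  by_cases hb : loopSeries ω ∈ ball N
  · exact mul_le_mul_of_nonneg_right (hC _ hb) (dens_nonneg _ _ _)
  · simp [dens, hb]

theorem integral_sub_le_of_ae_le {Ω : Type*} [MeasurableSpace Ω] {μ : Measure Ω}
    [IsProbabilityMeasure μ] {A B C D : Ω → ℝ} (hA : Integrable A μ) (hB : Integrable B μ)
    (hC : Integrable C μ) (hD : Integrable D μ) {a b k κ M : ℝ}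
    (h : ∀ᵐ ω ∂μ, C ω - k - κ * D ω ≤ M * (|A ω - a| + |B ω - b|)) :
    (∫ ω, C ω ∂μ) - k - κ * ∫ ω, D ω ∂μ ≤
      M * ((∫ ω, |A ω - a| ∂μ) + ∫ ω, |B ω - b| ∂μ) := by
  have jA : Integrable (fun ω => |A ω - a|) μ := (hA.sub (integrable_const a)).abs
  have jB : Integrable (fun ω => |B ω - b|) μ := (hB.sub (integrable_const b)).abs
  have jC : Integrable (fun ω => C ω - k) μ := hC.sub (integrable_const k)
  rw [← integral_add jA jB, ← integral_const_mul, ← integral_const_mul]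
  have e0 : (∫ ω, C ω ∂μ) - k = ∫ ω, (C ω - k) ∂μ := by
    rw [integral_sub hC (integrable_const k)]; simp
  rw [e0, ← integral_sub jC (hD.const_mul _)]
  exact integral_mono_ae (jC.sub (hD.const_mul _)) ((jA.add jB).const_mul M) h

theorem entropy_weighted_le_of_bounded {N lam c : ℝ} (hlam : 0 < lam)
    (hc : c ≤ 1 - Real.pi ^ 2 * N * lam) (hc0 : 0 < c)
    (hρ : Integrable (weighted N lam fun _ => 1) gaussianLaw)
    (hρ0 : 0 < ∫ ω, weighted N lam (fun _ => 1) ω ∂gaussianLaw)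
    {F G : Field2 → ℝ} (hF : Measurable F) (hFc : ContinuousOn F (ball N)) {a b : ℝ}
    (ha : 0 < a) (hFa : ∀ u ∈ ball N, a ≤ F u) (hFb : ∀ u ∈ ball N, F u ≤ b)
    (hG : Measurable G) (hG0 : ∀ u, 0 ≤ G u)
    (hslope : ∀ u ∈ ball N, ∀ η > 0, ∀ᶠ v in 𝓝[ball N] u, |F v - F u| ≤ (G u + η) * ‖v - u‖)
    (hi : Integrable (weighted N lam fun u => G u ^ 2) gaussianLaw) :
    (∫ ω, weighted N lam (fun u => F u ^ 2 * Real.log (F u ^ 2)) ω ∂gaussianLaw) -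
      (∫ ω, weighted N lam (fun u => F u ^ 2) ω ∂gaussianLaw) *
        Real.log ((∫ ω, weighted N lam (fun u => F u ^ 2) ω ∂gaussianLaw) /
          ∫ ω, weighted N lam (fun _ => 1) ω ∂gaussianLaw)
      ≤ 2 / c * ∫ ω, weighted N lam (fun u => G u ^ 2) ω ∂gaussianLaw := by
  have hsq : ∀ u ∈ ball N, a ^ 2 ≤ F u ^ 2 ∧ F u ^ 2 ≤ b ^ 2 := fun u hu =>
    ⟨pow_le_pow_left₀ ha.le (hFa u hu) 2,
      pow_le_pow_left₀ (ha.le.trans (hFa u hu)) (hFb u hu) 2⟩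
  have hlog : ∀ u ∈ ball N, |Real.log (F u ^ 2)| ≤ |Real.log (a ^ 2)| + |Real.log (b ^ 2)| := by
    intro u hu
    have h5 := Real.log_le_log (by positivity) (hsq u hu).1
    have h6 := Real.log_le_log (lt_of_lt_of_le (by positivity) (hsq u hu).1) (hsq u hu).2
    refine abs_le.2 ⟨?_, ?_⟩
    · linarith [neg_abs_le (Real.log (a ^ 2)), abs_nonneg (Real.log (b ^ 2))]
    · linarith [le_abs_self (Real.log (b ^ 2)), abs_nonneg (Real.log (a ^ 2))]
  have iA : Integrable (weighted N lam fun u => F u ^ 2) gaussianLaw :=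
    integrable_weighted_of_bounded hρ (by fun_prop) (C := b ^ 2) fun u hu => by
      rw [abs_of_nonneg (by positivity)]; exact (hsq u hu).2
  have iC : Integrable (weighted N lam fun u => F u ^ 2 * Real.log (F u ^ 2)) gaussianLaw :=
    integrable_weighted_of_bounded hρ (by fun_prop)
      (C := b ^ 2 * (|Real.log (a ^ 2)| + |Real.log (b ^ 2)|)) fun u hu => by
      rw [abs_mul, abs_of_nonneg (by positivity : 0 ≤ F u ^ 2)]
      exact mul_le_mul (hsq u hu).2 (hlog u hu) (abs_nonneg _) (by positivity)
  set a₀ := ∫ ω, weighted N lam (fun u => F u ^ 2) ω ∂gaussianLaw with ha₀d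
  set b₀ := ∫ ω, weighted N lam (fun _ => 1) ω ∂gaussianLaw with hb₀d
  have hcmp : ∀ ω, a ^ 2 * weighted N lam (fun _ => 1) ω ≤ weighted N lam (fun u => F u ^ 2) ω ∧
      weighted N lam (fun u => F u ^ 2) ω ≤ b ^ 2 * weighted N lam (fun _ => 1) ω := by
    intro ω
    simp only [weighted, one_mul]
    by_cases hb : loopSeries ω ∈ ball N
    · exact ⟨mul_le_mul_of_nonneg_right (hsq _ hb).1 (dens_nonneg _ _ _),
        mul_le_mul_of_nonneg_right (hsq _ hb).2 (dens_nonneg _ _ _)⟩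
    · simp [dens, hb]
  have ha₀ : 0 < a₀ := by
    have : a ^ 2 * b₀ ≤ a₀ := by
      rw [hb₀d, ← integral_const_mul]
      exact integral_mono (hρ.const_mul _) iA fun ω => (hcmp ω).1
    exact lt_of_lt_of_le (by positivity) this
  set M := |Real.log (a ^ 2)| + |Real.log (b ^ 2)| + 1 + b ^ 2
  have prodInt : ∀ {h : Field2 → ℝ} (n : ℕ), Integrable (weighted N lam h) gaussianLaw →
      Integrable (fun p : Sample × Sample => weighted N lam h (merge (freqs n) p.1 p.2))
        (gaussianLaw.prod gaussianLaw) := fun n hh =>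
    ((measurePreserving_merge (freqs n)).integrable_comp hh.aestronglyMeasurable).2 hh
  have intEq : ∀ {h : Field2 → ℝ} (n : ℕ), Integrable (weighted N lam h) gaussianLaw →
      Measurable h →
      ∫ ω, ∫ ω', weighted N lam h (merge (freqs n) ω' ω) ∂gaussianLaw ∂gaussianLaw =
        ∫ ω, weighted N lam h ω ∂gaussianLaw := by
    intro h n hh hm
    rw [← integral_prod_symm _ (prodInt n hh)]
    have e := (measurePreserving_merge (freqs n)).map_eq
    conv_rhs => rw [← e]
    rw [integral_map (measurable_merge _).aemeasurable
      (measurable_weighted N lam hm).aestronglyMeasurable]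
  have key : ∀ n, (∫ ω, weighted N lam (fun u => F u ^ 2 * Real.log (F u ^ 2)) ω ∂gaussianLaw) -
      a₀ * Real.log (a₀ / b₀) - 2 / c * ∫ ω, weighted N lam (fun u => G u ^ 2) ω ∂gaussianLaw ≤
      M * ((∫ ω, |(∫ ω', weighted N lam (fun u => F u ^ 2) (merge (freqs n) ω' ω) ∂gaussianLaw) -
        a₀| ∂gaussianLaw) + ∫ ω, |(∫ ω', weighted N lam (fun _ => 1) (merge (freqs n) ω' ω)
          ∂gaussianLaw) - b₀| ∂gaussianLaw) := by
    intro n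
    rw [← intEq n iC (by fun_prop), ← intEq n hi (by fun_prop)]
    refine integral_sub_le_of_ae_le (prodInt n iA).integral_prod_right
      (prodInt n hρ).integral_prod_right (prodInt n iC).integral_prod_right
      (prodInt n hi).integral_prod_right ?_
    filter_upwards [ae_regular, (prodInt n hi).prod_left_ae, (prodInt n iA).prod_left_ae,
      (prodInt n hρ).prod_left_ae] with ω hω h1 h2 h3
    have h4 := entropy_slice_le hlam hc hc0 hF hFc ha hFa hG hG0 hslope (freqs n) hω h1
    have h5 : a ^ 2 * (∫ ω', weighted N lam (fun _ => 1) (merge (freqs n) ω' ω) ∂gaussianLaw) ≤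
        ∫ ω', weighted N lam (fun u => F u ^ 2) (merge (freqs n) ω' ω) ∂gaussianLaw := by
      rw [← integral_const_mul]
      exact integral_mono (h3.const_mul _) h2 fun ω' => (hcmp _).1
    have h6 : (∫ ω', weighted N lam (fun u => F u ^ 2) (merge (freqs n) ω' ω) ∂gaussianLaw) ≤
        b ^ 2 * ∫ ω', weighted N lam (fun _ => 1) (merge (freqs n) ω' ω) ∂gaussianLaw := by
      rw [← integral_const_mul]
      exact integral_mono h2 (h3.const_mul _) fun ω' => (hcmp _).2
    have h7 : 0 ≤ ∫ ω', weighted N lam (fun _ => 1) (merge (freqs n) ω' ω) ∂gaussianLaw :=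
      integral_nonneg fun ω' => by
        simp only [weighted, one_mul]; exact dens_nonneg _ _ _
    generalize (∫ ω', weighted N lam (fun u => F u ^ 2) (merge (freqs n) ω' ω) ∂gaussianLaw) = A
      at *
    generalize (∫ ω', weighted N lam (fun _ => 1) (merge (freqs n) ω' ω) ∂gaussianLaw) = B at *
    obtain ⟨r, hr1, hr2, hr3⟩ : ∃ r, a ^ 2 ≤ r ∧ r ≤ b ^ 2 ∧ A = r * B := by
      rcases h7.eq_or_lt with h0 | h0
      · refine ⟨a ^ 2, le_rfl, ?_, ?_⟩
        · obtain ⟨u, hu⟩ : (ball N).Nonempty := by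
            by_contra hne
            rw [Set.not_nonempty_iff_eq_empty] at hne
            simp [hb₀d, weighted, dens, hne] at hρ0
          exact (hsq u hu).1.trans (hsq u hu).2
        · rw [← h0] at h5 h6 ⊢
          linarith
      · exact ⟨A / B, (le_div_iff₀ h0).2 h5, (div_le_iff₀ h0).2 h6, by field_simp⟩
    have h8 := mul_log_div_le (by positivity) hr1 hr2 hr3 ha₀ hρ0
    linarith
  have hlim := (((tendsto_integral_merge iA).add (tendsto_integral_merge hρ)).const_mul M)
  rw [add_zero, mul_zero] at hlim
  have := ge_of_tendsto' hlim key
  linarith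

/-! ### The gradient norm -/

section GradNorm

variable {X : Type*} [MetricSpace X] {f : X → ℝ}

theorem eventually_abs_sub_le_of_gradNorm {x : X} (h : gradNorm f x ≠ ∞) {η : ℝ} (hη : 0 < η) :
    ∀ᶠ y in 𝓝 x, |f y - f x| ≤ ((gradNorm f x).toReal + η) * dist y x := by
  have hlt : gradNorm f x < ENNReal.ofReal ((gradNorm f x).toReal + η) := by
    conv_lhs => rw [← ENNReal.ofReal_toReal h]
    exact (ENNReal.ofReal_lt_ofReal_iff (by positivity)).2 (by linarith)
  have h1 := eventually_lt_of_limsup_lt hlt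
  rw [eventually_nhdsWithin_iff] at h1
  filter_upwards [h1] with y hy
  rcases eq_or_ne y x with rfl | hne
  · simp
  have h2 := (hy hne).le
  have hd : edist y x ≠ 0 := by simpa using hne
  rw [ENNReal.div_le_iff hd (edist_ne_top _ _), edist_dist, edist_dist,
    ← ENNReal.ofReal_mul (by positivity), ENNReal.ofReal_le_ofReal_iff (by positivity)] at h2
  rwa [Real.dist_eq] at h2

theorem continuous_of_gradNorm (h : ∀ x, gradNorm f x ≠ ∞) : Continuous f := by
  refine continuous_iff_continuousAt.2 fun x => ?_
  refine tendsto_iff_dist_tendsto_zero.2 ?_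
  have h1 := eventually_abs_sub_le_of_gradNorm (h x) one_pos
  refine squeeze_zero' (Eventually.of_forall fun y => dist_nonneg)
    (h1.mono fun y hy => (Real.dist_eq _ _).trans_le hy) ?_
  have : Continuous fun y => ((gradNorm f x).toReal + 1) * dist y x := by fun_prop
  simpa using this.tendsto x

theorem measurable_gradNorm [MeasurableSpace X] [OpensMeasurableSpace X] (hf : Continuous f) :
    Measurable (gradNorm f) := by
  have e : gradNorm f = fun x => ⨅ n : ℕ, ⨆ y ∈ Metric.ball x (1 / ((n : ℝ) + 1)) ∩ {x}ᶜ,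
      edist (f y) (f x) / edist y x := by
    ext x
    have hb := nhdsWithin_hasBasis (Metric.nhds_basis_ball_inv_nat_succ (x := x)) {x}ᶜ
    rw [gradNorm, hb.limsup_eq_iInf_iSup]
    simp
  rw [e]
  refine Measurable.iInf fun n => LowerSemicontinuous.measurable ?_
  intro x t ht
  simp only [lt_iSup_iff] at ht
  obtain ⟨y, ⟨hy1, hy2⟩, hlt⟩ := ht
  have hd : edist y x ≠ 0 := by simpa using hy2
  have hc : ContinuousAt (fun z => edist (f y) (f z) / edist y z) x := by
    refine ENNReal.Tendsto.div ?_ (Or.inr hd) ?_ (Or.inl (edist_ne_top _ _))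
    · exact (continuous_const.edist hf).tendsto x
    · exact (continuous_const.edist continuous_id).tendsto x
  filter_upwards [hc.eventually (lt_mem_nhds hlt),
    Metric.isOpen_ball.mem_nhds (Metric.mem_ball'.1 hy1 : x ∈ Metric.ball y (1 / ((n : ℝ) + 1))),
    isOpen_ne.mem_nhds (Ne.symm hy2)] with z h1 h2 h3
  exact lt_of_lt_of_le h1 (le_iSup₂_of_le y ⟨Metric.mem_ball'.2 h2, Ne.symm h3⟩ le_rfl)

/-- The logarithmic Sobolev inequality follows from the one for bounded functions which are bounded
away from zero. -/
theorem lsi_of_bounded [MeasurableSpace X] [BorelSpace X] {μ : Measure X} [IsProbabilityMeasure μ]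
    {κ : ℝ} (hκ : 0 ≤ κ)
    (H : ∀ (F G : X → ℝ) (a b : ℝ), Continuous F → 0 < a → (∀ x, a ≤ F x) → (∀ x, F x ≤ b) →
      Measurable G → (∀ x, 0 ≤ G x) → Integrable (fun x => G x ^ 2) μ →
      (∀ x, ∀ η > 0, ∀ᶠ y in 𝓝 x, |F y - F x| ≤ (G x + η) * dist y x) →
      (∫ x, F x ^ 2 * Real.log (F x ^ 2) ∂μ) -
        (∫ x, F x ^ 2 ∂μ) * Real.log (∫ x, F x ^ 2 ∂μ) ≤ κ * ∫ x, G x ^ 2 ∂μ)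
    (hf2 : MemLp f 2 μ) (hfin : ∀ x, gradNorm f x ≠ ∞)
    (hg2 : MemLp (fun x => (gradNorm f x).toReal) 2 μ) :
    Integrable (fun x => f x ^ 2 * Real.log (f x ^ 2 / ∫ y, f y ^ 2 ∂μ)) μ ∧
      ∫ x, f x ^ 2 * Real.log (f x ^ 2 / ∫ y, f y ^ 2 ∂μ) ∂μ
        ≤ κ * ∫ x, (gradNorm f x).toReal ^ 2 ∂μ := by
  have hfc := continuous_of_gradNorm hfin
  have hgm := (measurable_gradNorm hfc).ennreal_toReal
  have ig := hg2.integrable_sq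
  have iF := hf2.integrable_sq
  set g : X → ℝ := fun x => (gradNorm f x).toReal with hg
  set D := κ * ∫ x, g x ^ 2 ∂μ with hD
  have hD0 : 0 ≤ D := mul_nonneg hκ (integral_nonneg fun x => by positivity)
  set m := ∫ y, f y ^ 2 ∂μ with hm
  set T : ℕ → X → ℝ := fun k x => min (max |f x| (1 / ((k : ℝ) + 1))) (k + 1) with hT
  have hk : ∀ k : ℕ, 1 / ((k : ℝ) + 1) ≤ (k : ℝ) + 1 := fun k => by
    rw [div_le_iff₀ (by positivity)]; nlinarith [(Nat.cast_nonneg k : (0 : ℝ) ≤ k)]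
  have hTpos : ∀ (k : ℕ) (x : X), 1 / ((k : ℝ) + 1) ≤ T k x := fun k x => le_min (le_max_right _ _) (hk k)
  have hTc : ∀ k, Continuous (T k) := fun k => by fun_prop
  have hTsq : ∀ k x, T k x ^ 2 ≤ f x ^ 2 + 1 := fun k x => by
    have h0 : 0 ≤ T k x := le_trans (by positivity) (hTpos k x)
    have h1 : T k x ≤ max |f x| 1 := (min_le_left _ _).trans (max_le_max le_rfl (by
      rw [div_le_one (by positivity)]; linarith [(Nat.cast_nonneg k : (0 : ℝ) ≤ k)]))
    have h2 := pow_le_pow_left₀ h0 h1 2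
    refine h2.trans ?_
    rcases le_total |f x| 1 with h | h
    · rw [max_eq_right h]; nlinarith [sq_nonneg (f x)]
    · rw [max_eq_left h, sq_abs]; linarith
  have hTlim : ∀ x, Tendsto (fun k => T k x) atTop (𝓝 |f x|) := fun x => by
    have h1 : Tendsto (fun k : ℕ => max |f x| (1 / ((k : ℝ) + 1))) atTop (𝓝 |f x|) := by
      have := (tendsto_one_div_add_atTop_nhds_zero_nat (𝕜 := ℝ))
      simpa using (tendsto_const_nhds (x := |f x|)).max this
    refine h1.congr' ?_
    obtain ⟨K, hK⟩ := exists_nat_ge |f x|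
    filter_upwards [eventually_ge_atTop K] with k hk'
    refine (min_eq_left (max_le ?_ (hk k))).symm
    have : (K : ℝ) ≤ k := by exact_mod_cast hk'
    linarith
  have hTsqlim : ∀ x, Tendsto (fun k => T k x ^ 2) atTop (𝓝 (f x ^ 2)) := fun x => by
    simpa using (hTlim x).pow 2
  have hmlim : Tendsto (fun k => ∫ x, T k x ^ 2 ∂μ) atTop (𝓝 m) := by
    refine tendsto_integral_of_dominated_convergence (fun x => f x ^ 2 + 1)
      (fun k => ((hTc k).pow 2).measurable.aestronglyMeasurable) (iF.add (integrable_const 1))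
      (fun k => ae_of_all _ fun x => ?_) (ae_of_all _ hTsqlim)
    rw [Real.norm_of_nonneg (by positivity)]
    exact hTsq k x
  have hHk : ∀ k, (∫ x, T k x ^ 2 * Real.log (T k x ^ 2) ∂μ) ≤
      (∫ x, T k x ^ 2 ∂μ) * Real.log (∫ x, T k x ^ 2 ∂μ) + D := by
    intro k
    have := H (T k) g _ _ (hTc k) (by positivity) (hTpos k) (fun x => min_le_right _ _) hgm
      (fun x => ENNReal.toReal_nonneg) ig fun x η hη => by
        filter_upwards [eventually_abs_sub_le_of_gradNorm (hfin x) hη] with y hy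
        refine le_trans ?_ hy
        calc |T k y - T k x| ≤ |max |f y| (1 / ((k : ℝ) + 1)) - max |f x| (1 / ((k : ℝ) + 1))| := by
              exact (abs_min_sub_min_le_max _ _ _ _).trans (by simp)
          _ ≤ |(|f y| - |f x|)| := by
              exact (abs_max_sub_max_le_max _ _ _ _).trans (by simp)
          _ ≤ |f y - f x| := abs_abs_sub_abs_le _ _
    linarith
  have hψ : ∀ s : ℝ, 0 ≤ s → 0 ≤ s * Real.log s + 1 := by
    intro s hs
    rcases hs.eq_or_lt with rfl | hs
    · simp
    · have := Real.one_sub_inv_le_log_of_pos hs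
      have h2 := mul_le_mul_of_nonneg_left this hs.le
      have h3 : s * (1 - s⁻¹) = s - 1 := by field_simp
      linarith
  have hψc : Continuous fun s : ℝ => s * Real.log s := Real.continuous_mul_log
  have iT : ∀ k, Integrable (fun x => T k x ^ 2 * Real.log (T k x ^ 2)) μ := by
    intro k
    have hcont : Continuous fun x => T k x ^ 2 * Real.log (T k x ^ 2) := hψc.comp ((hTc k).pow 2)
    obtain ⟨C, hC⟩ := (isCompact_Icc (a := (0 : ℝ)) (b := ((k : ℝ) + 1) ^ 2)).exists_bound_of_continuousOn
      hψc.continuousOn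
    refine Integrable.of_bound hcont.measurable.aestronglyMeasurable C (ae_of_all _ fun x => ?_)
    refine hC _ ⟨by positivity, ?_⟩
    exact pow_le_pow_left₀ (le_trans (by positivity) (hTpos k x)) (min_le_right _ _) 2
  have hfat : ∫⁻ x, ENNReal.ofReal (f x ^ 2 * Real.log (f x ^ 2) + 1) ∂μ ≤
      ENNReal.ofReal (m * Real.log m + D + 1) := by
    have h1 : ∀ x, ENNReal.ofReal (f x ^ 2 * Real.log (f x ^ 2) + 1) =
        liminf (fun k => ENNReal.ofReal (T k x ^ 2 * Real.log (T k x ^ 2) + 1)) atTop := by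
      intro x
      refine (Tendsto.liminf_eq ?_).symm
      refine (ENNReal.continuous_ofReal.tendsto _).comp ?_
      exact ((hψc.tendsto _).comp (hTsqlim x)).add_const 1
    simp only [h1]
    refine (lintegral_liminf_le fun k => ?_).trans ?_
    · exact ((hψc.comp ((hTc k).pow 2)).add continuous_const).measurable.ennreal_ofReal
    · have h2 : ∀ k, ∫⁻ x, ENNReal.ofReal (T k x ^ 2 * Real.log (T k x ^ 2) + 1) ∂μ ≤
          ENNReal.ofReal ((∫ x, T k x ^ 2 ∂μ) * Real.log (∫ x, T k x ^ 2 ∂μ) + D + 1) := by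
        intro k
        have iT1 : Integrable (fun x => T k x ^ 2 * Real.log (T k x ^ 2) + 1) μ :=
          (iT k).add (integrable_const 1)
        rw [← ofReal_integral_eq_lintegral_ofReal iT1
          (ae_of_all _ fun x => hψ _ (by positivity)), integral_add (iT k) (integrable_const 1)]
        refine ENNReal.ofReal_le_ofReal ?_
        have := hHk k
        simp only [integral_const, probReal_univ, smul_eq_mul, mul_one]
        linarith
      refine (liminf_le_liminf (Eventually.of_forall h2)).trans (le_of_eq (Tendsto.liminf_eq ?_))
      refine (ENNReal.continuous_ofReal.tendsto _).comp ?_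
      exact (((hψc.tendsto _).comp hmlim).add_const D).add_const 1
  have hm0 : 0 ≤ m := integral_nonneg fun x => by positivity
  have hcont : Continuous fun x => f x ^ 2 * Real.log (f x ^ 2) + 1 :=
    (hψc.comp (hfc.pow 2)).add continuous_const
  have i1 : Integrable (fun x => f x ^ 2 * Real.log (f x ^ 2) + 1) μ := by
    refine ⟨hcont.measurable.aestronglyMeasurable, ?_⟩
    rw [hasFiniteIntegral_iff_ofReal (ae_of_all _ fun x => hψ _ (by positivity))]
    exact hfat.trans_lt ENNReal.ofReal_lt_top
  have i2 : Integrable (fun x => f x ^ 2 * Real.log (f x ^ 2)) μ := by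
    refine (i1.sub (integrable_const 1)).congr (ae_of_all _ fun x => ?_)
    simp only [Pi.sub_apply, add_sub_cancel_right]
  have h3 : ∫ x, f x ^ 2 * Real.log (f x ^ 2) ∂μ ≤ m * Real.log m + D := by
    rw [← ofReal_integral_eq_lintegral_ofReal i1 (ae_of_all _ fun x => hψ _ (by positivity)),
      ENNReal.ofReal_le_ofReal_iff (by linarith [hψ m hm0]), integral_add i2 (integrable_const 1)]
      at hfat
    simp only [integral_const, probReal_univ, smul_eq_mul, mul_one] at hfat
    linarith
  rcases hm0.eq_or_lt with h0 | h0
  · rw [← h0]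
    simpa using hD0
  · have e : ∀ x, f x ^ 2 * Real.log (f x ^ 2 / m) =
        f x ^ 2 * Real.log (f x ^ 2) - f x ^ 2 * Real.log m := by
      intro x
      rcases eq_or_ne (f x) 0 with hx | hx
      · simp [hx]
      · rw [Real.log_div (by positivity) h0.ne']; ring
    simp only [e]
    refine ⟨i2.sub (iF.mul_const _), ?_⟩
    rw [integral_sub i2 (iF.mul_const _), integral_mul_const]
    linarith

end GradNorm

/-! ### The partition functions -/

theorem loopSeries_merge {ω : Sample} (h : SqSummable ω) (J : Finset Freq) (ω' : Sample) :
    loopSeries (merge J ω' ω) =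
      sliceMap J (J.restrict ω') + (loopSeries ω - modeSum J ω) := by
  rw [← extend_restrict, loopSeries_extend h]

theorem gaussianLaw_small_modes_pos (J : Finset Freq) {r : ℝ} (hr : 0 < r) :
    0 < gaussianLaw {ω | ‖sliceMap J (J.restrict ω)‖ < r} := by
  have hO : IsOpen {x : J → ℝ × ℝ | ‖sliceMap J x‖ < r} :=
    isOpen_lt (by fun_prop) continuous_const
  have h1 : gaussianLaw {ω | ‖sliceMap J (J.restrict ω)‖ < r} =
      gaussianLaw.map (J.restrict : Sample → _) {x | ‖sliceMap J x‖ < r} := by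
    rw [Measure.map_apply (by fun_prop) hO.measurableSet]; rfl
  have hm := measurable_halfSq J
  rw [h1, map_restrict_gaussianLaw, pos_iff_ne_zero]
  intro h0
  have h2 := withDensity_absolutelyContinuous' (μ := (volume : Measure (J → ℝ × ℝ)))
    (f := fun x => ENNReal.ofReal (Real.exp (-(halfSq J x + J.card * Real.log (2 * Real.pi)))))
    (by fun_prop) (ae_of_all _ fun x => by simp [Real.exp_pos])
  exact (hO.measure_pos volume ⟨0, by simpa using hr⟩).ne' (h2 h0)

theorem exists_small_tail {r : ℝ} (hr : 0 < r) :
    ∃ n, 0 < gaussianLaw {ω | SqSummable ω ∧ ‖loopSeries ω - modeSum (freqs n) ω‖ < r} := by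
  by_contra! h
  have h1 : ∀ᵐ ω ∂gaussianLaw,
      ∀ n, ¬ (SqSummable ω ∧ ‖loopSeries ω - modeSum (freqs n) ω‖ < r) := by
    refine ae_all_iff.2 fun n => ?_
    rw [ae_iff]
    simpa using h n
  obtain ⟨ω, h2, h3⟩ := (h1.and ae_sqSummable).exists
  have h4 : Tendsto (fun n => ‖loopSeries ω - modeSum (freqs n) ω‖) atTop (𝓝 0) := by
    simpa using ((tendsto_modeSum h3).const_sub (loopSeries ω)).norm
  obtain ⟨n, hn⟩ := (h4.eventually (gt_mem_nhds hr)).exists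
  exact h2 n ⟨h3, hn⟩

/-- The loop measure charges every ball. -/
theorem gaussianLaw_mem_ball_pos {N : ℝ} (hN : 0 < N) :
    0 < gaussianLaw {ω | loopSeries ω ∈ ball N} := by
  have hr : 0 < √N / 2 := by positivity
  obtain ⟨n, hn⟩ := exists_small_tail hr
  have hA : MeasurableSet {ω | loopSeries ω ∈ ball N} :=
    measurable_loopSeries (isClosed_ball N).measurableSet
  rw [← (measurePreserving_merge (freqs n)).measure_preimage hA.nullMeasurableSet]
  refine lt_of_lt_of_le ?_ (measure_mono (s :=
    {ω | ‖sliceMap (freqs n) ((freqs n).restrict ω)‖ < √N / 2} ×ˢ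
      {ω | SqSummable ω ∧ ‖loopSeries ω - modeSum (freqs n) ω‖ < √N / 2}) ?_)
  · rw [Measure.prod_prod]
    exact ENNReal.mul_pos (gaussianLaw_small_modes_pos _ hr).ne' hn.ne'
  · rintro ⟨ω', ω⟩ ⟨h1, h2, h3⟩
    simp only [Set.mem_ofPred_eq] at h1 h2 h3
    simp only [Set.mem_preimage, Set.mem_ofPred_eq]
    rw [loopSeries_merge h2, mem_ball_iff]
    have h4 := norm_add_le (sliceMap (freqs n) ((freqs n).restrict ω'))
      (loopSeries ω - modeSum (freqs n) ω)
    calc _ ≤ √N ^ 2 := pow_le_pow_left₀ (norm_nonneg _) (by linarith) 2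
      _ = N := Real.sq_sqrt hN.le

theorem one_le_dens {N lam : ℝ} (hlam : 0 < lam) {u : Field2} (hu : u ∈ ball N) :
    1 ≤ dens N lam u := by
  rw [dens, Set.indicator_of_mem hu]
  refine Real.one_le_exp (mul_nonneg (by positivity) (integral_nonneg fun θ => by positivity))

/-- The density of the Gibbs measure on the sample space. -/
def loopDens (N lam : ℝ) (ω : Sample) : ℝ≥0∞ := ENNReal.ofReal (dens N lam (loopSeries ω))

/-- The density of the truncated Gibbs measure on the sample space. -/
def truncDens (N lam : ℝ) (n : ℕ) (ω : Sample) : ℝ≥0∞ :=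
  ENNReal.ofReal (dens N lam (dirichlet n (loopSeries ω)))

theorem measurable_loopDens (N lam : ℝ) : Measurable (loopDens N lam) :=
  ((measurable_dens N lam).comp measurable_loopSeries).ennreal_ofReal

theorem measurable_truncDens (N lam : ℝ) (n : ℕ) : Measurable (truncDens N lam n) :=
  ((measurable_dens N lam).comp
    ((continuous_dirichlet n).measurable.comp measurable_loopSeries)).ennreal_ofReal

theorem ae_truncDens_eq (N lam : ℝ) (n : ℕ) :
    truncDens N lam n =ᵐ[gaussianLaw] fun ω => ENNReal.ofReal (dens N lam (modeSum (freqs n) ω)) := by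
  filter_upwards [ae_sqSummable] with ω hω
  rw [truncDens, dirichlet_loopSeries hω]

theorem norm_modeSum_le {ω : Sample} (h : SqSummable ω) (J : Finset Freq) :
    ‖modeSum J ω‖ ^ 2 ≤ ‖loopSeries ω‖ ^ 2 := by
  rw [norm_modeSum_sq]
  exact sum_le_hasSum _ (fun j _ => by positivity) (hasSum_norm_loopSeries_sq h)

theorem lintegral_loopDens_pos {N lam : ℝ} (hN : 0 < N) (hlam : 0 < lam) :
    0 < ∫⁻ ω, loopDens N lam ω ∂gaussianLaw := by
  have hA : MeasurableSet {ω | loopSeries ω ∈ ball N} :=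
    measurable_loopSeries (isClosed_ball N).measurableSet
  refine (gaussianLaw_mem_ball_pos hN).trans_le ?_
  rw [← lintegral_indicator_one hA]
  refine lintegral_mono fun ω => ?_
  by_cases h : loopSeries ω ∈ ball N
  · have h' : ω ∈ {ω | loopSeries ω ∈ ball N} := h
    rw [Set.indicator_of_mem h', loopDens, Pi.one_apply]
    exact ENNReal.one_le_ofReal.2 (one_le_dens hlam h)
  · have h' : ω ∉ {ω | loopSeries ω ∈ ball N} := h
    rw [Set.indicator_of_notMem h']; exact zero_le

theorem lintegral_truncDens_pos {N lam : ℝ} (hN : 0 < N) (hlam : 0 < lam) (n : ℕ) :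
    0 < ∫⁻ ω, truncDens N lam n ω ∂gaussianLaw := by
  have hA : MeasurableSet {ω | loopSeries ω ∈ ball N} :=
    measurable_loopSeries (isClosed_ball N).measurableSet
  refine (gaussianLaw_mem_ball_pos hN).trans_le ?_
  rw [← lintegral_indicator_one hA, lintegral_congr_ae (ae_truncDens_eq N lam n)]
  refine lintegral_mono_ae ?_
  filter_upwards [ae_sqSummable] with ω hω
  by_cases h : loopSeries ω ∈ ball N
  · have h' : ω ∈ {ω | loopSeries ω ∈ ball N} := h
    rw [Set.indicator_of_mem h', Pi.one_apply]
    exact ENNReal.one_le_ofReal.2 (one_le_dens hlam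
      (mem_ball_iff.2 ((norm_modeSum_le hω _).trans (mem_ball_iff.1 h))))
  · have h' : ω ∉ {ω | loopSeries ω ∈ ball N} := h
    rw [Set.indicator_of_notMem h']; exact zero_le

theorem lintegral_loopDens_ne_top {N lam : ℝ} (hN : 0 < N) (hlam : 0 < lam)
    (h : N * lam < 3 / (7 * Real.pi ^ 2)) : ∫⁻ ω, loopDens N lam ω ∂gaussianLaw ≠ ∞ :=
  ne_top_of_le_ne_top (partitionBound_ne_top h) (lintegral_dens_loopSeries_le hN hlam)

theorem lintegral_truncDens_ne_top {N lam : ℝ} (hN : 0 < N) (hlam : 0 < lam)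
    (h : N * lam < 3 / (7 * Real.pi ^ 2)) (n : ℕ) :
    ∫⁻ ω, truncDens N lam n ω ∂gaussianLaw ≠ ∞ := by
  rw [lintegral_congr_ae (ae_truncDens_eq N lam n)]
  exact ne_top_of_le_ne_top (partitionBound_ne_top h) (lintegral_dens_modeSum_le hN hlam _)

theorem ae_tendsto_truncDens (N lam : ℝ) :
    ∀ᵐ ω ∂gaussianLaw, Tendsto (fun n => truncDens N lam n ω) atTop (𝓝 (loopDens N lam ω)) := by
  filter_upwards [ae_regular] with ω hω
  simp only [truncDens, dirichlet_loopSeries hω.sqSummable]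
  exact (ENNReal.continuous_ofReal.tendsto _).comp (hω.tendsto_dens N lam)

theorem le_min_add_sq_div (x K : ℝ≥0∞) (hK : K ≠ 0) (hK' : K ≠ ∞) :
    x ≤ min x K + K⁻¹ * x ^ 2 := by
  rcases le_total x K with h | h
  · rw [min_eq_left h]; exact le_self_add
  · refine le_trans ?_ le_add_self
    calc x = K⁻¹ * (K * x) := by rw [← mul_assoc, ENNReal.inv_mul_cancel hK hK', one_mul]
      _ ≤ K⁻¹ * x ^ 2 := by rw [sq]; gcongr

/-- The partition functions of the truncated measures converge. -/
theorem tendsto_lintegral_truncDens {N lam : ℝ} (hN : 0 < N) (hlam : 0 < lam)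
    (h : N * (2 * lam) < 3 / (7 * Real.pi ^ 2)) :
    Tendsto (fun n => ∫⁻ ω, truncDens N lam n ω ∂gaussianLaw) atTop
      (𝓝 (∫⁻ ω, loopDens N lam ω ∂gaussianLaw)) := by
  have hlim := ae_tendsto_truncDens N lam
  have hB := partitionBound_ne_top h
  set B := partitionBound N (2 * lam)
  have hsq : ∀ n, ∫⁻ ω, truncDens N lam n ω ^ 2 ∂gaussianLaw ≤ B := by
    intro n
    have e : (fun ω => truncDens N lam n ω ^ 2) =ᵐ[gaussianLaw]
        fun ω => ENNReal.ofReal (dens N (2 * lam) (modeSum (freqs n) ω)) := by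
      filter_upwards [ae_truncDens_eq N lam n] with ω hω
      rw [hω, ← ENNReal.ofReal_pow (dens_nonneg _ _ _), dens_sq]
    rw [lintegral_congr_ae e]
    exact lintegral_dens_modeSum_le hN (by positivity) _
  refine tendsto_of_le_liminf_of_limsup_le ?_ ?_
  · calc ∫⁻ ω, loopDens N lam ω ∂gaussianLaw
        = ∫⁻ ω, liminf (fun n => truncDens N lam n ω) atTop ∂gaussianLaw :=
          lintegral_congr_ae (hlim.mono fun ω hω => hω.liminf_eq.symm)
      _ ≤ _ := lintegral_liminf_le fun n => measurable_truncDens N lam n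
  · refine ENNReal.le_of_forall_pos_le_add fun ε hε _ => ?_
    obtain ⟨K, hK⟩ : ∃ K : ℝ≥0∞, K ≠ 0 ∧ K ≠ ∞ ∧ K⁻¹ * B ≤ ε := by
      have hε' : (ε : ℝ≥0∞) ≠ 0 := by exact_mod_cast hε.ne'
      refine ⟨(B + 1) / ε, ?_, ENNReal.div_ne_top (by simp [hB]) hε', ?_⟩
      · exact (ENNReal.div_pos (by simp) ENNReal.coe_ne_top).ne'
      · rw [ENNReal.inv_div (Or.inl ENNReal.coe_ne_top) (Or.inl hε'), mul_comm, ← mul_div_assoc,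
          ENNReal.div_le_iff (by simp) (by simp [hB]), mul_comm]
        gcongr
        exact le_self_add
    have hDCT : Tendsto (fun n => ∫⁻ ω, min (truncDens N lam n ω) K ∂gaussianLaw) atTop
        (𝓝 (∫⁻ ω, min (loopDens N lam ω) K ∂gaussianLaw)) := by
      refine tendsto_lintegral_of_dominated_convergence (fun _ => K)
        (fun n => (measurable_truncDens N lam n).min measurable_const)
        (fun n => ae_of_all _ fun ω => min_le_right _ _) (by simp [hK.2.1]) ?_
      filter_upwards [hlim] with ω hω using hω.min tendsto_const_nhds
    have h1 : ∀ n, ∫⁻ ω, truncDens N lam n ω ∂gaussianLaw ≤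
        (∫⁻ ω, min (truncDens N lam n ω) K ∂gaussianLaw) + ε := by
      intro n
      calc _ ≤ ∫⁻ ω, (min (truncDens N lam n ω) K + K⁻¹ * truncDens N lam n ω ^ 2) ∂gaussianLaw :=
            lintegral_mono fun ω => le_min_add_sq_div _ _ hK.1 hK.2.1
        _ = (∫⁻ ω, min (truncDens N lam n ω) K ∂gaussianLaw) +
            K⁻¹ * ∫⁻ ω, truncDens N lam n ω ^ 2 ∂gaussianLaw := by
            rw [lintegral_add_left ((measurable_truncDens N lam n).min measurable_const),
              lintegral_const_mul _ ((measurable_truncDens N lam n).pow_const 2)]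
        _ ≤ _ := by gcongr; exact (mul_le_mul_right (hsq n) _).trans hK.2.2
    refine (limsup_le_limsup (Eventually.of_forall h1)).trans ?_
    rw [(hDCT.add tendsto_const_nhds).limsup_eq]
    gcongr
    exact min_le_left _ _

/-! ### The Gibbs measures as images of measures on the sample space -/

open Classical in
/-- The map `U` as a map into `S`, with the value `z` where `U` is not in `S`. -/
def toSub (S : Set Field2) (z : S) (U : Sample → Field2) (ω : Sample) : S :=
  if h : U ω ∈ S then ⟨U ω, h⟩ else z

theorem toSub_of_mem {S : Set Field2} {z : S} {U : Sample → Field2} {ω : Sample} (h : U ω ∈ S) :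
    toSub S z U ω = ⟨U ω, h⟩ := by
  rw [toSub, dif_pos h]

theorem measurable_toSub {S : Set Field2} (hS : MeasurableSet S) (z : S) {U : Sample → Field2}
    (hU : Measurable U) : Measurable (toSub S z U) := by
  classical
  rw [← (MeasurableEmbedding.subtype_coe hS).measurable_comp_iff]
  have e : Subtype.val ∘ toSub S z U = fun ω => if U ω ∈ S then U ω else (z : Field2) := by
    ext1 ω
    by_cases h : U ω ∈ S <;> simp [toSub, h]
  rw [e]
  exact Measurable.ite (hU hS) hU measurable_const

theorem gibbsWeight_eq_map {S : Set Field2} (hS : MeasurableSet S) (z : S) {U : Sample → Field2}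
    (hU : Measurable U) (lam : ℝ) :
    gibbsWeight S (gaussianLaw.map U) lam = (gaussianLaw.withDensity fun ω => ENNReal.ofReal
      (S.indicator (fun u => Real.exp (lam / 4 * ∫ θ, ‖u θ‖ ^ 4 ∂circMeasure)) (U ω))).map
        (toSub S z U) := by
  have hE := measurable_exp_quartic lam
  ext A hA
  obtain ⟨B, hB, rfl⟩ := hA
  have hA' : MeasurableSet (Subtype.val ⁻¹' B : Set S) := measurable_subtype_coe hB
  have hT := measurable_toSub hS z hU
  rw [gibbsWeight, withDensity_apply _ hA', ← lintegral_indicator hA', Measure.map_apply hT hA',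
    withDensity_apply _ (hT hA'), ← lintegral_indicator (hT hA')]
  have h1 := lintegral_subtype_comap (μ := gaussianLaw.map U) hS (B.indicator fun u =>
    ENNReal.ofReal (Real.exp (lam / 4 * ∫ θ, ‖u θ‖ ^ 4 ∂circMeasure)))
  refine Eq.trans (Eq.trans (lintegral_congr fun x => ?_) h1) ?_
  · rfl
  · rw [← lintegral_indicator hS, lintegral_map ((hE.ennreal_ofReal.indicator hB).indicator hS) hU]
    refine lintegral_congr fun ω => ?_
    by_cases h : U ω ∈ S
    · by_cases h' : U ω ∈ B
      · have h2 : ω ∈ toSub S z U ⁻¹' (Subtype.val ⁻¹' B) := by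
          simp only [Set.mem_preimage, toSub_of_mem h]; exact h'
        rw [Set.indicator_of_mem h2, Set.indicator_of_mem h, Set.indicator_of_mem h',
          Set.indicator_of_mem h]
      · have h2 : ω ∉ toSub S z U ⁻¹' (Subtype.val ⁻¹' B) := by
          simp only [Set.mem_preimage, toSub_of_mem h]; exact h'
        rw [Set.indicator_of_notMem h2, Set.indicator_of_mem h, Set.indicator_of_notMem h']
    · rw [Set.indicator_of_notMem h]
      refine (Set.indicator_apply_eq_zero.2 fun _ => ?_).symm
      rw [Set.indicator_of_notMem h, ENNReal.ofReal_zero]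

theorem gibbsOn_eq_map {S : Set Field2} (hS : MeasurableSet S) (z : S) {U : Sample → Field2}
    (hU : Measurable U) (lam : ℝ) {R : Sample → ℝ≥0∞} (hR : Measurable R)
    (hRU : ∀ ω, ENNReal.ofReal
      (S.indicator (fun u => Real.exp (lam / 4 * ∫ θ, ‖u θ‖ ^ 4 ∂circMeasure)) (U ω)) = R ω) :
    gibbsOn S (gaussianLaw.map U) lam = (gaussianLaw.withDensity fun ω =>
      (∫⁻ ω, R ω ∂gaussianLaw)⁻¹ * R ω).map (toSub S z U) := by
  have hT := measurable_toSub hS z hU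
  rw [gibbsOn, gibbsWeight_eq_map hS z hU lam]
  simp only [hRU]
  rw [Measure.map_apply hT MeasurableSet.univ, Set.preimage_univ,
    withDensity_apply _ MeasurableSet.univ, Measure.restrict_univ, ← Measure.map_smul,
    ← withDensity_smul _ hR]
  rfl

theorem dirichlet_dirichlet (n : ℕ) (u : Field2) : dirichlet n (dirichlet n u) = dirichlet n u := by
  rw [dirichlet]
  conv_rhs => rw [dirichlet]
  refine Finset.sum_congr rfl fun j hj => ?_
  rw [fourierCoeff_eq_inner]
  congr 1
  exact orthonormal_fourier.inner_right_sum (fun j => fourierCoeff u j) hj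

theorem isClosed_truncBall (N : ℝ) (n : ℕ) : IsClosed (truncBall N n) := by
  have e : Set.range (dirichlet n) = {u | dirichlet n u = u} := by
    ext u
    refine ⟨?_, fun h => ⟨u, h⟩⟩
    rintro ⟨v, rfl⟩
    exact dirichlet_dirichlet n v
  rw [truncBall, e]
  exact (isClosed_ball N).inter (isClosed_eq (continuous_dirichlet n) continuous_id)

theorem zero_mem_ball {N : ℝ} (hN : 0 ≤ N) : (0 : Field2) ∈ ball N := by
  rw [mem_ball_iff]; simpa using hN

theorem zero_mem_truncBall {N : ℝ} (hN : 0 ≤ N) (n : ℕ) : (0 : Field2) ∈ truncBall N n := by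
  refine ⟨zero_mem_ball hN, 0, ?_⟩
  rw [dirichlet]
  refine Finset.sum_eq_zero fun j _ => ?_
  rw [fourierCoeff_eq_inner, inner_zero_right, zero_smul]

/-- The random field as a map into the ball. -/
def ballMap {N : ℝ} (hN : 0 ≤ N) : Sample → ball N := toSub _ ⟨0, zero_mem_ball hN⟩ loopSeries

/-- The truncated random field as a map into the ball. -/
def truncMap {N : ℝ} (hN : 0 ≤ N) (n : ℕ) : Sample → truncBall N n :=
  toSub _ ⟨0, zero_mem_truncBall hN n⟩ fun ω => dirichlet n (loopSeries ω)

theorem measurable_dirichlet_loopSeries (n : ℕ) :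
    Measurable fun ω => dirichlet n (loopSeries ω) :=
  (continuous_dirichlet n).measurable.comp measurable_loopSeries

theorem measurable_ballMap {N : ℝ} (hN : 0 ≤ N) : Measurable (ballMap hN) :=
  measurable_toSub (isClosed_ball N).measurableSet _ measurable_loopSeries

theorem measurable_truncMap {N : ℝ} (hN : 0 ≤ N) (n : ℕ) : Measurable (truncMap hN n) :=
  measurable_toSub (isClosed_truncBall N n).measurableSet _ (measurable_dirichlet_loopSeries n)

theorem gibbs_eq_map {N : ℝ} (hN : 0 ≤ N) (lam : ℝ) :
    gibbs N lam = (gaussianLaw.withDensity fun ω =>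
      (∫⁻ ω, loopDens N lam ω ∂gaussianLaw)⁻¹ * loopDens N lam ω).map (ballMap hN) :=
  gibbsOn_eq_map (isClosed_ball N).measurableSet _ measurable_loopSeries lam
    (measurable_loopDens N lam) fun _ => rfl

theorem truncGibbs_eq_map {N : ℝ} (hN : 0 ≤ N) (lam : ℝ) (n : ℕ) :
    truncGibbs N lam n = (gaussianLaw.withDensity fun ω =>
      (∫⁻ ω, truncDens N lam n ω ∂gaussianLaw)⁻¹ * truncDens N lam n ω).map (truncMap hN n) := by
  have e : loopMeasure.map (dirichlet n) = gaussianLaw.map fun ω => dirichlet n (loopSeries ω) := by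
    rw [loopMeasure, Measure.map_map (continuous_dirichlet n).measurable measurable_loopSeries]
    rfl
  rw [truncGibbs, e]
  refine gibbsOn_eq_map (isClosed_truncBall N n).measurableSet _
    (measurable_dirichlet_loopSeries n) lam (measurable_truncDens N lam n) fun ω => ?_
  rw [truncDens, dens]
  congr 1
  by_cases h : dirichlet n (loopSeries ω) ∈ ball N
  · have h' : dirichlet n (loopSeries ω) ∈ truncBall N n := ⟨h, _, rfl⟩
    rw [Set.indicator_of_mem h, Set.indicator_of_mem h']
  · have h' : dirichlet n (loopSeries ω) ∉ truncBall N n := fun h' => h h'.1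
    rw [Set.indicator_of_notMem h, Set.indicator_of_notMem h']

theorem lintegral_inv_mul_self {R : Sample → ℝ≥0∞} (hR : Measurable R)
    (h0 : ∫⁻ ω, R ω ∂gaussianLaw ≠ 0) (ht : ∫⁻ ω, R ω ∂gaussianLaw ≠ ∞) :
    ∫⁻ ω, (∫⁻ ω, R ω ∂gaussianLaw)⁻¹ * R ω ∂gaussianLaw = 1 := by
  rw [lintegral_const_mul _ hR, ENNReal.inv_mul_cancel h0 ht]

theorem isMetricProbabilitySpace_of_map {S : Set Field2} (hS : IsClosed S) {σ : Sample → ℝ≥0∞}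
    (hσ : ∫⁻ ω, σ ω ∂gaussianLaw = 1) {T : Sample → S} (hT : Measurable T) :
    IsMetricProbabilitySpace ((gaussianLaw.withDensity σ).map T) where
  borel := inferInstance
  complete := hS.completeSpace_coe
  separable := inferInstance
  prob := by
    have : IsProbabilityMeasure (gaussianLaw.withDensity σ) := ⟨by
      rw [withDensity_apply _ MeasurableSet.univ, Measure.restrict_univ, hσ]⟩
    exact Measure.isProbabilityMeasure_map hT.aemeasurable

/-! ### Transportation -/

theorem inv_smul_smul_measure {X : Type*} [MeasurableSpace X] {μ : Measure X} {ε : ℝ≥0∞}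
    (h : μ Set.univ = ε) (hε : ε ≠ ∞) :
    ε⁻¹ • ε • μ = μ := by
  rcases eq_or_ne ε 0 with h0 | h0
  · rw [h0, Measure.measure_univ_eq_zero] at h
    rw [h]; simp
  · rw [smul_smul, ENNReal.inv_mul_cancel h0 hε, one_smul]

section Transport

variable {X Y Ω : Type*} [MetricSpace X] [MetricSpace Y] [MeasurableSpace X] [MeasurableSpace Y]
  [MeasurableSpace Ω] {γ : Measure Ω}

/-- Transportation between two measures with densities: the common part of the densities stays at
the same point of `Ω`, the rest is moved by the product coupling. -/
theorem transportDist_le [SFinite γ] {σ τ : Ω → ℝ≥0∞} (hσ : Measurable σ) (hτ : Measurable τ)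
    (hσ1 : ∫⁻ ω, σ ω ∂γ = 1) (hτ1 : ∫⁻ ω, τ ω ∂γ = 1) {p : Ω → X} {q : Ω → Y}
    (hp : Measurable p) (hq : Measurable q) {δ : X ⊕ Y → X ⊕ Y → ℝ≥0∞} (hδ : IsMetricCoupling δ)
    (hδm : Measurable fun z : X × Y => δ (Sum.inl z.1) (Sum.inr z.2)) {M : ℝ≥0∞}
    (hM : ∀ x y, δ (Sum.inl x) (Sum.inr y) ^ 2 ≤ M) :
    transportDist ((γ.withDensity σ).map p) ((γ.withDensity τ).map q) ≤
      ((∫⁻ ω, τ ω * δ (Sum.inl (p ω)) (Sum.inr (q ω)) ^ 2 ∂γ) + M * ∫⁻ ω, (τ ω - σ ω) ∂γ) ^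
        (1 / 2 : ℝ) := by
  set ε := ∫⁻ ω, (τ ω - σ ω) ∂γ with hε
  have hmin : Measurable fun ω => min (σ ω) (τ ω) := hσ.min hτ
  have eσ : (fun ω => min (σ ω) (τ ω)) + (fun ω => σ ω - τ ω) = σ := by
    ext ω
    rw [Pi.add_apply, add_comm]; exact tsub_add_min
  have eτ : (fun ω => min (σ ω) (τ ω)) + (fun ω => τ ω - σ ω) = τ := by
    ext ω
    rw [Pi.add_apply, add_comm, min_comm]; exact tsub_add_min
  have i1 : (∫⁻ ω, min (σ ω) (τ ω) ∂γ) + ∫⁻ ω, (σ ω - τ ω) ∂γ = 1 := by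
    rw [← lintegral_add_left hmin, ← hσ1]
    exact lintegral_congr fun ω => congrFun eσ ω
  have i2 : (∫⁻ ω, min (σ ω) (τ ω) ∂γ) + ε = 1 := by
    rw [hε, ← lintegral_add_left hmin, ← hτ1]
    exact lintegral_congr fun ω => congrFun eτ ω
  have hmt : ∫⁻ ω, min (σ ω) (τ ω) ∂γ ≠ ∞ := fun h => by simp [h] at i1
  have hεt : ε ≠ ∞ := fun h => by simp [h] at i2
  have i3 : ∫⁻ ω, (σ ω - τ ω) ∂γ = ε := by
    rw [← i2] at i1
    exact (ENNReal.add_right_inj hmt).1 i1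
  set μ₁ := (γ.withDensity fun ω => σ ω - τ ω).map p with hμ₁
  set μ₂ := (γ.withDensity fun ω => τ ω - σ ω).map q with hμ₂
  have u1 : μ₁ Set.univ = ε := by
    rw [hμ₁, Measure.map_apply hp MeasurableSet.univ, Set.preimage_univ,
      withDensity_apply _ MeasurableSet.univ, Measure.restrict_univ, i3]
  have u2 : μ₂ Set.univ = ε := by
    rw [hμ₂, Measure.map_apply hq MeasurableSet.univ, Set.preimage_univ,
      withDensity_apply _ MeasurableSet.univ, Measure.restrict_univ]
  have cancel₁ : ε⁻¹ • ε • μ₁ = μ₁ := inv_smul_smul_measure u1 hεt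
  have cancel₂ : ε⁻¹ • ε • μ₂ = μ₂ := inv_smul_smul_measure u2 hεt
  set π : Measure (X × Y) := (γ.withDensity fun ω => min (σ ω) (τ ω)).map (fun ω => (p ω, q ω)) +
    ε⁻¹ • μ₁.prod μ₂ with hπ
  have hpq : Measurable fun ω => (p ω, q ω) := hp.prodMk hq
  have m1 : π.map Prod.fst = (γ.withDensity σ).map p := by
    rw [hπ, Measure.map_add _ _ measurable_fst, Measure.map_map measurable_fst hpq,
      Measure.map_smul, Measure.map_fst_prod, u2, cancel₁, hμ₁]
    conv_rhs => rw [← eσ, withDensity_add_left hmin, Measure.map_add _ _ hp]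
    rfl
  have m2 : π.map Prod.snd = (γ.withDensity τ).map q := by
    rw [hπ, Measure.map_add _ _ measurable_snd, Measure.map_map measurable_snd hpq,
      Measure.map_smul, Measure.map_snd_prod, u1, cancel₂, hμ₂]
    conv_rhs => rw [← eτ, withDensity_add_left hmin, Measure.map_add _ _ hq]
    rfl
  refine (iInf₂_le δ hδ).trans ((iInf_le _ π).trans ((iInf₂_le m1 m2).trans ?_))
  refine ENNReal.rpow_le_rpow ?_ (by norm_num)
  have hδω : Measurable fun ω => δ (Sum.inl (p ω)) (Sum.inr (q ω)) ^ 2 :=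
    (hδm.comp hpq).pow_const 2
  rw [hπ, lintegral_add_measure, lintegral_smul_measure, lintegral_map (hδm.pow_const 2) hpq,
    lintegral_withDensity_eq_lintegral_mul _ hmin hδω]
  refine add_le_add (lintegral_mono fun ω => ?_) ?_
  · exact mul_le_mul_left (min_le_right _ _) _
  · calc ε⁻¹ • ∫⁻ z, δ (Sum.inl z.1) (Sum.inr z.2) ^ 2 ∂μ₁.prod μ₂
        ≤ ε⁻¹ • ∫⁻ _z, M ∂μ₁.prod μ₂ := by
          rw [smul_eq_mul, smul_eq_mul]
          gcongr
          exact hM _ _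
      _ = ε⁻¹ * (M * (ε * ε)) := by
          rw [lintegral_const, smul_eq_mul, ← Set.univ_prod_univ, Measure.prod_prod, u1, u2]
      _ ≤ M * ε := by
          rcases eq_or_ne ε 0 with h0 | h0
          · simp [h0]
          · have : ε⁻¹ * (M * (ε * ε)) = M * ε * (ε⁻¹ * ε) := by ring
            rw [this, ENNReal.inv_mul_cancel h0 hεt, mul_one]

end Transport

/-- The metric coupling of two subsets of a metric space. -/
def subsetCoupling {E : Type*} [MetricSpace E] (S T : Set E) (z w : S ⊕ T) : ℝ≥0∞ :=
  edist (Sum.elim Subtype.val Subtype.val z : E) (Sum.elim Subtype.val Subtype.val w)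

theorem isMetricCoupling_subsetCoupling {E : Type*} [MetricSpace E] (S T : Set E) :
    IsMetricCoupling (subsetCoupling S T) where
  self _ := edist_self _
  symm _ _ := edist_comm _ _
  triangle _ _ _ := edist_triangle _ _ _
  left _ _ := rfl
  right _ _ := rfl

theorem edist_le_of_mem_ball {N : ℝ} {u v : Field2} (hu : u ∈ ball N) (hv : v ∈ ball N) :
    edist u v ≤ ENNReal.ofReal (2 * √N) := by
  have h1 : ‖u‖ ≤ √N := Real.le_sqrt_of_sq_le (mem_ball_iff.1 hu)
  have h2 : ‖v‖ ≤ √N := Real.le_sqrt_of_sq_le (mem_ball_iff.1 hv)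
  rw [edist_dist, dist_eq_norm]
  exact ENNReal.ofReal_le_ofReal (by linarith [norm_sub_le u v])

theorem tendsto_transportDist {N lam : ℝ} (hN : 0 < N) (hlam : 0 < lam)
    (h : N * (2 * lam) < 3 / (7 * Real.pi ^ 2)) :
    Tendsto (fun n : ℕ => transportDist (truncGibbs N lam n) (gibbs N lam)) atTop (𝓝 0) := by
  have h' : N * lam < 3 / (7 * Real.pi ^ 2) := by nlinarith [mul_pos hN hlam]
  set Z := ∫⁻ ω, loopDens N lam ω ∂gaussianLaw with hZ
  set Zn : ℕ → ℝ≥0∞ := fun n => ∫⁻ ω, truncDens N lam n ω ∂gaussianLaw with hZn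
  have hZ0 : Z ≠ 0 := (lintegral_loopDens_pos hN hlam).ne'
  have hZt : Z ≠ ∞ := lintegral_loopDens_ne_top hN hlam h'
  set τ : Sample → ℝ≥0∞ := fun ω => Z⁻¹ * loopDens N lam ω with hτd
  set σ : ℕ → Sample → ℝ≥0∞ := fun n ω => (Zn n)⁻¹ * truncDens N lam n ω with hσd
  have hτ : Measurable τ := (measurable_loopDens N lam).const_mul _
  have hσ : ∀ n, Measurable (σ n) := fun n => (measurable_truncDens N lam n).const_mul _
  have hτ1 : ∫⁻ ω, τ ω ∂gaussianLaw = 1 :=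
    lintegral_inv_mul_self (measurable_loopDens N lam) hZ0 hZt
  have hσ1 : ∀ n, ∫⁻ ω, σ n ω ∂gaussianLaw = 1 := fun n =>
    lintegral_inv_mul_self (measurable_truncDens N lam n) (lintegral_truncDens_pos hN hlam n).ne'
      (lintegral_truncDens_ne_top hN hlam h' n)
  set M : ℝ≥0∞ := ENNReal.ofReal (2 * √N) ^ 2
  have hMt : M ≠ ∞ := ENNReal.pow_ne_top ENNReal.ofReal_ne_top
  have hle : ∀ n, transportDist (truncGibbs N lam n) (gibbs N lam) ≤
      ((∫⁻ ω, τ ω * edist (truncMap hN.le n ω : Field2) (ballMap hN.le ω) ^ 2 ∂gaussianLaw) +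
        M * ∫⁻ ω, (τ ω - σ n ω) ∂gaussianLaw) ^ (1 / 2 : ℝ) := by
    intro n
    rw [truncGibbs_eq_map hN.le, gibbs_eq_map hN.le]
    refine transportDist_le (hσ n) hτ (hσ1 n) hτ1 (measurable_truncMap hN.le n)
      (measurable_ballMap hN.le) (isMetricCoupling_subsetCoupling _ _) ?_ fun x y => ?_
    · exact (measurable_subtype_coe.comp measurable_fst).edist
        (measurable_subtype_coe.comp measurable_snd)
    · exact pow_le_pow_left' (edist_le_of_mem_ball x.2.1 y.2) 2
  refine tendsto_of_tendsto_of_tendsto_of_le_of_le tendsto_const_nhds ?_ (fun _ => zero_le) hle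
  have hI1 : Tendsto (fun n => ∫⁻ ω, τ ω * edist (truncMap hN.le n ω : Field2)
      (ballMap hN.le ω) ^ 2 ∂gaussianLaw) atTop (𝓝 0) := by
    have h0 : ∫⁻ _ω : Sample, (0 : ℝ≥0∞) ∂gaussianLaw = 0 := by simp
    rw [← h0]
    refine tendsto_lintegral_of_dominated_convergence (fun ω => τ ω * M) (fun n => ?_)
      (fun n => ae_of_all _ fun ω => ?_) ?_ ?_
    · exact hτ.mul (((measurable_subtype_coe.comp (measurable_truncMap hN.le n)).edist
        (measurable_subtype_coe.comp (measurable_ballMap hN.le))).pow_const 2)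
    · exact mul_le_mul_right (pow_le_pow_left'
        (edist_le_of_mem_ball (truncMap hN.le n ω).2.1 (ballMap hN.le ω).2) 2) _
    · rw [lintegral_mul_const _ hτ, hτ1, one_mul]; exact hMt
    · filter_upwards [ae_sqSummable] with ω hω
      by_cases hb : loopSeries ω ∈ ball N
      · have hn : ∀ n, dirichlet n (loopSeries ω) ∈ truncBall N n := fun n =>
          ⟨(dirichlet_loopSeries hω n).symm ▸
            mem_ball_iff.2 ((norm_modeSum_le hω _).trans (mem_ball_iff.1 hb)), _, rfl⟩
        have e1 : ∀ n, (truncMap hN.le n ω : Field2) = modeSum (freqs n) ω := fun n => by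
          rw [truncMap, toSub_of_mem (hn n)]; exact dirichlet_loopSeries hω n
        have e2 : (ballMap hN.le ω : Field2) = loopSeries ω := by
          rw [ballMap, toSub_of_mem hb]
        simp only [e1, e2]
        have h1 := tendsto_iff_edist_tendsto_0.1 (tendsto_modeSum hω)
        have h2 := ((ENNReal.continuous_pow 2).tendsto _).comp h1
        have hτt : τ ω ≠ ∞ := ENNReal.mul_ne_top (ENNReal.inv_ne_top.2 hZ0) ENNReal.ofReal_ne_top
        have h3 := ENNReal.Tendsto.const_mul h2 (Or.inr hτt)
        simpa using h3
      · have : τ ω = 0 := by simp [hτd, loopDens, dens, hb]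
        simp [this]
  have hI2 : Tendsto (fun n => ∫⁻ ω, (τ ω - σ n ω) ∂gaussianLaw) atTop (𝓝 0) := by
    have h0 : ∫⁻ _ω : Sample, (0 : ℝ≥0∞) ∂gaussianLaw = 0 := by simp
    rw [← h0]
    refine tendsto_lintegral_of_dominated_convergence τ (fun n => hτ.sub (hσ n))
      (fun n => ae_of_all _ fun ω => tsub_le_self) (by simp [hτ1]) ?_
    have hZl := tendsto_lintegral_truncDens hN hlam h
    filter_upwards [ae_tendsto_truncDens N lam] with ω hω
    have hτt : τ ω ≠ ∞ := ENNReal.mul_ne_top (ENNReal.inv_ne_top.2 hZ0) ENNReal.ofReal_ne_top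
    have h1 : Tendsto (fun n => σ n ω) atTop (𝓝 (τ ω)) :=
      ENNReal.Tendsto.mul (tendsto_inv_iff.2 hZl) (Or.inr ENNReal.ofReal_ne_top) hω
        (Or.inr (ENNReal.inv_ne_top.2 hZ0))
    have h2 := ENNReal.Tendsto.sub (tendsto_const_nhds (x := τ ω)) h1 (Or.inl hτt)
    simpa using h2
  have h3 := hI1.add (ENNReal.Tendsto.const_mul hI2 (Or.inr hMt))
  have h4 := ((ENNReal.continuous_rpow_const (y := (1 / 2 : ℝ))).tendsto _).comp h3
  simpa [Function.comp_def] using h4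

/-! ### The Gibbs measure -/

theorem integrable_weighted_one {N lam : ℝ} (hN : 0 < N) (hlam : 0 < lam)
    (h : N * lam < 3 / (7 * Real.pi ^ 2)) :
    Integrable (weighted N lam fun _ => 1) gaussianLaw := by
  have hm := measurable_weighted N lam (h := fun _ => 1) measurable_const
  refine ⟨hm.aestronglyMeasurable, ?_⟩
  have e : weighted N lam (fun _ => 1) = fun ω => dens N lam (loopSeries ω) := by
    ext ω; simp [weighted]
  rw [e, hasFiniteIntegral_iff_ofReal (ae_of_all _ fun ω => dens_nonneg _ _ _)]
  exact (lintegral_loopDens_ne_top hN hlam h).lt_top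

theorem integral_weighted_one (N lam : ℝ) :
    ∫ ω, weighted N lam (fun _ => 1) ω ∂gaussianLaw =
      (∫⁻ ω, loopDens N lam ω ∂gaussianLaw).toReal := by
  have hm := measurable_weighted N lam (h := fun _ => 1) measurable_const
  rw [integral_eq_lintegral_of_nonneg_ae (ae_of_all _ fun ω => ?_) hm.aestronglyMeasurable]
  · simp [weighted, loopDens]
  · simpa [weighted] using dens_nonneg _ _ _

theorem toReal_density_mul {N : ℝ} (hN : 0 ≤ N) (lam : ℝ) (Z : ℝ≥0∞) (h : Field2 → ℝ) (ω : Sample) :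
    (Z⁻¹ * loopDens N lam ω).toReal * h (ballMap hN ω) = Z.toReal⁻¹ * weighted N lam h ω := by
  rw [ENNReal.toReal_mul, ENNReal.toReal_inv, loopDens, ENNReal.toReal_ofReal (dens_nonneg _ _ _),
    weighted]
  by_cases hb : loopSeries ω ∈ ball N
  · rw [ballMap, toSub_of_mem hb]; ring
  · simp [dens, hb]

theorem integral_gibbs {N lam : ℝ} (hN : 0 < N) (hlam : 0 < lam) {h : Field2 → ℝ}
    (hh : Measurable h) :
    ∫ x : ball N, h x ∂gibbs N lam =
      (∫⁻ ω, loopDens N lam ω ∂gaussianLaw).toReal⁻¹ * ∫ ω, weighted N lam h ω ∂gaussianLaw := by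
  have hZ := (lintegral_loopDens_pos hN hlam).ne'
  have hv : AEStronglyMeasurable (fun x : ball N => h x) ((gaussianLaw.withDensity fun ω =>
      (∫⁻ ω, loopDens N lam ω ∂gaussianLaw)⁻¹ * loopDens N lam ω).map (ballMap hN.le)) :=
    (hh.comp measurable_subtype_coe).aestronglyMeasurable
  rw [gibbs_eq_map hN.le, integral_map (measurable_ballMap hN.le).aemeasurable hv,
    integral_withDensity_eq_integral_toReal_smul ((measurable_loopDens N lam).const_mul _)
    (ae_of_all _ fun ω => ENNReal.mul_lt_top (ENNReal.inv_ne_top.2 hZ).lt_top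
      ENNReal.ofReal_lt_top)]
  simp only [smul_eq_mul, toReal_density_mul]
  rw [integral_const_mul]

theorem integrable_weighted_of_gibbs {N lam : ℝ} (hN : 0 < N) (hlam : 0 < lam)
    (hsmall : N * lam < 3 / (7 * Real.pi ^ 2)) {h : Field2 → ℝ} (hh : Measurable h)
    (hi : Integrable (fun x : ball N => h x) (gibbs N lam)) :
    Integrable (weighted N lam h) gaussianLaw := by
  have hZ := (lintegral_loopDens_pos hN hlam).ne'
  have hZt := lintegral_loopDens_ne_top hN hlam hsmall
  have hv : AEStronglyMeasurable (fun x : ball N => h x) ((gaussianLaw.withDensity fun ω =>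
      (∫⁻ ω, loopDens N lam ω ∂gaussianLaw)⁻¹ * loopDens N lam ω).map (ballMap hN.le)) :=
    (hh.comp measurable_subtype_coe).aestronglyMeasurable
  rw [gibbs_eq_map hN.le, integrable_map_measure hv (measurable_ballMap hN.le).aemeasurable,
    integrable_withDensity_iff_integrable_smul' ((measurable_loopDens N lam).const_mul _)
    (ae_of_all _ fun ω => ENNReal.mul_lt_top (ENNReal.inv_ne_top.2 hZ).lt_top
      ENNReal.ofReal_lt_top)] at hi
  simp only [smul_eq_mul, Function.comp_apply, toReal_density_mul] at hi
  have := hi.const_mul (∫⁻ ω, loopDens N lam ω ∂gaussianLaw).toReal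
  refine this.congr (ae_of_all _ fun ω => ?_)
  have h0 := (ENNReal.toReal_pos hZ hZt).ne'
  simp only
  rw [← mul_assoc, mul_inv_cancel₀ h0, one_mul]

/-- The logarithmic Sobolev inequality for bounded functions and the Gibbs measure. -/
theorem entropy_gibbs_le_of_bounded {N lam c : ℝ} (hN : 0 < N) (hlam : 0 < lam)
    (hsmall : N * lam < 3 / (7 * Real.pi ^ 2))
    (hc : c ≤ 1 - Real.pi ^ 2 * N * lam) (hc0 : 0 < c)
    {F G : ball N → ℝ} {a b : ℝ} (hF : Continuous F) (ha : 0 < a) (hFa : ∀ x, a ≤ F x)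
    (hFb : ∀ x, F x ≤ b) (hG : Measurable G) (hG0 : ∀ x, 0 ≤ G x)
    (hG2 : Integrable (fun x => G x ^ 2) (gibbs N lam))
    (hslope : ∀ x, ∀ η > 0, ∀ᶠ y in 𝓝 x, |F y - F x| ≤ (G x + η) * dist y x) :
    (∫ x, F x ^ 2 * Real.log (F x ^ 2) ∂gibbs N lam) -
      (∫ x, F x ^ 2 ∂gibbs N lam) * Real.log (∫ x, F x ^ 2 ∂gibbs N lam) ≤
        2 / c * ∫ x, G x ^ 2 ∂gibbs N lam := by
  have hemb : MeasurableEmbedding (Subtype.val : ball N → Field2) :=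
    MeasurableEmbedding.subtype_coe (isClosed_ball N).measurableSet
  set F' : Field2 → ℝ := Function.extend Subtype.val F fun _ => a with hF'
  set G' : Field2 → ℝ := Function.extend Subtype.val G fun _ => 0 with hG'
  have hFx : ∀ x : ball N, F' x = F x := fun x => Subtype.val_injective.extend_apply _ _ x
  have hGx : ∀ x : ball N, G' x = G x := fun x => Subtype.val_injective.extend_apply _ _ x
  have hF'm : Measurable F' := hemb.measurable_extend hF.measurable measurable_const
  have hG'm : Measurable G' := hemb.measurable_extend hG measurable_const
  have hF'c : ContinuousOn F' (ball N) := by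
    rw [continuousOn_iff_continuous_domRestrict]
    have e : (ball N).domRestrict F' = F := funext hFx
    rwa [e]
  have hG'0 : ∀ u, 0 ≤ G' u := fun u => by
    by_cases hu : u ∈ ball N
    · rw [hGx ⟨u, hu⟩]; exact hG0 _
    · rw [hG', Function.extend_apply' _ _ _ (by rintro ⟨x, rfl⟩; exact hu x.2)]
  have hi : Integrable (weighted N lam fun u => G' u ^ 2) gaussianLaw := by
    refine integrable_weighted_of_gibbs hN hlam hsmall (hG'm.pow_const 2) ?_
    simpa only [hGx] using hG2
  have hZ := (lintegral_loopDens_pos hN hlam).ne'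
  have hZt := lintegral_loopDens_ne_top hN hlam hsmall
  have hZ0 := ENNReal.toReal_pos hZ hZt
  have h1 := entropy_weighted_le_of_bounded hlam hc hc0 (integrable_weighted_one hN hlam hsmall)
    (by rw [integral_weighted_one]; exact hZ0) hF'm hF'c ha (fun u hu => by rw [hFx ⟨u, hu⟩]; exact hFa _)
    (fun u hu => by rw [hFx ⟨u, hu⟩]; exact hFb _) hG'm hG'0 (fun u hu η hη => by
      have h2 := hslope ⟨u, hu⟩ η hη
      rw [nhds_subtype_eq_comap, eventually_comap] at h2
      rw [eventually_nhdsWithin_iff]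
      filter_upwards [h2] with v hv hvb
      have h3 := hv ⟨v, hvb⟩ rfl
      rw [hFx ⟨u, hu⟩, hFx ⟨v, hvb⟩, hGx ⟨u, hu⟩]
      rwa [Subtype.dist_eq, dist_eq_norm] at h3) hi
  have e1 := integral_gibbs hN hlam (h := fun u => F' u ^ 2 * Real.log (F' u ^ 2)) (by fun_prop)
  have e2 := integral_gibbs hN hlam (h := fun u => F' u ^ 2) (by fun_prop)
  have e3 := integral_gibbs hN hlam (h := fun u => G' u ^ 2) (by fun_prop)
  simp only [hFx] at e1 e2
  simp only [hGx] at e3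
  rw [e1, e2, e3]
  rw [integral_weighted_one] at h1
  have h4 := mul_le_mul_of_nonneg_left h1 (inv_pos.2 hZ0).le
  rw [div_eq_inv_mul] at h4
  linarith

theorem isLengthSpace_ball (N : ℝ) : IsLengthSpace (ball N) := by
  intro x y
  refine le_antisymm (le_iInf fun γ => ?_) ?_
  · have := eVariationOn.edist_le γ (Set.mem_univ 0) (Set.mem_univ 1)
    rwa [γ.source, γ.target] at this
  · let γ : Path x y :=
      { toFun := fun t => ⟨AffineMap.lineMap (x : Field2) (y : Field2) (t : ℝ),
          (convex_ball N).lineMap_mem x.2 y.2 t.2⟩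
        continuous_toFun := by
          refine Continuous.subtype_mk ?_ _
          exact AffineMap.lineMap_continuous.comp continuous_subtype_val
        source' := Subtype.ext (by simp)
        target' := Subtype.ext (by simp) }
    refine (iInf_le _ γ).trans ?_
    have h1 : eVariationOn (Subtype.val : unitInterval → ℝ) Set.univ ≤ 1 := by
      have hm : MonotoneOn (Subtype.val : unitInterval → ℝ) Set.univ := fun _ _ _ _ h => h
      have := (hm.eVariationOn_eq (Set.mem_univ 0) (Set.mem_univ 1)).le
      have e : (Set.univ ∩ Set.Icc 0 1 : Set unitInterval) = Set.univ := by
        exact Set.inter_eq_left.2 fun t _ => ⟨t.2.1, t.2.2⟩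
      rw [e] at this
      simpa using this
    have h2 := (lipschitzWith_lineMap (𝕜 := ℝ) (x : Field2) (y : Field2)).lipschitzOnWith (s := Set.univ)
      |>.comp_eVariationOn_le (g := (Subtype.val : unitInterval → ℝ)) (s := Set.univ)
        (Set.mapsTo_univ _ _)
    calc eVariationOn γ Set.univ ≤ _ := h2
      _ ≤ (nndist (x : Field2) (y : Field2) : ℝ≥0∞) * 1 := by gcongr
      _ = edist x y := by rw [mul_one, ← edist_nndist]; rfl

theorem neBot_nhdsNE_ball {N : ℝ} (hN : 0 < N) (x : ball N) : (𝓝[≠] x).NeBot := by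
  have : ConnectedSpace (ball N) := Subtype.connectedSpace
    ((convex_ball N).isConnected ⟨0, zero_mem_ball hN.le⟩)
  have hn : ‖(fourierLp 2 0 : Field2)‖ = 1 := orthonormal_fourier.1 0
  have hm : (√N : ℂ) • (fourierLp 2 0 : Field2) ∈ ball N := by
    rw [mem_ball_iff, norm_smul, hn, mul_one, Complex.norm_real, Real.norm_eq_abs, sq_abs,
      Real.sq_sqrt hN.le]
  have : Nontrivial (ball N) := by
    refine ⟨⟨0, zero_mem_ball hN.le⟩, ⟨_, hm⟩, fun h => ?_⟩
    have h1 := congrArg (fun z : ball N => ‖(z : Field2)‖) h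
    simp only [norm_zero, norm_smul, hn, mul_one, Complex.norm_real, Real.norm_eq_abs] at h1
    exact (abs_pos.2 (Real.sqrt_pos.2 hN).ne').ne h1
  infer_instance

theorem mmDiam_lt_top {N : ℝ} (μ : Measure (ball N)) : mmDiam μ < ∞ :=
  (Metric.ediam_le fun (x : ball N) _ (y : ball N) _ => edist_le_of_mem_ball x.2 y.2).trans_lt
    ENNReal.ofReal_lt_top

theorem isMetricProbabilitySpace_gibbs {N lam : ℝ} (hN : 0 < N) (hlam : 0 < lam)
    (h : N * lam < 3 / (7 * Real.pi ^ 2)) : IsMetricProbabilitySpace (gibbs N lam) := by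
  rw [gibbs_eq_map hN.le]
  exact isMetricProbabilitySpace_of_map (isClosed_ball N) (lintegral_inv_mul_self
    (measurable_loopDens N lam) (lintegral_loopDens_pos hN hlam).ne'
    (lintegral_loopDens_ne_top hN hlam h)) (measurable_ballMap hN.le)

theorem isMetricProbabilitySpace_truncGibbs {N lam : ℝ} (hN : 0 < N) (hlam : 0 < lam)
    (h : N * lam < 3 / (7 * Real.pi ^ 2)) (n : ℕ) :
    IsMetricProbabilitySpace (truncGibbs N lam n) := by
  rw [truncGibbs_eq_map hN.le]
  exact isMetricProbabilitySpace_of_map (isClosed_truncBall N n) (lintegral_inv_mul_self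
    (measurable_truncDens N lam n) (lintegral_truncDens_pos hN hlam n).ne'
    (lintegral_truncDens_ne_top hN hlam h n)) (measurable_truncMap hN.le n)

theorem satisfiesLSI_gibbs {N lam c : ℝ} (hN : 0 < N) (hlam : 0 < lam)
    (h : N * lam < 3 / (7 * Real.pi ^ 2)) (hc : c ≤ 1 - Real.pi ^ 2 * N * lam) (hc0 : 0 < c) :
    SatisfiesLSI (gibbs N lam) c where
  space := isMetricProbabilitySpace_gibbs hN hlam h
  length := isLengthSpace_ball N
  noIsolated := neBot_nhdsNE_ball hN
  pos := hc0
  lsi f hf hfin hg := by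
    have := (isMetricProbabilitySpace_gibbs hN hlam h).prob
    exact lsi_of_bounded (by positivity) (fun F G a b hF ha hFa hFb hG hG0 hG2 hs =>
      entropy_gibbs_le_of_bounded hN hlam h hc hc0 hF ha hFa hFb hG hG0 hG2 hs) hf hfin hg

end NLSGibbs

end

open NLSGibbs in
theorem theorem3p2 (N lam : ℝ) (hN : 0 < N) (hpos : 0 < N * lam)
    (hsmall : N * lam < 3 / (14 * Real.pi ^ 2)) :
    IsMetricProbabilitySpace (gibbs N lam) ∧
    (∀ n : ℕ, IsMetricProbabilitySpace (truncGibbs N lam n)) ∧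
    mmDiam (gibbs N lam) < ∞ ∧
    SatisfiesLSI (gibbs N lam) (1 - 14 * Real.pi ^ 2 * N * lam / 3) ∧
    Tendsto (fun n : ℕ => transportDist (truncGibbs N lam n) (gibbs N lam)) atTop (𝓝 0) := by
  have hlam : 0 < lam := (pos_iff_pos_of_mul_pos hpos).1 hN
  have hπ : 0 < Real.pi ^ 2 := by positivity
  have h1 : N * (2 * lam) < 3 / (7 * Real.pi ^ 2) := by
    have e : 3 / (7 * Real.pi ^ 2) = 2 * (3 / (14 * Real.pi ^ 2)) := by field_simp; norm_num
    rw [e]; linarith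
  have h2 : N * lam < 3 / (7 * Real.pi ^ 2) := by linarith
  have h3 : 14 * Real.pi ^ 2 * N * lam / 3 < 1 := by
    rw [lt_div_iff₀ (by positivity)] at hsmall
    linarith
  have h4 : 0 < Real.pi ^ 2 * N * lam := by positivity
  exact ⟨isMetricProbabilitySpace_gibbs hN hlam h2,
    isMetricProbabilitySpace_truncGibbs hN hlam h2, mmDiam_lt_top _,
    satisfiesLSI_gibbs hN hlam h2 (by linarith) (by linarith), tendsto_transportDist hN hlam h1⟩
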